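/- Let $\phi_\sigma,\phi_\varepsilon\in\mathcal E'(\mathbb R)$ be distributions with support in $[0,1]$, and set $\Phi_\sigma(s)=\langle\phi_\sigma(\alpha),s^\alpha\rangle$, $\Phi_\varepsilon(s)=\langle\phi_\varepsilon(\alpha),s^\alpha\rangle$ for $\operatorname{Re}s>0$, with the principal branch of $s^\alpha$. Let $\mathcal S'_+$ be the space of tempered distributions on $\mathbb R$ supported in $[0,\infty)$, and $\mathcal S'(\mathbb R\times\mathbb R_+)$ the space of tempered distributions on $\mathbb R^2$, in the variables $(x,t)$, that vanish for $t<0$. For $y\in\mathcal S'_+$ write $\mathcal L y(s)=\langle y(t),e^{-st}\rangle$, $\operatorname{Re}s>0$. Let $u_0,v_0\in\mathcal S'(\mathbb R)$, and assume: - (A1) $\mathcal L^{-1}(\Phi_\varepsilon/\Phi_\sigma)$ exists in $\mathcal S'_+$, i.e. there is $a\in\mathcal S'_+$ with $\mathcal L a(s)=\Phi_\varepsilon(s)/\Phi_\sigma(s)$ for $\operatorname{Re}s>0$; - (A2) $s^2\,\Phi_\sigma(s)/\Phi_\varepsilon(s)\in\mathbb C\setminus(-\infty,0]$ for all $s$ with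 $\operatorname{Re}s>0$; - (A3) $\mathcal L^{-1}(\Phi_\sigma/\Phi_\varepsilon)$ exists in $\mathcal S'_+$. For $\operatorname{Re}s>0$ let $\sqrt{\Phi_\sigma(s)/\Phi_\varepsilon(s)}$ denote the square root for which $\operatorname{Re}\bigl(s\sqrt{\Phi_\sigma(s)/\Phi_\varepsilon(s)}\bigr)>0$ (it exists by (A2)). Then there is a distribution $S\in\mathcal S'(\mathbb R\times\mathbb R_+)$ whose Laplace transform with respect to $t$ is, for $\operatorname{Re}s>0$, $$\tilde S(x,s)=\frac1{2s}\sqrt{\frac{\Phi_\sigma(s)}{\Phi_\varepsilon(s)}}\;\exp\Bigl(-|x|\,s\sqrt{\frac{\Phi_\sigma(s)}{\Phi_\varepsilon(s)}}\Bigr).$$ This $S$ is a fundamental solution of $P=\partial_t^2-a*_t\partial_x^2$, i.e. $PS=\delta(x,t)$. The convolution $u=S*_{x,t}\bigl(u_0(x)\delta'(t)+v_0(x)\delta(t)\bigr)$ exists in $\mathcal S'(\mathbb R\times\mathbb R_+)$, and $u$ is the unique solution in $\mathcal S'(\mathbb R\times\mathbb R_+)$ of the generalized Cauchy problem $$\frac{\partial^2u}{\partial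 t^2}=\mathcal L^{-1}\Bigl(\frac{\Phi_\varepsilon}{\Phi_\sigma}\Bigr)*_t\frac{\partial^2u}{\partial x^2}+u_0(x)\,\delta'(t)+v_0(x)\,\delta(t).$$ -/

import Mathlib

open scoped SchwartzMap ContDiff LineDeriv

namespace ViscoWave

noncomputable section

/-- A smooth cutoff function with compact support, equal to `1` on `[-1/2, 3/2]`. -/
def powBump : ContDiffBump (1 / 2 : ℝ) where
  rIn := 1
  rOut := 2
  rIn_pos := one_pos
  rIn_lt_rOut := one_lt_two

/-- The test function `α ↦ s ^ α`, cut off outside a neighbourhood of `[0, 1]`; here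
`s ^ α = exp (α log s)` with the principal branch of the logarithm. -/
def powTest (s : ℂ) : 𝓢(ℝ, ℂ) :=
  HasCompactSupport.toSchwartzMap
    (f := fun α : ℝ => (powBump α : ℂ) * Complex.exp ((α : ℂ) * Complex.log s))
    (by
      apply HasCompactSupport.mul_right
      exact powBump.hasCompactSupport.comp_left (g := fun r : ℝ => (r : ℂ)) Complex.ofReal_zero)
    (by
      have h1 : ContDiff ℝ ∞ (fun α : ℝ => ((powBump α : ℝ) : ℂ)) :=
        Complex.ofRealCLM.contDiff.comp powBump.contDiff
      have h2 : ContDiff ℝ ∞ (fun α : ℝ => Complex.exp ((α : ℂ) * Complex.log s)) :=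
        Complex.contDiff_exp.comp (Complex.ofRealCLM.contDiff.mul contDiff_const)
      exact h1.mul h2)

theorem powTest_apply {s : ℂ} (hs : s ≠ 0) {α : ℝ} (hα : α ∈ Set.Icc (-(1 / 2) : ℝ) (3 / 2)) :
    powTest s α = s ^ (α : ℂ) := by
  have h : powBump α = 1 := by
    apply powBump.one_of_mem_closedBall
    rw [Real.closedBall_eq_Icc]
    change α ∈ Set.Icc ((1 / 2 : ℝ) - 1) (1 / 2 + 1)
    constructor <;> linarith [hα.1, hα.2]
  change ((powBump α : ℝ) : ℂ) * Complex.exp ((α : ℂ) * Complex.log s) = _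
  rw [h, Complex.cpow_def_of_ne_zero hs, mul_comm (Complex.log s)]
  simp

/-- `Φ(s) = ⟨φ(α), s ^ α⟩` for a distribution `φ` with support in `[0, 1]`. -/
def Phi (φ : 𝓢'(ℝ, ℂ)) (s : ℂ) : ℂ := φ (powTest s)

/-- A smooth cutoff of `t ↦ exp (-s t)`, equal to it for `t ≥ -1` and to zero for `t ≤ -2`. -/
def expFun (s : ℂ) (t : ℝ) : ℂ :=
  (Real.smoothTransition (t + 2) : ℂ) * Complex.exp (-(s * t))

theorem expFun_contDiff (s : ℂ) : ContDiff ℝ ∞ (expFun s) := by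
  have h1 : ContDiff ℝ ∞ (fun t : ℝ => ((Real.smoothTransition (t + 2) : ℝ) : ℂ)) :=
    Complex.ofRealCLM.contDiff.comp
      (Real.smoothTransition.contDiff.comp (contDiff_id.add contDiff_const))
  have h2 : ContDiff ℝ ∞ (fun t : ℝ => Complex.exp (-(s * t))) :=
    Complex.contDiff_exp.comp (contDiff_const.mul Complex.ofRealCLM.contDiff).neg
  exact h1.mul h2

theorem expFun_of_ge (s : ℂ) {t : ℝ} (ht : -1 ≤ t) : expFun s t = Complex.exp (-(s * t)) := by
  simp [expFun, Real.smoothTransition.one_of_one_le (show 1 ≤ t + 2 by linarith)]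

theorem expFun_of_le (s : ℂ) {t : ℝ} (ht : t ≤ -2) : expFun s t = 0 := by
  simp [expFun, Real.smoothTransition.zero_of_nonpos (show t + 2 ≤ 0 by linarith)]

theorem iteratedDeriv_exp (s : ℂ) (n : ℕ) :
    iteratedDeriv n (fun t : ℝ => Complex.exp (-(s * t))) =
      fun t : ℝ => (-s) ^ n * Complex.exp (-(s * t)) := by
  induction n with
  | zero => simp
  | succ n ih =>
    rw [iteratedDeriv_succ, ih]
    funext t
    have h : HasDerivAt (fun t : ℝ => Complex.exp (-(s * t)))
        (Complex.exp (-(s * t)) * (-(s * 1))) t :=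
      (((Complex.ofRealCLM.hasDerivAt (x := t)).const_mul s).neg).cexp
    rw [(h.const_mul ((-s) ^ n)).deriv]
    ring

/-- The test function `t ↦ exp (-s t)`, `Re s > 0`, smoothly cut off away from `[0, ∞)`. -/
def expTest (s : ℂ) (hs : 0 < s.re) : 𝓢(ℝ, ℂ) where
  toFun := expFun s
  smooth' := expFun_contDiff s
  decay' k n := by
    set g : ℝ → ℝ := fun t => ‖t‖ ^ k * ‖iteratedFDeriv ℝ n (expFun s) t‖ with hg
    have hcont : Continuous g := by
      have := (expFun_contDiff s).continuous_iteratedFDeriv (m := n) (mod_cast le_top)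
      fun_prop
    have hright : Filter.Tendsto g Filter.atTop (nhds 0) := by
      have h0 : Filter.Tendsto (fun t : ℝ => ‖s‖ ^ n * (t ^ k * Real.exp (-s.re * t)))
          Filter.atTop (nhds 0) := by
        have := tendsto_rpow_mul_exp_neg_mul_atTop_nhds_zero (k : ℝ) s.re hs
        simpa [Real.rpow_natCast] using this.const_mul (‖s‖ ^ n)
      refine h0.congr' ?_
      filter_upwards [Filter.eventually_gt_atTop (0 : ℝ)] with t ht
      have he : expFun s =ᶠ[nhds t] fun t : ℝ => Complex.exp (-(s * t)) := by
        filter_upwards [Ioi_mem_nhds (show (-1 : ℝ) < t by linarith)] with r hr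
        exact expFun_of_ge s (le_of_lt hr)
      have h1 : iteratedDeriv n (expFun s) t = (-s) ^ n * Complex.exp (-(s * t)) := by
        rw [he.iteratedDeriv_eq, iteratedDeriv_exp]
      simp only [hg]
      rw [norm_iteratedFDeriv_eq_norm_iteratedDeriv, h1, norm_mul, norm_pow, norm_neg,
        Complex.norm_exp, Real.norm_of_nonneg ht.le]
      simp only [Complex.neg_re, Complex.re_mul_ofReal, neg_mul]
      ring
    have hleft : ∀ t, t < -2 → g t = 0 := by
      intro t ht
      have he : expFun s =ᶠ[nhds t] fun _ => 0 := by
        filter_upwards [Iio_mem_nhds ht] with r hr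
        exact expFun_of_le s (le_of_lt hr)
      simp only [hg]
      rw [norm_iteratedFDeriv_eq_norm_iteratedDeriv, he.iteratedDeriv_eq]
      simp
    obtain ⟨R, hR⟩ := Filter.eventually_atTop.1 (hright.eventually_le_const one_pos)
    obtain ⟨C, hC⟩ := (isCompact_Icc (a := (-2 : ℝ)) (b := R)).bddAbove_image hcont.continuousOn
    refine ⟨max C 1, fun t => ?_⟩
    change g t ≤ _
    rcases lt_or_ge t (-2) with h | h
    · rw [hleft t h]
      exact le_max_of_le_right zero_le_one
    · rcases le_total t R with h' | h'
      · exact le_max_of_le_left (hC ⟨t, ⟨h, h'⟩, rfl⟩)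
      · exact le_max_of_le_right (hR t h')

/-- `y` is the inverse Laplace transform of `Y` in `𝓢'₊`: the tempered distribution `y` is
supported in `[0, ∞)` and `⟨y(t), exp (-s t)⟩ = Y(s)` for `Re s > 0`. -/
def IsInverseLaplace (y : 𝓢'(ℝ, ℂ)) (Y : ℂ → ℂ) : Prop :=
  Distribution.IsVanishingOn y (Set.Iio 0) ∧
    ∀ (s : ℂ) (hs : 0 < s.re), y (expTest s hs) = Y s

/-- The test function `(x, t) ↦ f x * g t`. -/
def tensorTest (f g : 𝓢(ℝ, ℂ)) : 𝓢(ℝ × ℝ, ℂ) where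
  toFun p := f p.1 * g p.2
  smooth' := ((f.smooth ⊤).comp contDiff_fst).mul ((g.smooth ⊤).comp contDiff_snd)
  decay' k n := by
    have hfst : ∀ (h : 𝓢(ℝ, ℂ)) (L : ℝ × ℝ →L[ℝ] ℝ) (_ : ‖L‖ ≤ 1) (i : ℕ) (p : ℝ × ℝ),
        ‖iteratedFDeriv ℝ i (fun p => h (L p)) p‖ ≤ ‖iteratedFDeriv ℝ i h (L p)‖ := by
      intro h L hL i p
      have := L.iteratedFDeriv_comp_right (h.smooth ⊤) p (i := i) (mod_cast le_top)
      change ‖iteratedFDeriv ℝ i (h ∘ L) p‖ ≤ _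
      rw [this]
      refine (ContinuousMultilinearMap.norm_compContinuousLinearMap_le _ _).trans ?_
      refine mul_le_of_le_one_right (norm_nonneg _) ?_
      exact Finset.prod_le_one (fun _ _ => norm_nonneg _) (fun _ _ => hL)
    choose A hA0 hA using fun k n => f.decay k n
    choose B hB0 hB using fun k n => g.decay k n
    refine ⟨∑ i ∈ Finset.range (n + 1), (n.choose i : ℝ) *
      (A k i * B 0 (n - i) + A 0 i * B k (n - i)), fun p => ?_⟩
    have hmul := norm_iteratedFDeriv_mul_le (𝕜 := ℝ) (n := n) (N := ∞)
      (f := fun p : ℝ × ℝ => f p.1) (g := fun p : ℝ × ℝ => g p.2)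
      ((f.smooth ⊤).comp contDiff_fst) ((g.smooth ⊤).comp contDiff_snd) p (mod_cast le_top)
    refine (mul_le_mul_of_nonneg_left hmul (by positivity)).trans ?_
    rw [Finset.mul_sum]
    refine Finset.sum_le_sum fun i _ => ?_
    have h1 := hfst f (ContinuousLinearMap.fst ℝ ℝ ℝ) (ContinuousLinearMap.norm_fst_le ..) i p
    have h2 := hfst g (ContinuousLinearMap.snd ℝ ℝ ℝ) (ContinuousLinearMap.norm_snd_le ..) (n - i) p
    simp only [ContinuousLinearMap.coe_fst', ContinuousLinearMap.coe_snd'] at h1 h2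
    have hk : ‖p‖ ^ k ≤ ‖p.1‖ ^ k + ‖p.2‖ ^ k := by
      rw [Prod.norm_def]
      rcases max_cases ‖p.1‖ ‖p.2‖ with h | h <;> rw [h.1]
      · exact le_add_of_nonneg_right (by positivity)
      · exact le_add_of_nonneg_left (by positivity)
    have a1 := hA k i p.1
    have a0 := hA 0 i p.1
    have b1 := hB k (n - i) p.2
    have b0 := hB 0 (n - i) p.2
    rw [pow_zero, one_mul] at a0 b0
    set x := ‖iteratedFDeriv ℝ i f p.1‖
    set y := ‖iteratedFDeriv ℝ (n - i) g p.2‖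
    have hx : 0 ≤ x := norm_nonneg _
    have hy : 0 ≤ y := norm_nonneg _
    calc ‖p‖ ^ k * ((n.choose i : ℝ) * ‖iteratedFDeriv ℝ i (fun p : ℝ × ℝ => f p.1) p‖ *
          ‖iteratedFDeriv ℝ (n - i) (fun p : ℝ × ℝ => g p.2) p‖)
        ≤ (‖p.1‖ ^ k + ‖p.2‖ ^ k) * ((n.choose i : ℝ) * x * y) := by gcongr
      _ = (n.choose i : ℝ) * ((‖p.1‖ ^ k * x) * y + x * (‖p.2‖ ^ k * y)) := by ring
      _ ≤ _ := by
        have := (hA0 k i).le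
        have := (hA0 0 i).le
        gcongr

/-- `S ∈ 𝓢'(ℝ × ℝ₊)` is the inverse Laplace transform with respect to `t` of the function
`T x s`: `S` vanishes for `t < 0` and, for every `s` with `Re s > 0`, the distribution
`⟨S(x, t), exp (-s t)⟩` in `x` is the function `x ↦ T x s`. -/
def IsInverseLaplaceT (S : 𝓢'(ℝ × ℝ, ℂ)) (T : ℝ → ℂ → ℂ) : Prop :=
  Distribution.IsVanishingOn S {p : ℝ × ℝ | p.2 < 0} ∧
    ∀ (s : ℂ) (hs : 0 < s.re) (f : 𝓢(ℝ, ℂ)),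
      MeasureTheory.Integrable (fun x : ℝ => f x * T x s) ∧
        S (tensorTest f (expTest s hs)) = ∫ x : ℝ, f x * T x s

/-- The test function `x ↦ φ(x, t)`. -/
def sliceX (t : ℝ) : 𝓢(ℝ × ℝ, ℂ) →L[ℂ] 𝓢(ℝ, ℂ) :=
  SchwartzMap.compCLMOfAntilipschitz (g := fun x : ℝ => (x, t)) (K := 1) ℂ
    (by
      have h : (fun x : ℝ => (x, t)) =
          fun x : ℝ => ContinuousLinearMap.inl ℝ ℝ ℝ x + ((0 : ℝ), t) := by
        funext x; simp
      rw [h]; fun_prop)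
    (AntilipschitzWith.of_le_mul_dist fun x y => by simp [Prod.dist_eq])

/-- The test function `τ ↦ φ(x, t + τ)`. -/
def sliceT (x t : ℝ) : 𝓢(ℝ × ℝ, ℂ) →L[ℂ] 𝓢(ℝ, ℂ) :=
  SchwartzMap.compCLMOfAntilipschitz (g := fun τ : ℝ => (x, t + τ)) (K := 1) ℂ
    (by
      have h : (fun τ : ℝ => (x, t + τ)) =
          fun τ : ℝ => ContinuousLinearMap.inr ℝ ℝ ℝ τ + (x, t) := by
        funext τ; simp [add_comm]
      rw [h]; fun_prop)
    (AntilipschitzWith.of_le_mul_dist fun x y => by simp [Prod.dist_eq])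

theorem sliceX_apply (t : ℝ) (φ : 𝓢(ℝ × ℝ, ℂ)) (x : ℝ) : sliceX t φ x = φ (x, t) := rfl

theorem sliceT_apply (x t : ℝ) (φ : 𝓢(ℝ × ℝ, ℂ)) (τ : ℝ) : sliceT x t φ τ = φ (x, t + τ) := rfl

/-- The distribution `w(x) δ(t)`. -/
def mulDelta (w : 𝓢'(ℝ, ℂ)) : 𝓢'(ℝ × ℝ, ℂ) :=
  PointwiseConvergenceCLM.precomp ℂ (sliceX 0) w

theorem mulDelta_apply (w : 𝓢'(ℝ, ℂ)) (φ : 𝓢(ℝ × ℝ, ℂ)) : mulDelta w φ = w (sliceX 0 φ) := rfl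

/-- The partial derivative `∂/∂x` on tempered distributions in `(x, t)`. -/
def dx (u : 𝓢'(ℝ × ℝ, ℂ)) : 𝓢'(ℝ × ℝ, ℂ) := ∂_{((1, 0) : ℝ × ℝ)} u

/-- The partial derivative `∂/∂t` on tempered distributions in `(x, t)`. -/
def dt (u : 𝓢'(ℝ × ℝ, ℂ)) : 𝓢'(ℝ × ℝ, ℂ) := ∂_{((0, 1) : ℝ × ℝ)} u

/-- The distribution `u₀(x) δ'(t) + v₀(x) δ(t)`. -/
def cauchyData (u₀ v₀ : 𝓢'(ℝ, ℂ)) : 𝓢'(ℝ × ℝ, ℂ) := dt (mulDelta u₀) + mulDelta v₀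

/-- For `F`, `G` vanishing for `t < 0`: the convolution `F *_{x,t} G` exists and equals `w`, i.e.
`⟨w, φ⟩ = ⟨G(y), ⟨F(z), φ(z + y)⟩⟩` for all test functions `φ`. As `G` is supported in `t ≥ 0`,
only the values of `y ↦ ⟨F(z), φ(z + y)⟩` near that half-plane matter; there it must coincide
with a rapidly decreasing function `ψ`, to which `G` is applied. -/
def IsConv (F G w : 𝓢'(ℝ × ℝ, ℂ)) : Prop :=
  ∀ φ : 𝓢(ℝ × ℝ, ℂ), ∃ ψ : 𝓢(ℝ × ℝ, ℂ),
    (∀ y : ℝ × ℝ, -1 < y.2 → ψ y = F (SchwartzMap.compSubConstCLM ℂ (-y) φ)) ∧ w φ = G ψ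

/-- For `a` supported in `[0, ∞)` and `G` vanishing for `t < 0`: the convolution `a *_t G` in the
time variable equals `w`, i.e. `⟨w, φ⟩ = ⟨G(x, t), ⟨a(τ), φ(x, t + τ)⟩⟩` for all test functions
`φ`, where the inner function is cut off away from the half-plane `t ≥ 0`. -/
def IsConvT (a : 𝓢'(ℝ, ℂ)) (G w : 𝓢'(ℝ × ℝ, ℂ)) : Prop :=
  ∀ φ : 𝓢(ℝ × ℝ, ℂ), ∃ ψ : 𝓢(ℝ × ℝ, ℂ),
    (∀ x t : ℝ, -1 < t → ψ (x, t) = a (sliceT x t φ)) ∧ w φ = G ψ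

/-- `u ∈ 𝓢'(ℝ × ℝ₊)` solves `u_tt = a *_t u_xx + f`. -/
def IsSolution (a : 𝓢'(ℝ, ℂ)) (f u : 𝓢'(ℝ × ℝ, ℂ)) : Prop :=
  Distribution.IsVanishingOn u {p : ℝ × ℝ | p.2 < 0} ∧
    ∃ w : 𝓢'(ℝ × ℝ, ℂ), IsConvT a (dx (dx u)) w ∧ dt (dt u) = w + f

/-- `S ∈ 𝓢'(ℝ × ℝ₊)` is a fundamental solution of `∂_t² - a *_t ∂_x²`. -/
def IsFundamentalSolution (a : 𝓢'(ℝ, ℂ)) (S : 𝓢'(ℝ × ℝ, ℂ)) : Prop :=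
  IsSolution a (TemperedDistribution.delta ((0, 0) : ℝ × ℝ)) S

/-- The square root `r(s)` of `Q(s)` with `Re (s r(s)) > 0` (where `s ^ 2 * Q s ∉ (-∞, 0]`), written
through the principal square root of `s ^ 2 * Q s`. -/
def sqrtBranch (Q : ℂ → ℂ) (s : ℂ) : ℂ := (s ^ 2 * Q s) ^ (1 / 2 : ℂ) / s

/-- The function `(2 s)⁻¹ √Q(s) exp (-|x| s √Q(s))`. -/
def kernelLaplace (Q : ℂ → ℂ) (x : ℝ) (s : ℂ) : ℂ :=
  1 / (2 * s) * sqrtBranch Q s * Complex.exp (-(|x| * s * sqrtBranch Q s))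

end

end ViscoWave

set_option linter.unusedSectionVars false

/-! Put Q = Φ_σ/Φ_ε and p(s) = s√Q(s), so p² = s²Q and Re p > 0. A Laplace transform in t turns PS =
δ into the ODE s²Ŝ - Q⁻¹Ŝ'' = δ(x), whose decaying Green's function p/(2s²)·exp(-p|x|) is the
prescribed kernel. What has to be shown is that this kernel can be inverted to a tempered
distribution, that the convolutions act on Schwartz functions, and that the Laplace transform loses
no information.

Inversion. By (A3), Q is the Laplace transform of a tempered distribution, hence holomorphic and
bounded by C|1+s|^N (1+1/Re s)^M (`IsInverseLaplace.differentiableOn`,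
`IsInverseLaplace.polyGrowth`). Decay of exp(-p|x|) in x requires that Re p not be too small. Since
p is a holomorphic self-map of the right half-plane, the Schwarz lemma gives Re p(s) ≥ c Re s/|1+s|²
(`re_mul_le_of_mapsTo`), so every (1+|x|)^k times the kernel has polynomial growth in s
(`exists_norm_kernelLaplace_le`). Dividing by a power of 1+s makes the Bromwich integral converge
absolutely, and the same power of 1+∂_t undoes the division (`exists_kernel`).

Convolution. Decay in x together with support in t ≥ 0 makes y ↦ ⟨S(z), φ(z+y)⟩ rapidly decreasing
on t ≥ -2. Cut off in time, it defines a continuous operator U on test functions, and u is G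
composed with U, where G is the right-hand side. The same construction applied to δ(x)a(t) gives an
operator T that transposes `a *_t`. The equation then becomes an identity between values on test
functions (`isSolution_iff`).

Identities. A tempered distribution vanishing for t < 0 is determined by its values on the products
f(x)exp(-st) (`eq_of_laplace_eq`). This reduces PS = δ to the ODE. It also gives uniqueness: for
each s every Schwartz f is (s² - Q⁻¹∂²)F with F Schwartz (`exists_ode_solution`), so the transform
of any solution at f equals that of G at F. -/

namespace ViscoWave

open MeasureTheory

/-! ### Translates of Schwartz functions -/

section Translation

variable {E F : Type*} [NormedAddCommGroup E] [NormedSpace ℝ E] [NormedAddCommGroup F]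
  [NormedSpace ℝ F] [NormedSpace ℂ F] [SMulCommClass ℝ ℂ F]

theorem one_add_norm_pow_mul_iteratedFDeriv_le (ψ : 𝓢(E, F)) (k n : ℕ) :
    ∃ C : ℝ, 0 ≤ C ∧ ∀ x : E, (1 + ‖x‖) ^ k * ‖iteratedFDeriv ℝ n ψ x‖ ≤ C :=
  ⟨_, by positivity, fun x => SchwartzMap.one_add_le_sup_seminorm_apply (𝕜 := ℝ) (m := (k, n))
    le_rfl le_rfl ψ x⟩

theorem one_add_norm_add_le (x y : E) : 1 + ‖x + y‖ ≤ (1 + ‖x‖) * (1 + ‖y‖) := by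
  nlinarith [norm_add_le x y, norm_nonneg x, norm_nonneg y, mul_nonneg (norm_nonneg x) (norm_nonneg y)]

theorem iteratedFDeriv_compSubConstCLM (ψ : 𝓢(E, F)) (n : ℕ) (y x : E) :
    iteratedFDeriv ℝ n (SchwartzMap.compSubConstCLM ℂ y ψ) x = iteratedFDeriv ℝ n ψ (x - y) :=
  iteratedFDeriv_comp_sub n y x

theorem seminorm_compSubConstCLM_le (ψ : 𝓢(E, F)) (k n : ℕ) :
    ∃ C : ℝ, 0 ≤ C ∧ ∀ y : E,
      SchwartzMap.seminorm ℂ k n (SchwartzMap.compSubConstCLM ℂ y ψ) ≤ C * (1 + ‖y‖) ^ k := by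
  obtain ⟨C, hC, h⟩ := one_add_norm_pow_mul_iteratedFDeriv_le ψ k n
  refine ⟨C, hC, fun y => SchwartzMap.seminorm_le_bound ℂ k n _ (by positivity) fun x => ?_⟩
  rw [iteratedFDeriv_compSubConstCLM]
  have h1 : ‖x‖ ≤ (1 + ‖x - y‖) * (1 + ‖y‖) := by
    have := one_add_norm_add_le (x - y) y
    rw [sub_add_cancel] at this
    linarith
  calc ‖x‖ ^ k * ‖iteratedFDeriv ℝ n ψ (x - y)‖
      ≤ ((1 + ‖x - y‖) * (1 + ‖y‖)) ^ k * ‖iteratedFDeriv ℝ n ψ (x - y)‖ := by gcongr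
    _ = ((1 + ‖x - y‖) ^ k * ‖iteratedFDeriv ℝ n ψ (x - y)‖) * (1 + ‖y‖) ^ k := by
      rw [mul_pow]; ring
    _ ≤ _ := by gcongr; exact h _

theorem seminorm_compSubConstCLM_sub_le (ψ : 𝓢(E, F)) (k n : ℕ) :
    ∃ C : ℝ, 0 ≤ C ∧ ∀ y : E, ‖y‖ ≤ 1 →
      SchwartzMap.seminorm ℂ k n (SchwartzMap.compSubConstCLM ℂ y ψ - ψ) ≤ C * ‖y‖ := by
  obtain ⟨C, hC, h⟩ := one_add_norm_pow_mul_iteratedFDeriv_le ψ k (n + 1)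
  refine ⟨2 ^ k * C, by positivity, fun y hy =>
    SchwartzMap.seminorm_le_bound ℂ k n _ (by positivity) fun x => ?_⟩
  have hd : ∀ z, DifferentiableAt ℝ (iteratedFDeriv ℝ n ψ) z := fun z =>
    ((ψ.smooth (n + 1 : ℕ)).differentiable_iteratedFDeriv (mod_cast Nat.lt_succ_self n)) z
  have hsub : iteratedFDeriv ℝ n (SchwartzMap.compSubConstCLM ℂ y ψ - ψ) x =
      iteratedFDeriv ℝ n ψ (x - y) - iteratedFDeriv ℝ n ψ x := by
    rw [← iteratedFDeriv_compSubConstCLM]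
    have := iteratedFDeriv_sub_apply (𝕜 := ℝ) (i := n) (x := x)
      ((SchwartzMap.compSubConstCLM ℂ y ψ).contDiffAt n) (ψ.contDiffAt n)
    simpa using this
  rw [hsub]
  -- Mean value inequality on the unit ball about `x`, with the weight `‖x‖ ^ k` frozen at the
  -- centre. Changing it to a weight at `z` costs the factor `2 ^ k`.
  have key := (convex_closedBall x 1).norm_image_sub_le_of_norm_hasFDerivWithin_le
    (f := fun z => ‖x‖ ^ k • iteratedFDeriv ℝ n ψ z)
    (f' := fun z => ‖x‖ ^ k • fderiv ℝ (iteratedFDeriv ℝ n ψ) z) (C := 2 ^ k * C)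
    (x := x) (y := x - y)
    (fun z _ => ((hd z).hasFDerivAt.const_smul (‖x‖ ^ k)).hasFDerivWithinAt)
    (fun z hz => ?_) (by simp) (by simpa [mem_closedBall_iff_norm] using hy)
  · rw [← smul_sub, norm_smul, norm_pow, norm_norm] at key
    simpa using key
  · rw [norm_smul, norm_pow, norm_norm, norm_fderiv_iteratedFDeriv]
    have hz' : ‖x - z‖ ≤ 1 := by rwa [mem_closedBall_iff_norm, norm_sub_rev] at hz
    have h1 : ‖x‖ ≤ 2 * (1 + ‖z‖) := by
      have := norm_le_norm_add_norm_sub' x z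
      have h3 := norm_nonneg z
      linarith
    calc ‖x‖ ^ k * ‖iteratedFDeriv ℝ (n + 1) ψ z‖
        ≤ (2 * (1 + ‖z‖)) ^ k * ‖iteratedFDeriv ℝ (n + 1) ψ z‖ := by gcongr
      _ = 2 ^ k * ((1 + ‖z‖) ^ k * ‖iteratedFDeriv ℝ (n + 1) ψ z‖) := by rw [mul_pow]; ring
      _ ≤ _ := by gcongr; exact h z

theorem continuous_compSubConstCLM (ψ : 𝓢(E, F)) :
    Continuous fun y : E => SchwartzMap.compSubConstCLM ℂ y ψ := by
  have h0 : ∀ ψ : 𝓢(E, F), Filter.Tendsto (fun y : E => SchwartzMap.compSubConstCLM ℂ y ψ)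
      (nhds 0) (nhds ψ) := by
    intro ψ
    rw [(schwartz_withSeminorms ℂ E F).tendsto_nhds]
    rintro ⟨k, n⟩ ε hε
    obtain ⟨C, hC, h⟩ := seminorm_compSubConstCLM_sub_le ψ k n
    have ht : Filter.Tendsto (fun y : E => C * ‖y‖) (nhds 0) (nhds 0) := by
      have : Continuous fun y : E => C * ‖y‖ := by fun_prop
      simpa using this.tendsto 0
    filter_upwards [ht.eventually_lt_const hε, Metric.closedBall_mem_nhds (0 : E) one_pos]
      with y hy hy1
    exact (h y (by simpa using hy1)).trans_lt hy
  rw [continuous_iff_continuousAt]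
  intro y₀
  have h1 : Filter.Tendsto (fun y : E => y - y₀) (nhds y₀) (nhds 0) := by
    simpa using (continuous_id.sub continuous_const).tendsto (y₀ : E) (f := fun y : E => y - y₀)
  have h2 := (h0 (SchwartzMap.compSubConstCLM ℂ y₀ ψ)).comp h1
  refine h2.congr fun y => ?_
  simp

end Translation

/-! ### Interchanging a continuous functional with an integral -/

section Exchange

/-- The bound forces `u` to vanish on the kernel of `J`, so `u` descends to the range of `J`, and
Hahn–Banach extends it to `X`. -/
theorem exists_clm_of_norm_le {W X : Type*} [AddCommGroup W] [Module ℂ W]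
    [NormedAddCommGroup X] [NormedSpace ℂ X] (J : W →ₗ[ℂ] X) (u : W →ₗ[ℂ] ℂ) {C : ℝ}
    (h : ∀ w, ‖u w‖ ≤ C * ‖J w‖) : ∃ U : X →L[ℂ] ℂ, ∀ w, U (J w) = u w := by
  obtain ⟨g, hg⟩ := J.rangeRestrict.exists_rightInverse_of_surjective J.range_rangeRestrict
  have hJ : ∀ y, J (g y) = y := fun y => congrArg Subtype.val (LinearMap.congr_fun hg y)
  let f : LinearMap.range J →L[ℂ] ℂ := (u ∘ₗ g).mkContinuous C fun y => by
    have := h (g y)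
    rw [hJ] at this
    exact this
  obtain ⟨U, hU, -⟩ := exists_extension_norm_eq (LinearMap.range J) f
  refine ⟨U, fun w => ?_⟩
  have h1 := hU (J.rangeRestrict w)
  have h2 : f (J.rangeRestrict w) = u (g (J.rangeRestrict w)) := rfl
  have h3 : u (g (J.rangeRestrict w) - w) = 0 := by
    have := h (g (J.rangeRestrict w) - w)
    rw [map_sub J, hJ] at this
    simpa using this
  rw [map_sub, sub_eq_zero] at h3
  rw [← h3, ← h2, ← h1]
  rfl

/-- `W` carries no norm, so the Bochner integral is formed in a finite product of Banach spaces that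
controls `u`. The Hahn–Banach extension of `u` to that product commutes with it. -/
theorem map_eq_integral_of_norm_le {W ι Θ : Type*} [AddCommGroup W] [Module ℂ W]
    [TopologicalSpace W] [Fintype ι] {X : ι → Type*} [∀ i, NormedAddCommGroup (X i)]
    [∀ i, NormedSpace ℂ (X i)] [∀ i, CompleteSpace (X i)]
    [TopologicalSpace Θ] [MeasurableSpace Θ]
    [OpensMeasurableSpace Θ] [SecondCountableTopology Θ] {μ : Measure Θ}
    (J : ∀ i, W →L[ℂ] X i) (u : W →ₗ[ℂ] ℂ) {C : ℝ}
    (hu : ∀ w (M : ℝ), 0 ≤ M → (∀ i, ‖J i w‖ ≤ M) → ‖u w‖ ≤ C * M) {Φ : Θ → W} {φ : W}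
    (hcont : Continuous Φ) {b : ι → Θ → ℝ} (hb : ∀ i, Integrable (b i) μ)
    (hJb : ∀ i θ, ‖J i (Φ θ)‖ ≤ b i θ)
    (h : ∀ i, Integrable (fun θ => J i (Φ θ)) μ → J i φ = ∫ θ, J i (Φ θ) ∂μ) :
    u φ = ∫ θ, u (Φ θ) ∂μ := by
  let J' : W →L[ℂ] ∀ i, X i := ContinuousLinearMap.pi J
  obtain ⟨U, hU⟩ := exists_clm_of_norm_le J'.toLinearMap u (C := C) fun w =>
    hu w _ (norm_nonneg _) fun i => norm_le_pi_norm (J' w) i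
  have hi : ∀ i, Integrable (fun θ => J' (Φ θ) i) μ := fun i =>
    (hb i).mono' ((J i).continuous.comp hcont).aestronglyMeasurable (.of_forall (hJb i))
  have heq : J' φ = ∫ θ, J' (Φ θ) ∂μ := by
    funext i
    rw [eval_integral hi]
    exact h i (hi i)
  have h1 := U.integral_comp_comm (Integrable.of_eval hi)
  rw [← heq] at h1
  rw [← hU]
  refine h1.symm.trans (integral_congr_ae (.of_forall fun θ => hU _))

variable {E : Type*} [NormedAddCommGroup E] [NormedSpace ℝ E]

theorem exists_seminorm_bound (u : 𝓢(E, ℂ) →L[ℂ] ℂ) :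
    ∃ (s : Finset (ℕ × ℕ)) (C : ℝ), 0 ≤ C ∧
      ∀ φ, ‖u φ‖ ≤ C * s.sup (schwartzSeminormFamily ℂ E ℂ) φ := by
  obtain ⟨s, C, -, h⟩ := Seminorm.bound_of_continuous (schwartz_withSeminorms ℂ E ℂ)
    ((normSeminorm ℂ ℂ).comp (u : 𝓢(E, ℂ) →ₗ[ℂ] ℂ)) u.continuous.norm
  exact ⟨s, C, C.2, h⟩

theorem norm_pow_mul_iteratedFDeriv_apply_le (φ : 𝓢(E, ℂ)) (k n : ℕ) (x : E) (m : Fin n → E) :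
    ‖x‖ ^ k * ‖iteratedFDeriv ℝ n φ x m‖ ≤ SchwartzMap.seminorm ℂ k n φ * ∏ i, ‖m i‖ := by
  calc _ ≤ ‖x‖ ^ k * (‖iteratedFDeriv ℝ n φ x‖ * ∏ i, ‖m i‖) := by
        gcongr
        exact ContinuousMultilinearMap.le_opNorm _ m
    _ = (‖x‖ ^ k * ‖iteratedFDeriv ℝ n φ x‖) * ∏ i, ‖m i‖ := by ring
    _ ≤ _ := by
        gcongr
        exact SchwartzMap.le_seminorm ℂ k n φ x

/-- The function `(x, m) ↦ ‖x‖ ^ k * D ^ n φ (x) m`, normalized in `m`. -/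
noncomputable def weightedDerivFun (k n : ℕ) (φ : 𝓢(E, ℂ)) (d : E × (Fin n → E)) : ℂ :=
  ((‖d.1‖ ^ k / ∏ i, ‖d.2 i‖ : ℝ) : ℂ) * iteratedFDeriv ℝ n φ d.1 d.2

theorem norm_weightedDerivFun_le (k n : ℕ) (φ : 𝓢(E, ℂ)) (d : E × (Fin n → E)) :
    ‖weightedDerivFun k n φ d‖ ≤ SchwartzMap.seminorm ℂ k n φ := by
  have h0 : 0 ≤ ∏ i, ‖d.2 i‖ := Finset.prod_nonneg fun _ _ => norm_nonneg _
  rw [weightedDerivFun, norm_mul, Complex.norm_real, Real.norm_of_nonneg (by positivity),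
    div_mul_eq_mul_div]
  exact div_le_of_le_mul₀ h0 (apply_nonneg _ _)
    (norm_pow_mul_iteratedFDeriv_apply_le φ k n d.1 d.2)

/-- The ℓ^∞ norm of this family is exactly the Schwartz seminorm of index `(k, n)`. The target is a
Banach space whose integrals can be checked one scalar coordinate at a time. -/
noncomputable def weightedDeriv (E : Type*) [NormedAddCommGroup E] [NormedSpace ℝ E] (k n : ℕ) :
    𝓢(E, ℂ) →L[ℂ] lp (fun _ : E × (Fin n → E) => ℂ) ⊤ :=
  SchwartzMap.mkCLMtoNormedSpace (fun φ : 𝓢(E, ℂ) => ⟨weightedDerivFun k n φ,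
      memℓp_infty ⟨SchwartzMap.seminorm ℂ k n φ, by
        rintro _ ⟨d, rfl⟩
        exact norm_weightedDerivFun_le k n φ d⟩⟩)
    (fun φ ψ => by
      ext d
      have := iteratedFDeriv_add_apply (𝕜 := ℝ) (i := n) (x := d.1)
        (φ.contDiffAt n) (ψ.contDiffAt n)
      change weightedDerivFun k n (φ + ψ) d = weightedDerivFun k n φ d + weightedDerivFun k n ψ d
      change _ * iteratedFDeriv ℝ n (⇑φ + ⇑ψ) d.1 d.2 = _
      rw [this, add_apply, mul_add]
      rfl)
    (fun c φ => by
      ext d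
      have := iteratedFDeriv_const_smul_apply (𝕜 := ℝ) (a := c) (i := n) (x := d.1)
        (φ.contDiffAt n)
      change weightedDerivFun k n (c • φ) d = c • weightedDerivFun k n φ d
      change _ * iteratedFDeriv ℝ n (c • ⇑φ) d.1 d.2 = _
      rw [this, smul_apply, mul_smul_comm]
      rfl)
    ⟨{(k, n)}, 1, zero_le_one, fun φ => by
      rw [Finset.sup_singleton, one_mul]
      exact lp.norm_le_of_forall_le (apply_nonneg _ _) (norm_weightedDerivFun_le k n φ)⟩

theorem weightedDeriv_apply (k n : ℕ) (φ : 𝓢(E, ℂ)) (d : E × (Fin n → E)) :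
    weightedDeriv E k n φ d = weightedDerivFun k n φ d := rfl

theorem norm_weightedDeriv_le (k n : ℕ) (φ : 𝓢(E, ℂ)) :
    ‖weightedDeriv E k n φ‖ ≤ SchwartzMap.seminorm ℂ k n φ :=
  lp.norm_le_of_forall_le (apply_nonneg _ _) (norm_weightedDerivFun_le k n φ)

theorem seminorm_le_norm_weightedDeriv (k n : ℕ) (φ : 𝓢(E, ℂ)) :
    SchwartzMap.seminorm ℂ k n φ ≤ ‖weightedDeriv E k n φ‖ := by
  refine SchwartzMap.seminorm_le_bound ℂ k n φ (norm_nonneg _) fun x => ?_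
  have key : ‖((‖x‖ ^ k : ℝ) : ℂ) • iteratedFDeriv ℝ n φ x‖ ≤ ‖weightedDeriv E k n φ‖ := by
    refine ContinuousMultilinearMap.opNorm_le_bound (norm_nonneg _) fun m => ?_
    -- With a zero vector the normalization divides by `0` and the coordinate carries no
    -- information, but the multilinear map vanishes there.
    by_cases h : ∃ i, m i = 0
    · obtain ⟨i, hi⟩ := h
      rw [ContinuousMultilinearMap.map_coord_zero _ i hi, norm_zero]
      exact mul_nonneg (norm_nonneg _) (Finset.prod_nonneg fun _ _ => norm_nonneg _)
    · push Not at h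
      have hp : 0 < ∏ i, ‖m i‖ := Finset.prod_pos fun i _ => norm_pos_iff.2 (h i)
      have h1 := lp.norm_apply_le_norm (by simp) (weightedDeriv E k n φ) (x, m)
      rw [weightedDeriv_apply, weightedDerivFun, norm_mul, Complex.norm_real,
        Real.norm_of_nonneg (by positivity), div_mul_eq_mul_div, div_le_iff₀ hp] at h1
      rw [smul_apply, norm_smul, Complex.norm_real,
        Real.norm_of_nonneg (by positivity)]
      exact h1
  rwa [norm_smul, Complex.norm_real, Real.norm_of_nonneg (by positivity)] at key

-- Differentiation under the integral, one direction at a time. The seminorms of index `(0, n)`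
-- bound the derivatives uniformly in `x` and serve as dominating functions.
open SchwartzMap LineDeriv in
theorem iteratedFDeriv_apply_eq_integral {Θ : Type*} [TopologicalSpace Θ] [MeasurableSpace Θ]
    [OpensMeasurableSpace Θ] [SecondCountableTopology Θ] {μ : Measure Θ}
    {Φ : Θ → 𝓢(E, ℂ)} {φ : 𝓢(E, ℂ)} (hcont : Continuous Φ)
    (hint : ∀ n, Integrable (fun θ => SchwartzMap.seminorm ℂ 0 n (Φ θ)) μ)
    (h : ∀ x, φ x = ∫ θ, Φ θ x ∂μ) (n : ℕ) (m : Fin n → E) (x : E) :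
    iteratedFDeriv ℝ n φ x m = ∫ θ, iteratedFDeriv ℝ n (Φ θ) x m ∂μ := by
  simp only [← iteratedLineDerivOp_eq_iteratedFDeriv]
  have hbd : ∀ n (m : Fin n → E) x θ,
      ‖∂^{m} (Φ θ) x‖ ≤ SchwartzMap.seminorm ℂ 0 n (Φ θ) * ∏ i, ‖m i‖ := by
    intro n m x θ
    rw [iteratedLineDerivOp_eq_iteratedFDeriv]
    simpa using norm_pow_mul_iteratedFDeriv_apply_le (Φ θ) 0 n x m
  have hm : ∀ n (m : Fin n → E) x, AEStronglyMeasurable (fun θ => ∂^{m} (Φ θ) x) μ := by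
    intro n m x
    refine Continuous.aestronglyMeasurable ?_
    exact (TemperedDistribution.delta x).continuous.comp
      ((iteratedLineDerivOpCLM ℂ 𝓢(E, ℂ) m).continuous.comp hcont)
  have hi : ∀ n (m : Fin n → E) x, Integrable (fun θ => ∂^{m} (Φ θ) x) μ := fun n m x =>
    ((hint n).mul_const _).mono' (hm n m x) (.of_forall (hbd n m x))
  induction n generalizing x with
  | zero => simpa using h x
  | succ n ih =>
    have hd : ∀ (f : 𝓢(E, ℂ)) (v x : E) (r : ℝ),
        HasDerivAt (fun r : ℝ => f (x + r • v)) (∂_{v} f (x + r • v)) r := by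
      intro f v x r
      have h1 : HasDerivAt (fun r : ℝ => x + r • v) v r := by
        simpa using ((hasDerivAt_id r).smul_const v).const_add x
      exact (f.hasFDerivAt (x + r • v)).comp_hasDerivAt r h1
    have key := hasDerivAt_integral_of_dominated_loc_of_deriv_le (𝕜 := ℝ) (μ := μ) (x₀ := 0)
      (F := fun r θ => ∂^{Fin.tail m} (Φ θ) (x + r • m 0))
      (F' := fun r θ => ∂^{m} (Φ θ) (x + r • m 0)) Filter.univ_mem
      (.of_forall fun r => hm n _ _) (hi n _ _) (hm (n + 1) m _)
      (.of_forall fun θ r _ => hbd (n + 1) m _ θ)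
      ((hint (n + 1)).mul_const _) (.of_forall fun θ r _ => by
        rw [iteratedLineDerivOp_succ_left]
        exact hd _ _ _ _)
    have h2 := hd (∂^{Fin.tail m} φ) (m 0) x 0
    simp only [ih] at h2
    have h3 := h2.unique key.2
    simpa [iteratedLineDerivOp_succ_left] using h3

/-- A continuous linear functional on the Schwartz space commutes with integrals of continuous
families of Schwartz functions. -/
theorem map_eq_integral {Θ : Type*} [TopologicalSpace Θ] [MeasurableSpace Θ]
    [OpensMeasurableSpace Θ] [SecondCountableTopology Θ] {μ : Measure Θ}
    (u : 𝓢(E, ℂ) →L[ℂ] ℂ) {Φ : Θ → 𝓢(E, ℂ)} {φ : 𝓢(E, ℂ)} (hcont : Continuous Φ)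
    (hint : ∀ k n, Integrable (fun θ => SchwartzMap.seminorm ℂ k n (Φ θ)) μ)
    (h₀ : ∀ x, φ x = ∫ θ, Φ θ x ∂μ) : u φ = ∫ θ, u (Φ θ) ∂μ := by
  obtain ⟨s, C, hC, hu⟩ := exists_seminorm_bound u
  -- One ℓ^∞ factor for each of the finitely many seminorms that control `u`.
  refine map_eq_integral_of_norm_le (ι := s)
    (X := fun i => lp (fun _ : E × (Fin i.1.2 → E) => ℂ) ⊤)
    (fun i => weightedDeriv E i.1.1 i.1.2)
    u.toLinearMap (C := C) (fun w M hM hw => (hu w).trans ?_) hcont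
    (fun i => hint i.1.1 i.1.2) (fun i θ => norm_weightedDeriv_le i.1.1 i.1.2 (Φ θ))
    fun i hi => ?_
  · gcongr
    exact Seminorm.finset_sup_apply_le hM fun i his =>
      (seminorm_le_norm_weightedDeriv i.1 i.2 w).trans (hw ⟨i, his⟩)
  · ext d
    have h1 := (lp.evalCLM ℝ (fun _ : E × (Fin i.1.2 → E) => ℂ) ⊤ d).integral_comp_comm hi
    refine Eq.trans ?_ h1
    change _ * iteratedFDeriv ℝ i.1.2 φ d.1 d.2 =
      ∫ θ, _ * iteratedFDeriv ℝ i.1.2 (Φ θ) d.1 d.2 ∂μ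
    rw [iteratedFDeriv_apply_eq_integral hcont (hint 0) h₀, integral_const_mul]

end Exchange

/-! ### Functionals applied to convolutions -/

section Convolution

variable {V : Type*} [NormedAddCommGroup V] [InnerProductSpace ℝ V] [FiniteDimensional ℝ V]
  [MeasurableSpace V] [BorelSpace V]

theorem integrable_norm_mul_one_add_pow (φ : 𝓢(V, ℂ)) (k : ℕ) :
    Integrable fun y => ‖φ y‖ * (1 + ‖y‖) ^ k := by
  have h1 := (φ.integrable_pow_mul volume 0).const_mul (2 ^ (k - 1))
  have h2 := (φ.integrable_pow_mul volume k).const_mul (2 ^ (k - 1))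
  refine (h1.add h2).mono' (by fun_prop) (.of_forall fun y => ?_)
  rw [Real.norm_of_nonneg (by positivity)]
  have := add_pow_le zero_le_one (norm_nonneg y) k
  calc _ ≤ ‖φ y‖ * (2 ^ (k - 1) * (1 ^ k + ‖y‖ ^ k)) := by gcongr
    _ = _ := by simp; ring

/-- The convolution is the superposition of the translates of `ψ` with weights `φ y`, and the
seminorms of these translates grow only polynomially in `y`. -/
theorem map_convolution (u : 𝓢(V, ℂ) →L[ℂ] ℂ) (φ ψ : 𝓢(V, ℂ)) :
    u (SchwartzMap.convolution (ContinuousLinearMap.mul ℂ ℂ) φ ψ) =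
      ∫ y, φ y * u (SchwartzMap.compSubConstCLM ℂ y ψ) := by
  have hc : Continuous fun y => φ y • SchwartzMap.compSubConstCLM ℂ y ψ :=
    φ.continuous.smul (continuous_compSubConstCLM ψ)
  rw [map_eq_integral (μ := volume) u hc]
  · simp
  · intro k n
    obtain ⟨C, hC, h⟩ := seminorm_compSubConstCLM_le ψ k n
    refine ((integrable_norm_mul_one_add_pow φ k).const_mul C).mono' ?_ (.of_forall fun y => ?_)
    · exact (((schwartz_withSeminorms ℂ V ℂ).continuous_seminorm (k, n)).comp
        hc).aestronglyMeasurable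
    · rw [Real.norm_of_nonneg (apply_nonneg _ _), map_smul_eq_mul]
      calc _ ≤ ‖φ y‖ * (C * (1 + ‖y‖) ^ k) := by gcongr; exact h y
        _ = _ := by ring
  · intro x
    rw [SchwartzMap.convolution_apply]
    rfl

end Convolution

/-! ### Approximation by multiplying with slowly varying functions -/

section Dilation

variable {E : Type*} [NormedAddCommGroup E] [NormedSpace ℝ E]

/-- The test function `x ↦ f (c x)`, `c ≠ 0`. -/
noncomputable def dilate (c : ℝ) (hc : c ≠ 0) : 𝓢(E, ℂ) →L[ℂ] 𝓢(E, ℂ) :=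
  SchwartzMap.compCLMOfContinuousLinearEquiv ℂ
    (ContinuousLinearEquiv.smulLeft (R₁ := ℝ) (M₁ := E) (Units.mk0 c hc))

/-- The pointwise product of two test functions. -/
noncomputable def mulTest (f : 𝓢(E, ℂ)) : 𝓢(E, ℂ) →L[ℂ] 𝓢(E, ℂ) :=
  SchwartzMap.pairing (ContinuousLinearMap.mul ℂ ℂ) f

/-- At order zero the factor `c * ‖x‖` comes from the mean value inequality starting at `0`. At
positive order each derivative brings out a power of `c ≤ 1`. -/
theorem norm_iteratedFDeriv_dilate_sub_one_le (χ : 𝓢(E, ℂ)) (h0 : χ 0 = 1) (i : ℕ) :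
    ∃ C : ℝ, 0 ≤ C ∧ ∀ (c : ℝ), 0 < c → c ≤ 1 → ∀ x : E,
      ‖iteratedFDeriv ℝ i (fun x => χ (c • x) - 1) x‖ ≤ C * c * (1 + ‖x‖) := by
  rcases i with _ | i
  · refine ⟨SchwartzMap.seminorm ℝ 0 1 χ, apply_nonneg _ _, fun c hc hc1 x => ?_⟩
    rw [norm_iteratedFDeriv_zero]
    have h := (convex_univ (𝕜 := ℝ) (E := E)).norm_image_sub_le_of_norm_fderiv_le (f := χ) (𝕜 := ℝ)
      (C := SchwartzMap.seminorm ℝ 0 1 χ) (x := 0) (y := c • x)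
      (fun z _ => χ.differentiableAt) (fun z _ => by
        rw [← norm_iteratedFDeriv_one]
        exact χ.norm_iteratedFDeriv_le_seminorm ℝ 1 z) trivial trivial
    rw [h0, sub_zero, norm_smul, Real.norm_of_nonneg hc.le] at h
    refine h.trans ?_
    rw [← mul_assoc]
    gcongr
    linarith
  · refine ⟨SchwartzMap.seminorm ℝ 0 (i + 1) χ, apply_nonneg _ _, fun c hc hc1 x => ?_⟩
    have h1 : iteratedFDeriv ℝ (i + 1) (fun x => χ (c • x) - 1) =
        fun x => c ^ (i + 1) • iteratedFDeriv ℝ (i + 1) χ (c • x) := by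
      rw [← iteratedFDeriv_comp_const_smul c (χ.smooth (i + 1 : ℕ))]
      have hs : ContDiff ℝ (i + 1 : ℕ) (fun x => χ (c • x)) :=
        (χ.smooth (i + 1 : ℕ)).comp (contDiff_const_smul c)
      funext x
      have := iteratedFDeriv_sub_apply (𝕜 := ℝ) (i := i + 1) (x := x) (g := fun _ : E => (1 : ℂ))
        hs.contDiffAt contDiffAt_const
      rw [iteratedFDeriv_const_of_ne (by simp)] at this
      rw [Pi.zero_apply, sub_zero] at this
      exact this
    rw [h1, norm_smul, norm_pow, Real.norm_of_nonneg hc.le, pow_succ]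
    have h2 := χ.norm_iteratedFDeriv_le_seminorm ℝ (i + 1) (c • x)
    have h3 : c ^ i ≤ 1 := pow_le_one₀ hc.le hc1
    calc c ^ i * c * ‖iteratedFDeriv ℝ (i + 1) χ (c • x)‖
        ≤ 1 * c * SchwartzMap.seminorm ℝ 0 (i + 1) χ := by gcongr
      _ = SchwartzMap.seminorm ℝ 0 (i + 1) χ * c * 1 := by ring
      _ ≤ _ := by gcongr; linarith [norm_nonneg x]

theorem seminorm_mulTest_dilate_sub_le (φ χ : 𝓢(E, ℂ)) (h0 : χ 0 = 1) (k n : ℕ) :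
    ∃ C : ℝ, ∀ (c : ℝ) (hc : 0 < c), c ≤ 1 →
      SchwartzMap.seminorm ℂ k n (mulTest φ (dilate c hc.ne' χ) - φ) ≤ C * c := by
  choose A hA0 hA using fun i => norm_iteratedFDeriv_dilate_sub_one_le χ h0 i
  -- The extra power in `k + 1` absorbs the growth `1 + ‖x‖` of `χ (c x) - 1`.
  choose B hB0 hB using fun i => one_add_norm_pow_mul_iteratedFDeriv_le φ (k + 1) i
  refine ⟨∑ i ∈ Finset.range (n + 1), (n.choose i : ℝ) * B i * A (n - i), fun c hc hc1 => ?_⟩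
  have hpos : 0 ≤ ∑ i ∈ Finset.range (n + 1), (n.choose i : ℝ) * B i * A (n - i) :=
    Finset.sum_nonneg fun i _ => by have := hB0 i; have := hA0 (n - i); positivity
  refine SchwartzMap.seminorm_le_bound ℂ k n _ (by positivity) fun x => ?_
  have hfun : (⇑(mulTest φ (dilate c hc.ne' χ) - φ) : E → ℂ) =
      fun x => φ x * (χ (c • x) - 1) := by
    funext x
    change φ x * χ (c • x) - φ x = _
    ring
  have hs : ContDiff ℝ ∞ (fun x => χ (c • x) - 1) :=
    ((χ.smooth ⊤).comp (contDiff_const_smul c)).sub contDiff_const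
  have h := norm_iteratedFDeriv_mul_le (𝕜 := ℝ) (n := n) (N := ∞) (φ.smooth ⊤) hs x
    (mod_cast le_top)
  rw [hfun, Finset.sum_mul]
  refine (mul_le_mul_of_nonneg_left h (by positivity)).trans ?_
  rw [Finset.mul_sum]
  refine Finset.sum_le_sum fun i _ => ?_
  have h1 := hA (n - i) c hc hc1 x
  have h2 := hB i x
  have h3 := hA0 (n - i)
  have h4 : ‖x‖ ^ k ≤ (1 + ‖x‖) ^ k := by gcongr; linarith
  calc ‖x‖ ^ k * ((n.choose i : ℝ) * ‖iteratedFDeriv ℝ i φ x‖ *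
        ‖iteratedFDeriv ℝ (n - i) (fun x => χ (c • x) - 1) x‖)
      ≤ (1 + ‖x‖) ^ k * ((n.choose i : ℝ) * ‖iteratedFDeriv ℝ i φ x‖ *
        (A (n - i) * c * (1 + ‖x‖))) := by gcongr
    _ = (n.choose i : ℝ) * ((1 + ‖x‖) ^ (k + 1) * ‖iteratedFDeriv ℝ i φ x‖) * A (n - i) * c := by
      ring
    _ ≤ _ := by gcongr

theorem tendsto_mulTest_dilate (φ χ : 𝓢(E, ℂ)) (h0 : χ 0 = 1) {c : ℕ → ℝ} (hc : ∀ n, 0 < c n)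
    (hc1 : ∀ n, c n ≤ 1) (hlim : Filter.Tendsto c Filter.atTop (nhds 0)) :
    Filter.Tendsto (fun n => mulTest φ (dilate (c n) (hc n).ne' χ)) Filter.atTop (nhds φ) := by
  rw [(schwartz_withSeminorms ℂ E ℂ).tendsto_nhds]
  rintro ⟨k, n⟩ ε hε
  obtain ⟨C, h⟩ := seminorm_mulTest_dilate_sub_le φ χ h0 k n
  have ht : Filter.Tendsto (fun n => C * c n) Filter.atTop (nhds 0) := by
    simpa using hlim.const_mul C
  filter_upwards [ht.eventually_lt_const hε] with j hj
  exact (h (c j) (hc j) (hc1 j)).trans_lt hj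

end Dilation

/-! ### Modulations and pointwise products -/

section Modulation

variable {V : Type*} [NormedAddCommGroup V] [InnerProductSpace ℝ V] [FiniteDimensional ℝ V]
  [MeasurableSpace V] [BorelSpace V]

open FourierTransform

/-- The test function `x ↦ exp (-2πi ⟨y, x⟩) f x`. -/
noncomputable def modulate (y : V) (f : 𝓢(V, ℂ)) : 𝓢(V, ℂ) :=
  𝓕 (SchwartzMap.compSubConstCLM ℂ y (𝓕⁻ f : 𝓢(V, ℂ)))

theorem modulate_apply (y : V) (f : 𝓢(V, ℂ)) (x : V) :
    modulate y f x = Complex.exp (-(2 * Real.pi * inner ℝ y x * Complex.I)) * f x := by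
  have h : ∀ g : 𝓢(V, ℂ), (𝓕 (SchwartzMap.compSubConstCLM ℂ y g) : 𝓢(V, ℂ)) x =
      Complex.exp (-(2 * Real.pi * inner ℝ y x * Complex.I)) * (𝓕 g : 𝓢(V, ℂ)) x := by
    intro g
    rw [SchwartzMap.fourier_coe, SchwartzMap.fourier_coe, Real.fourier_eq', Real.fourier_eq',
      ← integral_const_mul, ← integral_add_right_eq_self _ y]
    refine integral_congr_ae (.of_forall fun v => ?_)
    simp only [SchwartzMap.compSubConstCLM_apply, add_sub_cancel_right, smul_eq_mul]
    rw [← mul_assoc, ← Complex.exp_add, inner_add_left]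
    congr 2
    push_cast
    ring
  rw [modulate, h, FourierTransform.fourier_fourierInv_eq]

/-- Fourier inversion of `φ` writes the product as a superposition of modulations of `χ`. Formally
this is `map_convolution` for `u` composed with the Fourier transform. -/
theorem map_mulTest (u : 𝓢(V, ℂ) →L[ℂ] ℂ) (φ χ : 𝓢(V, ℂ)) :
    u (mulTest φ χ) = ∫ y, (𝓕⁻ φ : 𝓢(V, ℂ)) y * u (modulate y χ) := by
  have h := map_convolution (u ∘L fourierCLM ℂ 𝓢(V, ℂ)) (𝓕⁻ φ) (𝓕⁻ χ)
  simp only [ContinuousLinearMap.comp_apply, FourierTransform.fourierCLM_apply,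
    SchwartzMap.fourier_convolution, FourierTransform.fourier_fourierInv_eq] at h
  exact h

end Modulation

/-! ### Injectivity of the Laplace transform in time -/

section HalfPlane

/-- The margin `b < 0` places the closed support of `φ - ψ` inside the open half-plane where `z`
vanishes. -/
theorem map_eq_of_eqOn {z : 𝓢'(ℝ × ℝ, ℂ)}
    (hz : Distribution.IsVanishingOn z {p : ℝ × ℝ | p.2 < 0}) {b : ℝ} (hb : b < 0)
    {φ ψ : 𝓢(ℝ × ℝ, ℂ)} (h : ∀ p : ℝ × ℝ, b < p.2 → φ p = ψ p) : z φ = z ψ := by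
  rw [← sub_eq_zero, ← map_sub]
  refine hz _ fun p hp => ?_
  have hcl : IsClosed {p : ℝ × ℝ | p.2 ≤ b} := isClosed_le continuous_snd continuous_const
  have hs : tsupport (φ - ψ) ⊆ {p : ℝ × ℝ | p.2 ≤ b} := by
    refine closure_minimal (fun q hq => ?_) hcl
    by_contra hlt
    refine hq ?_
    have := h q (not_le.1 hlt)
    simp [this]
  exact lt_of_le_of_lt (hs hp) hb

theorem expFun_mul_exp (s w : ℂ) (t : ℝ) :
    Complex.exp (-(w * t)) * expFun s t = expFun (s + w) t := by
  simp only [expFun]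
  rw [mul_left_comm, ← Complex.exp_add]
  congr 2
  ring

theorem expTest_apply (s : ℂ) (hs : 0 < s.re) (t : ℝ) : expTest s hs t = expFun s t := rfl

theorem tensorTest_apply (f g : 𝓢(ℝ, ℂ)) (p : ℝ × ℝ) : tensorTest f g p = f p.1 * g p.2 := rfl

-- Modulating `f(x) exp(-st)` modulates `f` and shifts `s` by an imaginary number. The family of
-- test products is therefore stable under modulation, and the integrand in `map_mulTest` vanishes
-- identically.
open FourierTransform in
theorem map_mulTest_tensorTest {z : 𝓢'(ℝ × ℝ, ℂ)}
    (h : ∀ (s : ℂ) (hs : 0 < s.re) (f : 𝓢(ℝ, ℂ)), z (tensorTest f (expTest s hs)) = 0)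
    (φ : 𝓢(ℝ × ℝ, ℂ)) (f : 𝓢(ℝ, ℂ)) (s : ℂ) (hs : 0 < s.re) :
    z (mulTest φ (tensorTest f (expTest s hs))) = 0 := by
  -- The product carries the sup norm, whereas the Fourier transform needs an inner product.
  let e : WithLp 2 (ℝ × ℝ) ≃L[ℝ] ℝ × ℝ := WithLp.prodContinuousLinearEquiv 2 ℝ ℝ ℝ
  let T : 𝓢(WithLp 2 (ℝ × ℝ), ℂ) →L[ℂ] 𝓢(ℝ × ℝ, ℂ) :=
    SchwartzMap.compCLMOfContinuousLinearEquiv ℂ e.symm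
  let T' : 𝓢(ℝ × ℝ, ℂ) →L[ℂ] 𝓢(WithLp 2 (ℝ × ℝ), ℂ) :=
    SchwartzMap.compCLMOfContinuousLinearEquiv ℂ e
  let z' : 𝓢(ℝ × ℝ, ℂ) →L[ℂ] ℂ := z
  have key := map_mulTest (z' ∘L T) (T' φ) (T' (tensorTest f (expTest s hs)))
  have h1 : T (mulTest (T' φ) (T' (tensorTest f (expTest s hs)))) =
      mulTest φ (tensorTest f (expTest s hs)) := by
    ext p
    rfl
  rw [ContinuousLinearMap.comp_apply, h1] at key
  refine key.trans (integral_eq_zero_of_ae (.of_forall fun y => ?_))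
  have hre : (s + 2 * Real.pi * y.snd * Complex.I).re = s.re := by simp
  have h2 : T (modulate y (T' (tensorTest f (expTest s hs)))) =
      tensorTest (modulate y.fst f)
        (expTest (s + 2 * Real.pi * y.snd * Complex.I) (by rwa [hre])) := by
    ext p
    change modulate y (T' (tensorTest f (expTest s hs))) (e.symm p) = _
    rw [modulate_apply, tensorTest_apply, modulate_apply, expTest_apply, ← expFun_mul_exp]
    change _ * (f p.1 * expFun s p.2) = _
    have h3 : inner ℝ y (e.symm p) = inner ℝ y.fst p.1 + inner ℝ y.snd p.2 := by
      rw [WithLp.prod_inner_apply]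
      rfl
    rw [h3]
    have h4 : Complex.exp (-(2 * Real.pi * ((inner ℝ y.fst p.1 + inner ℝ y.snd p.2 : ℝ) : ℂ)
        * Complex.I)) = Complex.exp (-(2 * Real.pi * ((inner ℝ y.fst p.1 : ℝ) : ℂ) * Complex.I)) *
        Complex.exp (-(2 * Real.pi * y.snd * Complex.I * p.2)) := by
      rw [← Complex.exp_add]
      congr 1
      simp
      ring
    rw [h4]
    ring
  have h5 : z' (T (modulate y (T' (tensorTest f (expTest s hs))))) = 0 := by
    rw [h2]
    exact h _ _ _
  simp [h5]

/-- A test function equal to `1` on `[-1, 1]`. -/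
noncomputable def unitBump : 𝓢(ℝ, ℂ) :=
  HasCompactSupport.toSchwartzMap
    (f := fun x : ℝ => (((⟨1, 2, one_pos, one_lt_two⟩ : ContDiffBump (0 : ℝ)) x : ℝ) : ℂ))
    ((ContDiffBump.hasCompactSupport _).comp_left (g := fun r : ℝ => (r : ℂ)) Complex.ofReal_zero)
    (Complex.ofRealCLM.contDiff.comp (ContDiffBump.contDiff _))

theorem unitBump_zero : unitBump 0 = 1 := by
  change (((⟨1, 2, one_pos, one_lt_two⟩ : ContDiffBump (0 : ℝ)) 0 : ℝ) : ℂ) = 1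
  rw [ContDiffBump.one_of_mem_closedBall _ (by simp)]
  simp

/-- The Laplace transform in `t` is injective on tempered distributions vanishing for `t < 0`. -/
theorem eq_zero_of_laplace_eq_zero {z : 𝓢'(ℝ × ℝ, ℂ)}
    (hz : Distribution.IsVanishingOn z {p : ℝ × ℝ | p.2 < 0})
    (h : ∀ (s : ℂ) (hs : 0 < s.re) (f : 𝓢(ℝ, ℂ)), z (tensorTest f (expTest s hs)) = 0) :
    z = 0 := by
  ext φ
  -- Since `χ 0 = 1`, the products `φ(z) χ(cz)` tend to `φ` as `c → 0`. It remains to see that `z`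
  -- kills each of them.
  let χ : 𝓢(ℝ × ℝ, ℂ) := tensorTest unitBump (expTest 1 (by simp))
  have hχ : χ 0 = 1 := by
    change unitBump 0 * expFun 1 0 = 1
    rw [unitBump_zero, expFun_of_ge _ (by norm_num)]
    simp
  let c : ℕ → ℝ := fun n => 1 / ((n : ℝ) + 1)
  have hc : ∀ n, 0 < c n := fun n => by positivity
  have hc1 : ∀ n, c n ≤ 1 := fun n => by
    rw [div_le_one (by positivity)]
    linarith [Nat.cast_nonneg (α := ℝ) n]
  have hlim := tendsto_mulTest_dilate φ χ hχ hc hc1 tendsto_one_div_add_atTop_nhds_zero_nat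
  have h1 := ((map_continuous z).tendsto φ).comp hlim
  have h2 : ∀ n, z (mulTest φ (dilate (c n) (hc n).ne' χ)) = 0 := by
    intro n
    have hre : 0 < ((c n : ℝ) : ℂ).re := by simpa using hc n
    rw [← map_mulTest_tensorTest h φ (dilate (c n) (hc n).ne' unitBump) (c n) hre]
    -- As `c ≤ 1`, both time cutoffs equal `1` for `t > -1`. There the dilated `χ` is the dilated
    -- bump times `exp(-ct)`.
    refine map_eq_of_eqOn hz (b := -1) (by norm_num) fun p hp => ?_
    change φ p * (unitBump (c n • p.1) * expFun 1 (c n * p.2)) =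
      φ p * (unitBump (c n • p.1) * expFun (c n) p.2)
    have h3 : -1 ≤ c n * p.2 := by nlinarith [hc n, hc1 n]
    rw [expFun_of_ge _ h3, expFun_of_ge _ hp.le]
    push_cast
    ring_nf
  have h3 : Filter.Tendsto (fun _ : ℕ => (0 : ℂ)) Filter.atTop (nhds (z φ)) :=
    h1.congr fun n => h2 n
  exact tendsto_nhds_unique h3 tendsto_const_nhds

theorem eq_of_laplace_eq {z w : 𝓢'(ℝ × ℝ, ℂ)}
    (hz : Distribution.IsVanishingOn z {p : ℝ × ℝ | p.2 < 0})
    (hw : Distribution.IsVanishingOn w {p : ℝ × ℝ | p.2 < 0})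
    (h : ∀ (s : ℂ) (hs : 0 < s.re) (f : 𝓢(ℝ, ℂ)),
      z (tensorTest f (expTest s hs)) = w (tensorTest f (expTest s hs))) : z = w := by
  rw [← sub_eq_zero]
  refine eq_zero_of_laplace_eq_zero (fun φ hφ => ?_) fun s hs f => ?_
  · change z φ - w φ = 0
    rw [hz φ hφ, hw φ hφ, sub_zero]
  · change z _ - w _ = 0
    rw [h, sub_self]

end HalfPlane

/-! ### Polynomial growth of Laplace transforms -/

section Growth

theorem pow_mul_exp_neg_le (k : ℕ) {r x : ℝ} (hr : 0 < r) (hx : 0 ≤ x) :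
    x ^ k * Real.exp (-(r * x)) ≤ k.factorial / r ^ k := by
  have h := Real.pow_div_factorial_le_exp (r * x) (by positivity) k
  rw [div_le_iff₀ (by positivity), mul_pow] at h
  rw [le_div_iff₀ (by positivity), Real.exp_neg, mul_assoc, mul_comm _ (r ^ k), ← mul_assoc,
    ← div_eq_mul_inv, div_le_iff₀ (Real.exp_pos _), mul_comm (x ^ k)]
  linarith

theorem norm_iteratedFDeriv_smoothTransition_le (i : ℕ) :
    ∃ B : ℝ, 0 ≤ B ∧ ∀ t : ℝ, ‖iteratedFDeriv ℝ i
      (fun t : ℝ => ((Real.smoothTransition (t + 2) : ℝ) : ℂ)) t‖ ≤ B := by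
  set f : ℝ → ℂ := fun t => ((Real.smoothTransition (t + 2) : ℝ) : ℂ) with hf
  have hs : ContDiff ℝ ∞ f := Complex.ofRealCLM.contDiff.comp
      (Real.smoothTransition.contDiff.comp (contDiff_id.add contDiff_const))
  have hcont : Continuous (fun t => ‖iteratedFDeriv ℝ i f t‖) :=
    (hs.continuous_iteratedFDeriv (m := i) (mod_cast le_top)).norm
  obtain ⟨C, hC⟩ := (isCompact_Icc (a := (-3 : ℝ)) (b := 0)).bddAbove_image hcont.continuousOn
  have hconst : ∀ (c : ℂ) (t : ℝ), f =ᶠ[nhds t] (fun _ => c) → ‖c‖ ≤ 1 →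
      ‖iteratedFDeriv ℝ i f t‖ ≤ 1 := by
    intro c t h hc
    rw [(h.iteratedFDeriv ℝ i).eq_of_nhds]
    rcases i with _ | i
    · simpa using hc
    · rw [iteratedFDeriv_const_of_ne (by simp)]
      simp
  refine ⟨max C 1, le_max_of_le_right zero_le_one, fun t => ?_⟩
  rcases lt_or_ge t (-3) with h | h
  · refine le_max_of_le_right (hconst 0 t ?_ (by simp))
    filter_upwards [Iio_mem_nhds h] with r hr
    simp only [hf]
    rw [Real.smoothTransition.zero_of_nonpos (by linarith [Set.mem_Iio.1 hr])]
    simp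
  · rcases le_or_gt t 0 with h' | h'
    · exact le_max_of_le_left (hC ⟨t, ⟨h, h'⟩, rfl⟩)
    · refine le_max_of_le_right (hconst 1 t ?_ (by simp))
      filter_upwards [Ioi_mem_nhds h'] with r hr
      simp only [hf]
      rw [Real.smoothTransition.one_of_one_le (by linarith [Set.mem_Ioi.1 hr])]
      simp

theorem seminorm_expTest_le (k n : ℕ) :
    ∃ C : ℝ, 0 ≤ C ∧ ∀ (s : ℂ) (hs : 0 < s.re), s.re ≤ 1 →
      SchwartzMap.seminorm ℂ k n (expTest s hs) ≤ C * (1 + ‖s‖) ^ n * (1 / s.re) ^ k := by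
  choose B hB0 hB using norm_iteratedFDeriv_smoothTransition_le
  set S := ∑ i ∈ Finset.range (n + 1), (n.choose i : ℝ) * B i with hS
  have hS0 : 0 ≤ S := Finset.sum_nonneg fun i _ => by have := hB0 i; positivity
  refine ⟨S * (k.factorial * Real.exp 4), by positivity, fun s hs hs1 =>
    SchwartzMap.seminorm_le_bound ℂ k n _ (by positivity) fun t => ?_⟩
  change ‖t‖ ^ k * ‖iteratedFDeriv ℝ n (expFun s) t‖ ≤ _
  rcases lt_or_ge t (-2) with h | h
  · have he : expFun s =ᶠ[nhds t] fun _ => 0 := by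
      filter_upwards [Iio_mem_nhds h] with r hr
      exact expFun_of_le s (le_of_lt hr)
    rw [(he.iteratedFDeriv ℝ n).eq_of_nhds]
    simp only [iteratedFDeriv_fun_zero, Pi.zero_apply, norm_zero, mul_zero]
    positivity
  · have hf : ContDiff ℝ ∞ (fun t : ℝ => ((Real.smoothTransition (t + 2) : ℝ) : ℂ)) :=
      Complex.ofRealCLM.contDiff.comp
        (Real.smoothTransition.contDiff.comp (contDiff_id.add contDiff_const))
    have hg : ContDiff ℝ ∞ (fun t : ℝ => Complex.exp (-(s * t))) :=
      Complex.contDiff_exp.comp (contDiff_const.mul Complex.ofRealCLM.contDiff).neg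
    have hmul := norm_iteratedFDeriv_mul_le (𝕜 := ℝ) (n := n) (N := ∞) hf hg t (mod_cast le_top)
    have hgn : ∀ j, ‖iteratedFDeriv ℝ j (fun t : ℝ => Complex.exp (-(s * t))) t‖ =
        ‖s‖ ^ j * Real.exp (-(s.re * t)) := by
      intro j
      rw [norm_iteratedFDeriv_eq_norm_iteratedDeriv, iteratedDeriv_exp, norm_mul, norm_pow,
        norm_neg, Complex.norm_exp]
      simp
    have h1 : ‖iteratedFDeriv ℝ n (expFun s) t‖ ≤
        S * ((1 + ‖s‖) ^ n * Real.exp (-(s.re * t))) := by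
      refine hmul.trans ?_
      rw [hS, Finset.sum_mul]
      refine Finset.sum_le_sum fun i hi => ?_
      rw [hgn]
      have h2 : ‖s‖ ^ (n - i) ≤ (1 + ‖s‖) ^ n :=
        (pow_le_pow_left₀ (norm_nonneg _) (by linarith) _).trans
          (pow_le_pow_right₀ (by linarith [norm_nonneg s]) (Nat.sub_le _ _))
      have := hB i t
      have := hB0 i
      gcongr
    have h3 : ‖t‖ ^ k * Real.exp (-(s.re * t)) ≤ k.factorial * Real.exp 4 * (1 / s.re) ^ k := by
      -- On `t ≥ -2` one has `|t| ≤ t + 4`. The shift by `4` costs `exp(4 Re s) ≤ exp 4`, which is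
      -- where `Re s ≤ 1` is needed.
      have h4 := pow_mul_exp_neg_le k hs (x := t + 4) (by linarith)
      have h5 : ‖t‖ ≤ t + 4 := by
        rw [Real.norm_eq_abs, abs_le]
        constructor <;> linarith
      have h6 : Real.exp (-(s.re * t)) ≤ Real.exp 4 * Real.exp (-(s.re * (t + 4))) := by
        rw [← Real.exp_add]
        apply Real.exp_le_exp.2
        nlinarith
      have h7 : 0 ≤ t + 4 := by linarith
      calc ‖t‖ ^ k * Real.exp (-(s.re * t))
          ≤ (t + 4) ^ k * (Real.exp 4 * Real.exp (-(s.re * (t + 4)))) := by gcongr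
        _ = Real.exp 4 * ((t + 4) ^ k * Real.exp (-(s.re * (t + 4)))) := by ring
        _ ≤ Real.exp 4 * (k.factorial / s.re ^ k) := by gcongr
        _ = _ := by rw [one_div, inv_pow]; ring
    calc ‖t‖ ^ k * ‖iteratedFDeriv ℝ n (expFun s) t‖
        ≤ ‖t‖ ^ k * (S * ((1 + ‖s‖) ^ n * Real.exp (-(s.re * t)))) := by gcongr
      _ = S * (1 + ‖s‖) ^ n * (‖t‖ ^ k * Real.exp (-(s.re * t))) := by ring
      _ ≤ S * (1 + ‖s‖) ^ n * (k.factorial * Real.exp 4 * (1 / s.re) ^ k) := by gcongr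
      _ = _ := by ring

theorem seminorm_dilate_le (k n : ℕ) (f : 𝓢(ℝ, ℂ)) {c : ℝ} (hc : 1 ≤ c) :
    SchwartzMap.seminorm ℂ k n (dilate c (by positivity) f) ≤
      c ^ n * SchwartzMap.seminorm ℂ k n f := by
  refine SchwartzMap.seminorm_le_bound ℂ k n _ (by positivity) fun x => ?_
  have h : iteratedFDeriv ℝ n (dilate c (by positivity) f) x =
      c ^ n • iteratedFDeriv ℝ n f (c • x) :=
    congrFun (iteratedFDeriv_comp_const_smul c (f.smooth n)) x
  have hc0 : 0 ≤ c := by linarith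
  rw [h, norm_smul, norm_pow, Real.norm_of_nonneg hc0]
  have h1 : ‖x‖ ≤ ‖c • x‖ := by
    rw [norm_smul, Real.norm_of_nonneg hc0]
    nlinarith [norm_nonneg x]
  calc ‖x‖ ^ k * (c ^ n * ‖iteratedFDeriv ℝ n f (c • x)‖)
      ≤ ‖c • x‖ ^ k * (c ^ n * ‖iteratedFDeriv ℝ n f (c • x)‖) := by gcongr
    _ = c ^ n * (‖c • x‖ ^ k * ‖iteratedFDeriv ℝ n f (c • x)‖) := by ring
    _ ≤ _ := by gcongr; exact SchwartzMap.le_seminorm ℂ k n f _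

theorem map_eq_of_eqOn_Ioi {y : 𝓢'(ℝ, ℂ)} (hy : Distribution.IsVanishingOn y (Set.Iio 0)) {b : ℝ}
    (hb : b < 0) {φ ψ : 𝓢(ℝ, ℂ)} (h : ∀ t, b < t → φ t = ψ t) : y φ = y ψ := by
  rw [← sub_eq_zero, ← map_sub]
  refine hy _ fun p hp => ?_
  have hs : tsupport (φ - ψ) ⊆ Set.Iic b := by
    refine closure_minimal (fun q hq => ?_) isClosed_Iic
    by_contra hlt
    refine hq ?_
    have := h q (not_le.1 hlt)
    simp [this]
  exact lt_of_le_of_lt (hs hp) hb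

/-- Functions on the right half-plane of polynomial growth. -/
def PolyGrowth (F : ℂ → ℂ) (N M : ℕ) : Prop :=
  ∃ C : ℝ, 0 ≤ C ∧ ∀ s : ℂ, 0 < s.re → ‖F s‖ ≤ C * ‖1 + s‖ ^ N * (1 + 1 / s.re) ^ M

theorem re_lt_norm_one_add {s : ℂ} : 1 + s.re ≤ ‖1 + s‖ := by
  have := Complex.re_le_norm (1 + s)
  simpa using this

theorem norm_le_norm_one_add {s : ℂ} (hs : 0 < s.re) : ‖s‖ ≤ ‖1 + s‖ := by
  rw [Complex.norm_def, Complex.norm_def]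
  apply Real.sqrt_le_sqrt
  simp only [Complex.normSq_apply, Complex.add_re, Complex.one_re, Complex.add_im, Complex.one_im]
  nlinarith

/-- Continuity of `y` bounds `Y s` by seminorms of `exp(-st)`, but the cut-off part at negative
times would contribute an exponential in `Re s`. Rescaling time by `1 + Re s` replaces `s` by `s /
(1 + Re s)`, whose real part is below `1`, at polynomial cost. -/
theorem IsInverseLaplace.polyGrowth {y : 𝓢'(ℝ, ℂ)} {Y : ℂ → ℂ} (h : IsInverseLaplace y Y) :
    ∃ N M, PolyGrowth Y N M := by
  obtain ⟨S, C, hC, hy⟩ := exists_seminorm_bound (E := ℝ) (y : 𝓢(ℝ, ℂ) →L[ℂ] ℂ)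
  choose D hD0 hD using fun i : ℕ × ℕ => seminorm_expTest_le i.1 i.2
  set N := S.sup Prod.snd
  set M := S.sup Prod.fst
  refine ⟨N, M, C * ∑ i ∈ S, D i * 2 ^ N, mul_nonneg hC (Finset.sum_nonneg fun i _ =>
    mul_nonneg (hD0 i) (by positivity)), fun s hs => ?_⟩
  rw [← h.2 s hs]
  have h1 : 0 < 1 + s.re := by linarith
  have hre : (s / ((1 + s.re : ℝ) : ℂ)).re = s.re / (1 + s.re) := Complex.div_ofReal_re _ _
  have hs' : 0 < (s / ((1 + s.re : ℝ) : ℂ)).re := by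
    rw [hre]; positivity
  set g := dilate (1 + s.re) h1.ne' (expTest (s / ((1 + s.re : ℝ) : ℂ)) hs') with hg
  have heq : y (expTest s hs) = y g := by
    refine map_eq_of_eqOn_Ioi h.1 (b := -(1 / (1 + s.re))) (by
      have : 0 < 1 / (1 + s.re) := by positivity
      linarith) fun t ht => ?_
    change expFun s t = expFun (s / ((1 + s.re : ℝ) : ℂ)) ((1 + s.re) * t)
    have h2 : 1 / (1 + s.re) ≤ 1 := by
      rw [div_le_one h1]; linarith
    have h3 : -1 ≤ (1 + s.re) * t := by
      have := mul_lt_mul_of_pos_left ht h1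
      rw [mul_neg, mul_one_div_cancel h1.ne'] at this
      exact this.le
    rw [expFun_of_ge _ (by linarith), expFun_of_ge _ h3]
    congr 2
    have : ((1 + s.re : ℝ) : ℂ) ≠ 0 := by exact_mod_cast h1.ne'
    push_cast at this ⊢
    field_simp
  rw [heq]
  refine (hy g).trans ?_
  rw [mul_assoc C, mul_assoc C]
  refine mul_le_mul_of_nonneg_left ?_ hC
  have hM1 : 1 ≤ 1 + 1 / s.re := by
    have : 0 < 1 / s.re := by positivity
    linarith
  have hN1 : 1 ≤ ‖1 + s‖ := by linarith [re_lt_norm_one_add (s := s)]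
  refine Seminorm.finset_sup_apply_le (mul_nonneg (mul_nonneg (Finset.sum_nonneg fun i _ =>
    mul_nonneg (hD0 i) (by positivity)) (by positivity)) (by positivity)) fun i hi => ?_
  change SchwartzMap.seminorm ℂ i.1 i.2 g ≤ _
  have h4 : i.2 ≤ N := Finset.le_sup (f := Prod.snd) hi
  have h5 : i.1 ≤ M := Finset.le_sup (f := Prod.fst) hi
  have h6 : (1 + s.re) * (1 + ‖s / ((1 + s.re : ℝ) : ℂ)‖) ≤ 2 * ‖1 + s‖ := by
    rw [norm_div, Complex.norm_real, Real.norm_of_nonneg h1.le, mul_add,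
      mul_div_cancel₀ _ h1.ne']
    linarith [re_lt_norm_one_add (s := s), norm_le_norm_one_add hs]
  -- This is the source of the factor `1 + 1 / Re s` in `PolyGrowth`.
  have h7 : 1 / (s.re / (1 + s.re)) = 1 + 1 / s.re := by field_simp; ring
  have h8 := hD i _ hs' (by rw [hre, div_le_one h1]; linarith)
  rw [hre, h7] at h8
  calc SchwartzMap.seminorm ℂ i.1 i.2 g
      ≤ (1 + s.re) ^ i.2 * SchwartzMap.seminorm ℂ i.1 i.2
          (expTest (s / ((1 + s.re : ℝ) : ℂ)) hs') := seminorm_dilate_le _ _ _ (by linarith)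
    _ ≤ (1 + s.re) ^ i.2 * (D i * (1 + ‖s / ((1 + s.re : ℝ) : ℂ)‖) ^ i.2 *
          (1 + 1 / s.re) ^ i.1) := by gcongr
    _ = D i * ((1 + s.re) * (1 + ‖s / ((1 + s.re : ℝ) : ℂ)‖)) ^ i.2 *
          (1 + 1 / s.re) ^ i.1 := by rw [mul_pow]; ring
    _ ≤ D i * (2 * ‖1 + s‖) ^ N * (1 + 1 / s.re) ^ M := by
      have := hD0 i
      have h9 : 1 ≤ 2 * ‖1 + s‖ := by linarith
      have h10 : ((1 + s.re) * (1 + ‖s / ((1 + s.re : ℝ) : ℂ)‖)) ^ i.2 ≤ (2 * ‖1 + s‖) ^ N :=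
        (pow_le_pow_left₀ (by positivity) h6 _).trans (pow_le_pow_right₀ h9 h4)
      have h11 : (1 + 1 / s.re) ^ i.1 ≤ (1 + 1 / s.re) ^ M := pow_le_pow_right₀ hM1 h5
      gcongr
    _ = (D i * 2 ^ N) * ‖1 + s‖ ^ N * (1 + 1 / s.re) ^ M := by rw [mul_pow]; ring
    _ ≤ (∑ i ∈ S, D i * 2 ^ N) * ‖1 + s‖ ^ N * (1 + 1 / s.re) ^ M := by
      gcongr
      exact Finset.single_le_sum (f := fun i => D i * 2 ^ N)
        (fun j _ => mul_nonneg (hD0 j) (by positivity)) hi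
    _ = _ := by ring

end Growth

/-! ### Holomorphy of Laplace transforms -/

section Holomorphy

theorem norm_expFun (s : ℂ) (t : ℝ) :
    ‖expFun s t‖ = Real.smoothTransition (t + 2) * Real.exp (-(s.re * t)) := by
  rw [expFun, norm_mul, Complex.norm_real,
    Real.norm_of_nonneg (Real.smoothTransition.nonneg _), Complex.norm_exp]
  simp

theorem norm_expFun_le_add {s : ℂ} {a b : ℝ} (ha : a ≤ s.re) (hb : s.re ≤ b) (t : ℝ) :
    ‖expFun s t‖ ≤ ‖expFun a t‖ + ‖expFun b t‖ := by
  simp only [norm_expFun, Complex.ofReal_re]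
  rw [← mul_add]
  refine mul_le_mul_of_nonneg_left ?_ (Real.smoothTransition.nonneg _)
  rcases le_total 0 t with h | h
  · have : Real.exp (-(s.re * t)) ≤ Real.exp (-(a * t)) := by
      apply Real.exp_le_exp.2; nlinarith
    linarith [Real.exp_pos (-(b * t))]
  · have : Real.exp (-(s.re * t)) ≤ Real.exp (-(b * t)) := by
      apply Real.exp_le_exp.2; nlinarith
    linarith [Real.exp_pos (-(a * t))]

/-- Near `s₀` the exponentials are dominated by those with the real rates `Re s₀ / 2` and `3 Re s₀ /
2`. Differentiating in `s` costs one power of `t`. -/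
theorem differentiableOn_integral_expFun {q : ℝ → ℂ} (hq : Continuous q) {C : ℝ} {m : ℕ}
    (hbd : ∀ t, ‖q t‖ ≤ C * (1 + ‖t‖) ^ m) :
    DifferentiableOn ℂ (fun s => ∫ t : ℝ, expFun s t * q t) {s | 0 < s.re} := by
  intro s₀ hs₀
  have hs₀' : 0 < s₀.re := hs₀
  have hC : 0 ≤ C := by
    have := (norm_nonneg _).trans (hbd 0)
    simpa using this
  have hcont : ∀ s, Continuous (expFun s) := fun s => (expFun_contDiff s).continuous
  have ha : 0 < ((s₀.re / 2 : ℝ) : ℂ).re := by simpa using hs₀'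
  have hb : 0 < ((3 * s₀.re / 2 : ℝ) : ℂ).re := by simpa using hs₀'
  have hball : ∀ s ∈ Metric.ball s₀ (s₀.re / 2), s₀.re / 2 ≤ s.re ∧ s.re ≤ 3 * s₀.re / 2 := by
    intro s hs
    have h1 := (Complex.abs_re_le_norm (s - s₀)).trans_lt (mem_ball_iff_norm.1 hs)
    rw [Complex.sub_re, abs_lt] at h1
    constructor <;> linarith
  have hint := fun j => ((integrable_norm_mul_one_add_pow (expTest _ ha) j).add
    (integrable_norm_mul_one_add_pow (expTest _ hb) j)).const_mul C
  have hbd' : ∀ s ∈ Metric.ball s₀ (s₀.re / 2), ∀ j, ∀ t : ℝ,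
      ‖expFun s t‖ * (C * (1 + ‖t‖) ^ j) ≤ C * (‖expTest _ ha t‖ * (1 + ‖t‖) ^ j +
        ‖expTest _ hb t‖ * (1 + ‖t‖) ^ j) := by
    intro s hs j t
    have := norm_expFun_le_add (hball s hs).1 (hball s hs).2 t
    rw [expTest_apply, expTest_apply]
    calc _ ≤ (‖expFun ((s₀.re / 2 : ℝ) : ℂ) t‖ + ‖expFun ((3 * s₀.re / 2 : ℝ) : ℂ) t‖) *
          (C * (1 + ‖t‖) ^ j) := by gcongr
      _ = _ := by ring
  have hmem : s₀ ∈ Metric.ball s₀ (s₀.re / 2) := Metric.mem_ball_self (by positivity)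
  have key := hasDerivAt_integral_of_dominated_loc_of_deriv_le (𝕜 := ℂ) (μ := volume) (x₀ := s₀)
    (F := fun s t => expFun s t * q t) (F' := fun s t => -(t : ℂ) * expFun s t * q t)
    (Metric.ball_mem_nhds s₀ (by positivity : 0 < s₀.re / 2))
    (.of_forall fun s => ((hcont s).mul hq).aestronglyMeasurable)
    ((hint m).mono' ((hcont s₀).mul hq).aestronglyMeasurable (.of_forall fun t => by
      rw [norm_mul]
      refine le_trans ?_ (hbd' s₀ hmem m t)
      gcongr
      exact hbd t))
    (by
      have := hcont s₀
      exact (by fun_prop : Continuous fun t : ℝ => -(t : ℂ) * expFun s₀ t * q t).aestronglyMeasurable)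
    (.of_forall fun t s hs => by
      refine le_trans ?_ (hbd' s hs (m + 1) t)
      rw [norm_mul, norm_mul, norm_neg, Complex.norm_real]
      have h1 : ‖t‖ ≤ 1 + ‖t‖ := by linarith
      calc ‖t‖ * ‖expFun s t‖ * ‖q t‖ ≤ (1 + ‖t‖) * ‖expFun s t‖ * (C * (1 + ‖t‖) ^ m) := by
            gcongr
            exact hbd t
        _ = _ := by ring)
    (hint (m + 1))
    (.of_forall fun t s _ => by
      have h1 : HasDerivAt (fun s : ℂ => Complex.exp (-(s * t)))
          (Complex.exp (-(s * t)) * (-(1 * t))) s :=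
        (((hasDerivAt_id s).mul_const (t : ℂ)).neg).cexp
      have h2 := (h1.const_mul ((Real.smoothTransition (t + 2) : ℝ) : ℂ)).mul_const (q t)
      refine h2.congr_deriv ?_
      simp only [expFun]
      ring)
  exact key.2.differentiableAt.differentiableWithinAt

/-- Mollification by an even bump `ρ` gives `Y(s) ∫ exp(-st) ρ(t) dt = ∫ exp(-st) ⟨y, ρ(· - t)⟩ dt`.
Both integrals are holomorphic, and the one on the left is nonzero near `s₀` when `ρ` has small
support. -/
theorem IsInverseLaplace.differentiableOn {y : 𝓢'(ℝ, ℂ)} {Y : ℂ → ℂ} (h : IsInverseLaplace y Y) :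
    DifferentiableOn ℂ Y {s | 0 < s.re} := by
  intro s₀ hs₀
  -- The bound `1 / 4` keeps the shifted times above `-1`, where the cutoff is `1`. The other bound
  -- gives `|s₀ t| ≤ 1 < π / 2` on the support of `ρ`, so `exp(-s₀ t)` has positive real part there.
  set δ : ℝ := min (1 / 4) (1 / (1 + ‖s₀‖)) with hδ
  have hδ0 : 0 < δ := by positivity
  have hδ4 : δ ≤ 1 / 4 := min_le_left _ _
  have hδs : ‖s₀‖ * δ ≤ 1 := by
    calc ‖s₀‖ * δ ≤ ‖s₀‖ * (1 / (1 + ‖s₀‖)) := by gcongr; exact min_le_right _ _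
      _ ≤ 1 := by
        rw [mul_one_div, div_le_one (by positivity)]
        linarith
  let B : ContDiffBump (0 : ℝ) := ⟨δ / 2, δ, by positivity, by linarith⟩
  have hsupp : ∀ t : ℝ, δ ≤ |t| → B t = 0 := fun t ht =>
    B.zero_of_le_dist (by simpa [Real.dist_eq] using ht)
  have hBc : HasCompactSupport fun t : ℝ => ((B t : ℝ) : ℂ) :=
    B.hasCompactSupport.comp_left (g := fun r : ℝ => (r : ℂ)) Complex.ofReal_zero
  let ρ : 𝓢(ℝ, ℂ) := HasCompactSupport.toSchwartzMap hBc
    (Complex.ofRealCLM.contDiff.comp B.contDiff)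
  have hρ : ∀ t, ρ t = ((B t : ℝ) : ℂ) := fun t => rfl
  let u : 𝓢(ℝ, ℂ) →L[ℂ] ℂ := y
  have hk : Continuous fun t => u (SchwartzMap.compSubConstCLM ℂ t ρ) :=
    u.continuous.comp (continuous_compSubConstCLM ρ)
  obtain ⟨S, C, hC, hu⟩ := exists_seminorm_bound u
  choose D hD0 hD using fun i : ℕ × ℕ => seminorm_compSubConstCLM_le ρ i.1 i.2
  have hkbd : ∀ t : ℝ, ‖u (SchwartzMap.compSubConstCLM ℂ t ρ)‖ ≤
      (C * ∑ i ∈ S, D i) * (1 + ‖t‖) ^ (S.sup Prod.fst) := by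
    intro t
    refine (hu _).trans ?_
    rw [mul_assoc]
    refine mul_le_mul_of_nonneg_left ?_ hC
    refine Seminorm.finset_sup_apply_le (mul_nonneg (Finset.sum_nonneg fun i _ => hD0 i)
      (by positivity)) fun i hi => (hD i t).trans ?_
    refine mul_le_mul (Finset.single_le_sum (f := D) (fun j _ => hD0 j) hi) ?_ (by positivity)
      (Finset.sum_nonneg fun i _ => hD0 i)
    exact pow_le_pow_right₀ (by linarith [norm_nonneg t]) (Finset.le_sup (f := Prod.fst) hi)
  have hnum := differentiableOn_integral_expFun hk hkbd s₀ hs₀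
  have hden := differentiableOn_integral_expFun (q := ρ) ρ.continuous (C := 1) (m := 0)
    (fun t => by
      rw [hρ, Complex.norm_real, Real.norm_of_nonneg B.nonneg]
      simpa using B.le_one) s₀ hs₀
  have hne : (∫ t : ℝ, expFun s₀ t * ρ t) ≠ 0 := by
    have hci : Continuous fun t => expFun s₀ t * ρ t :=
      (expFun_contDiff s₀).continuous.mul ρ.continuous
    have hcs : HasCompactSupport fun t => expFun s₀ t * ρ t := hBc.mul_left
    intro h0
    have h1 := congrArg Complex.re h0
    rw [← RCLike.re_eq_complex_re, ← integral_re (hci.integrable_of_hasCompactSupport hcs)] at h1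
    have hpos : 0 < ∫ t : ℝ, (expFun s₀ t * ρ t).re := by
      refine Continuous.integral_pos_of_hasCompactSupport_nonneg_nonzero (x := 0)
        (Complex.continuous_re.comp hci)
        (hcs.comp_left (g := Complex.re) Complex.zero_re) (fun t => ?_) ?_
      · change 0 ≤ (expFun s₀ t * ρ t).re
        rcases le_or_gt δ |t| with ht | ht
        · rw [hρ, hsupp t ht]
          simp
        · rw [hρ, Complex.re_mul_ofReal]
          refine mul_nonneg ?_ B.nonneg
          have ht' := abs_lt.1 ht
          rw [expFun_of_ge _ (by linarith), Complex.exp_re]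
          refine mul_nonneg (Real.exp_pos _).le (Real.cos_nonneg_of_mem_Icc ?_)
          have h2 : |(-(s₀ * t)).im| ≤ 1 := by
            refine (Complex.abs_im_le_norm _).trans ?_
            rw [norm_neg, norm_mul, Complex.norm_real, Real.norm_eq_abs]
            exact (mul_le_mul_of_nonneg_left ht.le (norm_nonneg _)).trans hδs
          have h3 := abs_le.1 h2
          have h4 := Real.pi_gt_three
          constructor <;> linarith
      · rw [hρ, B.one_of_mem_closedBall (by simpa using B.rIn_pos.le),
          expFun_of_ge _ (by norm_num)]
        simp
    simp only [RCLike.re_eq_complex_re, Complex.zero_re] at h1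
    exact hpos.ne' h1
  have hev : ∀ᶠ s in nhdsWithin s₀ {s : ℂ | 0 < s.re}, (∫ t : ℝ, expFun s t * ρ t) ≠ 0 :=
    hden.continuousWithinAt.eventually_ne hne
  have hmul : ∀ s : ℂ, 0 < s.re → Y s * (∫ t : ℝ, expFun s t * ρ t) =
      ∫ t, expFun s t * u (SchwartzMap.compSubConstCLM ℂ t ρ) := by
    intro s hs
    have h1 := map_convolution u (expTest s hs) ρ
    refine Eq.trans ?_ h1
    rw [← h.2 s hs, mul_comm, ← smul_eq_mul]
    change _ • u (expTest s hs) = _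
    rw [← map_smul]
    -- For `t > -1/2`, the substitution `r ↦ r + t` and evenness of `ρ` show that the convolution
    -- with `ρ` multiplies `exp(-st)` by the Laplace integral of `ρ`.
    refine map_eq_of_eqOn_Ioi h.1 (b := -(1 / 2)) (by norm_num) fun t ht => ?_
    rw [SchwartzMap.convolution_apply]
    change (∫ t : ℝ, expFun s t * ρ t) * expFun s t = ∫ r : ℝ, expFun s r * ρ (t - r)
    rw [← integral_mul_const,
      ← integral_add_right_eq_self (fun r => expFun s r * ρ (t - r)) t]
    refine integral_congr_ae (.of_forall fun r => ?_)
    have hneg : ρ (t - (r + t)) = ρ r := by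
      rw [sub_add_cancel_right, hρ, hρ, B.neg]
    simp only [hneg]
    rcases le_or_gt δ |r| with hr | hr
    · rw [hρ, hsupp r hr]
      simp
    · have hr' := abs_lt.1 hr
      rw [expFun_of_ge _ (by linarith), expFun_of_ge _ (by linarith), expFun_of_ge _ (by linarith),
        mul_right_comm, ← Complex.exp_add]
      congr 2
      push_cast
      ring
  have hYeq : Y =ᶠ[nhdsWithin s₀ {s : ℂ | 0 < s.re}] fun s =>
      (∫ t, expFun s t * u (SchwartzMap.compSubConstCLM ℂ t ρ)) /
        (∫ t : ℝ, expFun s t * ρ t) := by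
    filter_upwards [hev, self_mem_nhdsWithin] with s hs1 hs2
    rw [eq_div_iff hs1, hmul s hs2]
  exact (hnum.div hden hne).congr_of_eventuallyEq hYeq (hYeq.self_of_nhdsWithin hs₀)

end Holomorphy

open Filter Topology

/-! ### Laplace inversion along vertical lines -/

section Bromwich

open scoped FourierTransform

theorem integrable_of_norm_le_inv_one_add_sq {f : ℝ → ℂ} (hf : Continuous f) {K : ℝ}
    (hK : ∀ ν, ‖f ν‖ ≤ K * (1 + ν ^ 2)⁻¹) : Integrable f :=
  (integrable_inv_one_add_sq.const_mul K).mono' hf.aestronglyMeasurable (.of_forall hK)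

theorem continuous_vertical {F : ℂ → ℂ} (hF : DifferentiableOn ℂ F {z | 0 < z.re}) {c : ℝ}
    (hc : 0 < c) : Continuous fun ν : ℝ => F (c + ν * Complex.I) :=
  hF.continuousOn.comp_continuous (by fun_prop) fun ν => by simpa using hc

/-- Cauchy's theorem on rectangles of height `2T`. The quadratic decay makes the horizontal sides
disappear as `T → ∞`. -/
theorem integral_vertical_eq {F : ℂ → ℂ} (hF : DifferentiableOn ℂ F {z | 0 < z.re}) {a b K : ℝ}
    (ha : 0 < a) (hab : a ≤ b)
    (hK : ∀ c ∈ Set.Icc a b, ∀ ν : ℝ, ‖F (c + ν * Complex.I)‖ ≤ K * (1 + ν ^ 2)⁻¹) :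
    ∫ ν : ℝ, F (a + ν * Complex.I) = ∫ ν : ℝ, F (b + ν * Complex.I) := by
  have hb : 0 < b := ha.trans_le hab
  have hia := integrable_of_norm_le_inv_one_add_sq (continuous_vertical hF ha)
    (hK a ⟨le_rfl, hab⟩)
  have hib := integrable_of_norm_le_inv_one_add_sq (continuous_vertical hF hb)
    (hK b ⟨hab, le_rfl⟩)
  have ta := intervalIntegral_tendsto_integral hia tendsto_neg_atTop_atBot tendsto_id
  have tb := intervalIntegral_tendsto_integral hib tendsto_neg_atTop_atBot tendsto_id
  have hT : Tendsto (fun T : ℝ => K * (1 + T ^ 2)⁻¹ * |b - a|) atTop (𝓝 0) := by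
    have h1 : Tendsto (fun T : ℝ => 1 + T ^ 2) atTop atTop :=
      tendsto_atTop_add_const_left _ _ (tendsto_pow_atTop two_ne_zero)
    simpa using (h1.inv_tendsto_atTop.const_mul K).mul_const |b - a|
  have hside : ∀ T : ℝ, ‖∫ x in a..b, F (x + T * Complex.I)‖ ≤ K * (1 + T ^ 2)⁻¹ * |b - a| := by
    intro T
    refine intervalIntegral.norm_integral_le_of_norm_le_const fun x hx => ?_
    rw [Set.uIoc_of_le hab] at hx
    exact hK x ⟨hx.1.le, hx.2⟩ T
  have t1 : Tendsto (fun T : ℝ => ∫ x in a..b, F (x + T * Complex.I)) atTop (𝓝 0) :=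
    squeeze_zero_norm hside hT
  have t2 : Tendsto (fun T : ℝ => ∫ x in a..b, F (x + (-T : ℝ) * Complex.I)) atTop (𝓝 0) :=
    squeeze_zero_norm (fun T => by simpa using hside (-T)) hT
  have hrect : ∀ T : ℝ, (∫ x in a..b, F (x + (-T : ℝ) * Complex.I)) -
      (∫ x in a..b, F (x + T * Complex.I)) +
      Complex.I • (∫ y in -T..T, F (b + y * Complex.I)) -
      Complex.I • (∫ y in -T..T, F (a + y * Complex.I)) = 0 := by
    intro T
    have := Complex.integral_boundary_rect_eq_zero_of_differentiableOn F (⟨a, -T⟩ : ℂ) ⟨b, T⟩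
      (hF.mono fun z hz => by
        have h1 := (Set.mem_preimage.1 hz.1)
        rw [Set.uIcc_of_le hab] at h1
        exact ha.trans_le h1.1)
    simpa using this
  have hlim := ((t2.sub t1).add (tb.const_smul Complex.I)).sub (ta.const_smul Complex.I)
  have h0 := tendsto_nhds_unique (hlim.congr fun T => hrect T) tendsto_const_nhds
  have h1 : Complex.I * ((∫ ν : ℝ, F (b + ν * Complex.I)) - ∫ ν : ℝ, F (a + ν * Complex.I)) = 0 := by
    simpa [mul_sub] using h0
  rcases mul_eq_zero.1 h1 with h | h
  · exact absurd h Complex.I_ne_zero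
  · exact (sub_eq_zero.1 h).symm

/-- The inverse Laplace transform of `h`, by integration along the line `Re s = 2 π c`. -/
noncomputable def bromwich (h : ℂ → ℂ) (c t : ℝ) : ℂ :=
  ∫ ν : ℝ, Complex.exp (2 * Real.pi * (c + ν * Complex.I) * t) *
    h (2 * Real.pi * (c + ν * Complex.I))

variable {h : ℂ → ℂ} {C : ℝ} {M : ℕ}

theorem norm_vertical_le (hb : ∀ s : ℂ, 0 < s.re → ‖h s‖ ≤ C * (1 + 1 / s.re) ^ M / ‖1 + s‖ ^ 2)
    (hC : 0 ≤ C) {c : ℝ} (hc : 0 < c) (ν : ℝ) :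
    ‖h (2 * Real.pi * (c + ν * Complex.I))‖ ≤ C * (1 + 1 / c) ^ M * (1 + ν ^ 2)⁻¹ := by
  have hpi := Real.pi_gt_three
  have hre : (2 * Real.pi * (c + ν * Complex.I) : ℂ).re = 2 * Real.pi * c := by simp
  have him : (2 * Real.pi * (c + ν * Complex.I) : ℂ).im = 2 * Real.pi * ν := by simp
  have hpos : 0 < 2 * Real.pi * c := by positivity
  refine (hb _ (by rw [hre]; exact hpos)).trans ?_
  rw [hre, ← div_eq_mul_inv, Complex.sq_norm, Complex.normSq_apply, Complex.add_re, Complex.add_im,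
    hre, him, Complex.one_re, Complex.one_im]
  have h1 : 1 / (2 * Real.pi * c) ≤ 1 / c := one_div_le_one_div_of_le hc (by nlinarith)
  have h2 : 1 + ν ^ 2 ≤ (1 + 2 * Real.pi * c) * (1 + 2 * Real.pi * c) +
      (0 + 2 * Real.pi * ν) * (0 + 2 * Real.pi * ν) := by
    nlinarith [mul_nonneg (sq_nonneg ν) (by nlinarith : (0 : ℝ) ≤ (2 * Real.pi) ^ 2 - 1)]
  gcongr

theorem norm_bromwich_integrand_le
    (hb : ∀ s : ℂ, 0 < s.re → ‖h s‖ ≤ C * (1 + 1 / s.re) ^ M / ‖1 + s‖ ^ 2)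
    (hC : 0 ≤ C) {c : ℝ} (hc : 0 < c) (t ν : ℝ) :
    ‖Complex.exp (2 * Real.pi * (c + ν * Complex.I) * t) * h (2 * Real.pi * (c + ν * Complex.I))‖ ≤
      Real.exp (2 * Real.pi * c * t) * (C * (1 + 1 / c) ^ M) * (1 + ν ^ 2)⁻¹ := by
  have hre : (2 * Real.pi * (c + ν * Complex.I) * t : ℂ).re = 2 * Real.pi * c * t := by simp
  rw [norm_mul, Complex.norm_exp, hre, mul_assoc (Real.exp _)]
  exact mul_le_mul_of_nonneg_left (norm_vertical_le hb hC hc ν) (Real.exp_pos _).le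

theorem norm_bromwich_le
    (hb : ∀ s : ℂ, 0 < s.re → ‖h s‖ ≤ C * (1 + 1 / s.re) ^ M / ‖1 + s‖ ^ 2)
    (hC : 0 ≤ C) {c : ℝ} (hc : 0 < c) (t : ℝ) :
    ‖bromwich h c t‖ ≤ Real.exp (2 * Real.pi * c * t) * (C * (1 + 1 / c) ^ M) * Real.pi := by
  refine le_of_le_of_eq ?_ (congrArg (_ * ·) integral_univ_inv_one_add_sq)
  rw [← integral_const_mul]
  exact norm_integral_le_of_norm_le (integrable_inv_one_add_sq.const_mul _)
    (.of_forall (norm_bromwich_integrand_le hb hC hc t))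

theorem differentiableOn_bromwich_integrand (hd : DifferentiableOn ℂ h {s | 0 < s.re}) (t : ℝ) :
    DifferentiableOn ℂ (fun z : ℂ => Complex.exp (2 * Real.pi * z * t) * h (2 * Real.pi * z))
      {z | 0 < z.re} := by
  refine DifferentiableOn.mul (by fun_prop) (hd.comp (by fun_prop) fun z hz => ?_)
  have : (2 * Real.pi * z : ℂ).re = 2 * Real.pi * z.re := by
    rw [← Complex.ofReal_ofNat, ← Complex.ofReal_mul, Complex.re_ofReal_mul]
  change 0 < (2 * Real.pi * z : ℂ).re
  rw [this]
  have : 0 < z.re := hz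
  positivity

theorem bromwich_eq_of_le (hd : DifferentiableOn ℂ h {s | 0 < s.re})
    (hb : ∀ s : ℂ, 0 < s.re → ‖h s‖ ≤ C * (1 + 1 / s.re) ^ M / ‖1 + s‖ ^ 2)
    (hC : 0 ≤ C) {c d : ℝ} (hc : 0 < c) (hcd : c ≤ d) (t : ℝ) :
    bromwich h c t = bromwich h d t := by
  refine integral_vertical_eq (differentiableOn_bromwich_integrand hd t) hc hcd
    (K := Real.exp (2 * Real.pi * d * |t|) * (C * (1 + 1 / c) ^ M)) fun b hcb ν => ?_
  have hb0 : 0 < b := hc.trans_le hcb.1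
  refine (norm_bromwich_integrand_le hb hC hb0 t ν).trans ?_
  have h1 : Real.exp (2 * Real.pi * b * t) ≤ Real.exp (2 * Real.pi * d * |t|) := by
    apply Real.exp_le_exp.2
    have := Real.pi_pos
    calc 2 * Real.pi * b * t ≤ 2 * Real.pi * b * |t| := by gcongr; exact le_abs_self t
      _ ≤ _ := by gcongr; exact hcb.2
  have h2 : 1 / b ≤ 1 / c := one_div_le_one_div_of_le hc hcb.1
  gcongr

theorem bromwich_eq (hd : DifferentiableOn ℂ h {s | 0 < s.re})
    (hb : ∀ s : ℂ, 0 < s.re → ‖h s‖ ≤ C * (1 + 1 / s.re) ^ M / ‖1 + s‖ ^ 2)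
    (hC : 0 ≤ C) {c d : ℝ} (hc : 0 < c) (hd0 : 0 < d) (t : ℝ) :
    bromwich h c t = bromwich h d t := by
  rcases le_total c d with hcd | hcd
  · exact bromwich_eq_of_le hd hb hC hc hcd t
  · exact (bromwich_eq_of_le hd hb hC hd0 hcd t).symm

/-- Moving the line to `c → +∞` does not change the integral, while `exp(2πct) → 0` for `t < 0`. -/
theorem bromwich_of_neg (hd : DifferentiableOn ℂ h {s | 0 < s.re})
    (hb : ∀ s : ℂ, 0 < s.re → ‖h s‖ ≤ C * (1 + 1 / s.re) ^ M / ‖1 + s‖ ^ 2)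
    (hC : 0 ≤ C) {c : ℝ} (hc : 0 < c) {t : ℝ} (ht : t < 0) : bromwich h c t = 0 := by
  have hle : ∀ d : ℝ, 1 ≤ d → ‖bromwich h c t‖ ≤
      Real.exp (2 * Real.pi * t * d) * (C * 2 ^ M * Real.pi) := by
    intro d hd1
    rw [bromwich_eq hd hb hC hc (by linarith : 0 < d)]
    refine (norm_bromwich_le hb hC (by linarith) t).trans ?_
    rw [mul_assoc, mul_right_comm _ d]
    have : 1 + 1 / d ≤ 2 := by
      have : 1 / d ≤ 1 := by rw [div_le_one (by linarith)]; exact hd1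
      linarith
    have h0 : 0 ≤ 1 + 1 / d := by positivity
    gcongr
  have hlim : Tendsto (fun d : ℝ => Real.exp (2 * Real.pi * t * d) * (C * 2 ^ M * Real.pi)) atTop
      (𝓝 0) := by
    have h1 : Tendsto (fun d : ℝ => 2 * Real.pi * t * d) atTop atBot :=
      tendsto_id.const_mul_atTop_of_neg (mul_neg_of_pos_of_neg (by positivity) ht)
    simpa using (Real.tendsto_exp_atBot.comp h1).mul_const (C * 2 ^ M * Real.pi)
  exact norm_le_zero_iff.1 (ge_of_tendsto hlim (by
    filter_upwards [eventually_ge_atTop 1] with d hd1 using hle d hd1))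

/-- Independence of the line allows the choice `c = 1 / (1 + t)` for `t ≥ 0`. The exponential then
stays below `exp(2π)`, and `(1 + 1/c)^M` becomes polynomial growth in `t`. -/
theorem norm_bromwich_one_le (hd : DifferentiableOn ℂ h {s | 0 < s.re})
    (hb : ∀ s : ℂ, 0 < s.re → ‖h s‖ ≤ C * (1 + 1 / s.re) ^ M / ‖1 + s‖ ^ 2)
    (hC : 0 ≤ C) (t : ℝ) :
    ‖bromwich h 1 t‖ ≤ C * (Real.exp (2 * Real.pi) * 2 ^ M * Real.pi) * (1 + ‖t‖) ^ M := by
  have hp := Real.pi_pos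
  rcases lt_or_ge t 0 with ht | ht
  · rw [bromwich_of_neg hd hb hC one_pos ht, norm_zero]
    positivity
  · have h1 : 0 < 1 / (1 + t) := by positivity
    rw [bromwich_eq hd hb hC one_pos h1]
    refine (norm_bromwich_le hb hC h1 t).trans ?_
    have h2 : Real.exp (2 * Real.pi * (1 / (1 + t)) * t) ≤ Real.exp (2 * Real.pi) := by
      apply Real.exp_le_exp.2
      rw [mul_assoc]
      refine mul_le_of_le_one_right (by positivity) ?_
      rw [one_div_mul_eq_div, div_le_one (by positivity)]
      linarith
    have h3 : 1 + 1 / (1 / (1 + t)) ≤ 2 * (1 + ‖t‖) := by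
      rw [one_div_one_div, Real.norm_of_nonneg ht]
      linarith
    have h4 : (1 + 1 / (1 / (1 + t))) ^ M ≤ (2 * (1 + ‖t‖)) ^ M := by gcongr
    calc _ ≤ Real.exp (2 * Real.pi) * (C * (2 * (1 + ‖t‖)) ^ M) * Real.pi := by gcongr
      _ = _ := by rw [mul_pow]; ring

theorem bromwich_eq_fourierInv (h : ℂ → ℂ) (c t : ℝ) :
    bromwich h c t = Complex.exp (2 * Real.pi * c * t) *
      𝓕⁻ (fun ν : ℝ => h (2 * Real.pi * (c + ν * Complex.I))) t := by
  rw [Real.fourierInv_eq', bromwich, ← integral_const_mul]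
  refine integral_congr_ae (.of_forall fun ν => ?_)
  simp only [smul_eq_mul]
  rw [← mul_assoc, ← Complex.exp_add]
  congr 2
  simp
  ring

theorem integrable_vertical (hd : DifferentiableOn ℂ h {s | 0 < s.re})
    (hb : ∀ s : ℂ, 0 < s.re → ‖h s‖ ≤ C * (1 + 1 / s.re) ^ M / ‖1 + s‖ ^ 2)
    (hC : 0 ≤ C) {c : ℝ} (hc : 0 < c) :
    Continuous (fun ν : ℝ => h (2 * Real.pi * (c + ν * Complex.I))) ∧
    Integrable (fun ν : ℝ => h (2 * Real.pi * (c + ν * Complex.I))) := by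
  have h1 : Continuous (fun ν : ℝ => h (2 * Real.pi * (c + ν * Complex.I))) := by
    have := continuous_vertical (differentiableOn_bromwich_integrand hd 0) hc
    simpa using this
  exact ⟨h1, integrable_of_norm_le_inv_one_add_sq h1 (norm_vertical_le hb hC hc)⟩

theorem continuous_bromwich (hd : DifferentiableOn ℂ h {s | 0 < s.re})
    (hb : ∀ s : ℂ, 0 < s.re → ‖h s‖ ≤ C * (1 + 1 / s.re) ^ M / ‖1 + s‖ ^ 2)
    (hC : 0 ≤ C) {c : ℝ} (hc : 0 < c) : Continuous (bromwich h c) := by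
  have h2 := VectorFourier.fourierIntegral_continuous Real.continuous_fourierChar
    (L := innerₗ ℝ) (by fun_prop : Continuous fun p : ℝ × ℝ => innerₗ ℝ p.1 p.2)
    (integrable_vertical hd hb hC hc).2
  have h3 : bromwich h c = fun t : ℝ => Complex.exp (2 * Real.pi * c * t) *
      𝓕 (fun ν : ℝ => h (2 * Real.pi * (c + ν * Complex.I))) (-t) := by
    funext t
    rw [bromwich_eq_fourierInv, Real.fourierInv_eq_fourier_neg]
  rw [h3]
  exact Continuous.mul (by fun_prop) (h2.comp continuous_neg)

theorem integrable_exp_mul_of_norm_le {g : ℝ → ℂ} (hg : AEStronglyMeasurable g)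
    (h0 : ∀ t < 0, g t = 0) {K : ℝ} (hK : ∀ t, ‖g t‖ ≤ K * (1 + ‖t‖) ^ M) {s : ℂ}
    (hs : 0 < s.re) : Integrable fun t : ℝ => Complex.exp (-(s * t)) * g t := by
  refine ((integrable_norm_mul_one_add_pow (expTest s hs) M).const_mul K).mono'
    (by fun_prop) (.of_forall fun t => ?_)
  rcases lt_or_ge t 0 with ht | ht
  · rw [h0 t ht, mul_zero, norm_zero]
    have := (norm_nonneg _).trans (hK 0)
    rw [norm_zero, add_zero, one_pow, mul_one] at this
    positivity
  · rw [norm_mul, expTest_apply, expFun_of_ge _ (by linarith)]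
    calc _ ≤ ‖Complex.exp (-(s * t))‖ * (K * (1 + ‖t‖) ^ M) := by gcongr; exact hK t
      _ = _ := by ring

/-- On the line through `s` the Bromwich integral is an inverse Fourier transform times `exp(2πct)`.
The polynomial bound makes that transform integrable, and Fourier inversion at frequency `Im s / 2π`
recovers `h s`. -/
theorem integral_exp_mul_bromwich (hd : DifferentiableOn ℂ h {s | 0 < s.re})
    (hb : ∀ s : ℂ, 0 < s.re → ‖h s‖ ≤ C * (1 + 1 / s.re) ^ M / ‖1 + s‖ ^ 2)
    (hC : 0 ≤ C) {s : ℂ} (hs : 0 < s.re) :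
    ∫ t : ℝ, Complex.exp (-(s * t)) * bromwich h 1 t = h s := by
  have hp := Real.pi_pos
  set c : ℝ := s.re / (2 * Real.pi) with hc
  have hc0 : 0 < c := by positivity
  obtain ⟨h1, h2⟩ := integrable_vertical hd hb hC hc0
  set H := fun ν : ℝ => h (2 * Real.pi * (c + ν * Complex.I)) with hH
  have h3 : ∀ t : ℝ, 𝓕⁻ H t = Complex.exp (-(2 * Real.pi * c * t)) * bromwich h 1 t := by
    intro t
    rw [bromwich_eq hd hb hC one_pos hc0, bromwich_eq_fourierInv, ← mul_assoc, ← Complex.exp_add]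
    simp [hH]
  have h4 : Integrable (𝓕⁻ H) := by
    have := integrable_exp_mul_of_norm_le (continuous_bromwich hd hb hC one_pos).aestronglyMeasurable
      (fun t ht => bromwich_of_neg hd hb hC one_pos ht) (norm_bromwich_one_le hd hb hC)
      (s := ((2 * Real.pi * c : ℝ) : ℂ)) (by rw [Complex.ofReal_re]; positivity)
    refine this.congr (.of_forall fun t => ?_)
    simp only [h3]
    push_cast
    rfl
  have h4' : Integrable (𝓕 H) := by
    refine h4.comp_neg.congr (.of_forall fun t => ?_)
    simp only [Real.fourierInv_eq_fourier_neg, neg_neg]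
  have h5 := congrFun (h1.fourier_fourierInv_eq h2 h4') (s.im / (2 * Real.pi))
  rw [Real.fourier_eq'] at h5
  have h6 : (2 * Real.pi * (c + (s.im / (2 * Real.pi) : ℝ) * Complex.I) : ℂ) = s := by
    have : (Real.pi : ℂ) ≠ 0 := by exact_mod_cast hp.ne'
    conv_rhs => rw [← Complex.re_add_im s]
    rw [hc]
    push_cast
    field_simp
  rw [hH] at h5
  simp only at h5
  rw [h6] at h5
  rw [← h5]
  refine integral_congr_ae (.of_forall fun t => ?_)
  simp only [smul_eq_mul]
  rw [← hH, h3, ← mul_assoc, ← Complex.exp_add]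
  congr 2
  conv_lhs => rw [← h6]
  simp
  ring

end Bromwich

/-! ### The Schwarz lemma in the right half-plane -/

section HalfPlane

theorem sq_norm_sub_eq (z w : ℂ) :
    ‖z - w‖ ^ 2 = ‖z + (starRingEnd ℂ) w‖ ^ 2 - 4 * z.re * w.re := by
  rw [Complex.sq_norm, Complex.sq_norm, Complex.normSq_apply, Complex.normSq_apply]
  simp
  ring

theorem norm_add_conj_pos {z w : ℂ} (hz : 0 < z.re) (hw : 0 < w.re) :
    0 < ‖z + (starRingEnd ℂ) w‖ := by
  rw [norm_pos_iff]
  intro h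
  have := congrArg Complex.re h
  simp at this
  linarith

theorem norm_sub_le_norm_add_conj {z w : ℂ} (hz : 0 < z.re) (hw : 0 < w.re) :
    ‖z - w‖ ≤ ‖z + (starRingEnd ℂ) w‖ := by
  refine (sq_le_sq₀ (norm_nonneg _) (norm_nonneg _)).1 ?_
  rw [sq_norm_sub_eq]
  nlinarith [mul_pos hz hw]

theorem re_cayley_pos {w : ℂ} (hw : ‖w‖ < 1) : 0 < ((1 + w) / (1 - w)).re := by
  have h1 : (1 - w) ≠ 0 := by
    intro h
    rw [← sub_eq_zero.1 h, norm_one] at hw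
    exact lt_irrefl _ hw
  have h2 : w.re * w.re + w.im * w.im < 1 := by
    rw [← Complex.normSq_apply, ← Complex.sq_norm]
    nlinarith [norm_nonneg w]
  rw [Complex.div_re, ← add_div]
  refine div_pos ?_ (Complex.normSq_pos.2 h1)
  simp
  nlinarith

/-- A holomorphic self-map of the right half-plane does not approach the boundary too fast. -/
theorem re_mul_le_of_mapsTo {p : ℂ → ℂ} (hd : DifferentiableOn ℂ p {s | 0 < s.re})
    (hp : ∀ s : ℂ, 0 < s.re → 0 < (p s).re) {s : ℂ} (hs : 0 < s.re) :
    s.re * (p 1).re ≤ (p s).re * ‖1 + s‖ ^ 2 := by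
  have hp1 : 0 < (p 1).re := hp 1 (by simp)
  have hone : ∀ w : ℂ, ‖w‖ < 1 → 1 - w ≠ 0 := by
    intro w hw h
    rw [← sub_eq_zero.1 h, norm_one] at hw
    exact lt_irrefl _ hw
  -- Cayley transforms on both sides turn `p` into a map of the unit disc with `f 0 = 0`. The
  -- Schwarz lemma is then applied at `w = (s - 1) / (1 + s)`.
  let f : ℂ → ℂ := fun w => (p ((1 + w) / (1 - w)) - p 1) /
    (p ((1 + w) / (1 - w)) + (starRingEnd ℂ) (p 1))
  have hmaps : Set.MapsTo f (Metric.ball 0 1) (Metric.closedBall 0 1) := by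
    intro w hw
    have hw1 : ‖w‖ < 1 := mem_ball_zero_iff.1 hw
    have h1 := hp _ (re_cayley_pos hw1)
    rw [mem_closedBall_zero_iff, norm_div, div_le_one (norm_add_conj_pos h1 hp1)]
    exact norm_sub_le_norm_add_conj h1 hp1
  have hfd : DifferentiableOn ℂ f (Metric.ball 0 1) := by
    have h1 : DifferentiableOn ℂ (fun w : ℂ => p ((1 + w) / (1 - w))) (Metric.ball 0 1) := by
      refine hd.comp (DifferentiableOn.div (by fun_prop) (by fun_prop) fun w hw =>
        hone w (mem_ball_zero_iff.1 hw)) fun w hw => re_cayley_pos (mem_ball_zero_iff.1 hw)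
    refine (h1.sub_const _).div (h1.add_const _) fun w hw => ?_
    exact norm_pos_iff.1 (norm_add_conj_pos (hp _ (re_cayley_pos (mem_ball_zero_iff.1 hw))) hp1)
  have hs1 : 1 + s ≠ 0 := by
    intro h
    have := congrArg Complex.re h
    simp at this
    linarith
  have hn1 : 0 < ‖1 + s‖ := norm_pos_iff.2 hs1
  have hsq : ‖s - 1‖ ^ 2 = ‖1 + s‖ ^ 2 - 4 * s.re := by
    rw [sq_norm_sub_eq]
    simp [add_comm]
  have hw : ‖(s - 1) / (1 + s)‖ < 1 := by
    rw [norm_div, div_lt_one hn1]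
    refine (sq_lt_sq₀ (norm_nonneg _) (norm_nonneg _)).1 ?_
    linarith
  have key := Complex.norm_le_norm_of_mapsTo_ball hfd hmaps (by simp [f]) hw
  have hc : (1 + (s - 1) / (1 + s)) / (1 - (s - 1) / (1 + s)) = s := by
    have h1 : (1 - (s - 1) / (1 + s)) ≠ 0 := hone _ hw
    rw [div_eq_iff h1]
    field_simp
    ring
  simp only [f, hc, norm_div] at key
  have hA := norm_add_conj_pos (hp s hs) hp1
  rw [div_le_div_iff₀ hA hn1] at key
  -- After squaring, `sq_norm_sub_eq` cancels the main terms and leaves `Re s ‖p s + conj (p 1)‖² ≤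
  -- Re (p s) Re (p 1) ‖1 + s‖²`.
  have h2 := pow_le_pow_left₀ (by positivity) key 2
  rw [mul_pow, mul_pow, hsq, sq_norm_sub_eq] at h2
  have h3 : (p 1).re ≤ ‖p s + (starRingEnd ℂ) (p 1)‖ := by
    refine le_trans ?_ (Complex.re_le_norm _)
    simp [(hp s hs).le]
  have h4 : (p 1).re ^ 2 ≤ ‖p s + (starRingEnd ℂ) (p 1)‖ ^ 2 := by gcongr
  have h5 : s.re * (p 1).re ^ 2 ≤ (p s).re * (p 1).re * ‖1 + s‖ ^ 2 := by
    nlinarith [mul_le_mul_of_nonneg_left h4 hs.le]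
  refine le_of_mul_le_mul_right ?_ hp1
  calc _ = s.re * (p 1).re ^ 2 := by ring
    _ ≤ _ := h5
    _ = _ := by ring

end HalfPlane

/-! ### Closure properties of polynomial growth -/

section PolyGrowth

/-- Polynomial growth with some exponents. -/
def HasPolyGrowth (F : ℂ → ℂ) : Prop := ∃ N M, PolyGrowth F N M

theorem one_le_norm_one_add {s : ℂ} (hs : 0 < s.re) : 1 ≤ ‖1 + s‖ := by
  linarith [re_lt_norm_one_add (s := s)]

theorem one_le_one_add_one_div {r : ℝ} (hr : 0 < r) : 1 ≤ 1 + 1 / r := by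
  have : 0 < 1 / r := by positivity
  linarith

theorem PolyGrowth.mono_exponents {F : ℂ → ℂ} {N M N' M' : ℕ} (h : PolyGrowth F N M) (hN : N ≤ N')
    (hM : M ≤ M') : PolyGrowth F N' M' := by
  obtain ⟨C, hC, h⟩ := h
  refine ⟨C, hC, fun s hs => (h s hs).trans ?_⟩
  have h1 := pow_le_pow_right₀ (one_le_norm_one_add hs) hN
  have h2 := pow_le_pow_right₀ (one_le_one_add_one_div hs) hM
  have h3 := one_le_one_add_one_div hs
  gcongr

theorem HasPolyGrowth.mono {F G : ℂ → ℂ} (hF : HasPolyGrowth F) (K : ℝ)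
    (h : ∀ s : ℂ, 0 < s.re → ‖G s‖ ≤ K * ‖F s‖) : HasPolyGrowth G := by
  obtain ⟨N, M, C, hC, hF⟩ := hF
  refine ⟨N, M, |K| * C, by positivity, fun s hs => (h s hs).trans ?_⟩
  rw [mul_assoc, mul_assoc, ← mul_assoc C]
  calc K * ‖F s‖ ≤ |K| * ‖F s‖ := by gcongr; exact le_abs_self K
    _ ≤ _ := by gcongr; exact hF s hs

theorem HasPolyGrowth.mul {F G : ℂ → ℂ} (hF : HasPolyGrowth F) (hG : HasPolyGrowth G) :
    HasPolyGrowth fun s => F s * G s := by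
  obtain ⟨N, M, C, hC, hF⟩ := hF
  obtain ⟨N', M', C', hC', hG⟩ := hG
  refine ⟨N + N', M + M', C * C', by positivity, fun s hs => ?_⟩
  rw [norm_mul]
  have := one_le_one_add_one_div hs
  calc _ ≤ (C * ‖1 + s‖ ^ N * (1 + 1 / s.re) ^ M) * (C' * ‖1 + s‖ ^ N' * (1 + 1 / s.re) ^ M') := by
        gcongr
        · exact hF s hs
        · exact hG s hs
    _ = _ := by ring

theorem HasPolyGrowth.add {F G : ℂ → ℂ} (hF : HasPolyGrowth F) (hG : HasPolyGrowth G) :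
    HasPolyGrowth fun s => F s + G s := by
  obtain ⟨N, M, hF⟩ := hF
  obtain ⟨N', M', hG⟩ := hG
  obtain ⟨C, hC, hF⟩ := hF.mono_exponents (le_max_left N N') (le_max_left M M')
  obtain ⟨C', hC', hG⟩ := hG.mono_exponents (le_max_right N N') (le_max_right M M')
  refine ⟨max N N', max M M', C + C', by positivity, fun s hs => (norm_add_le _ _).trans ?_⟩
  rw [add_mul, add_mul]
  exact add_le_add (hF s hs) (hG s hs)

theorem hasPolyGrowth_const (c : ℂ) : HasPolyGrowth fun _ => c :=
  ⟨0, 0, ‖c‖, norm_nonneg _, fun s hs => by simp⟩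

theorem HasPolyGrowth.pow {F : ℂ → ℂ} (hF : HasPolyGrowth F) (k : ℕ) :
    HasPolyGrowth fun s => F s ^ k := by
  induction k with
  | zero => simpa using hasPolyGrowth_const 1
  | succ k ih => simpa only [pow_succ] using ih.mul hF

theorem hasPolyGrowth_one_add : HasPolyGrowth fun s => 1 + s :=
  ⟨1, 0, 1, zero_le_one, fun s hs => by simp⟩

theorem hasPolyGrowth_one_div_re : HasPolyGrowth fun s => ((1 / s.re : ℝ) : ℂ) :=
  ⟨0, 1, 1, zero_le_one, fun s hs => by
    rw [Complex.norm_real, Real.norm_of_nonneg (by positivity)]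
    simp⟩

theorem hasPolyGrowth_id : HasPolyGrowth fun s => s :=
  hasPolyGrowth_one_add.mono 1 fun s hs => by
    simpa using norm_le_norm_one_add hs

theorem hasPolyGrowth_inv : HasPolyGrowth fun s => s⁻¹ :=
  hasPolyGrowth_one_div_re.mono 1 fun s hs => by
    rw [Complex.norm_real, Real.norm_of_nonneg (by positivity), norm_inv, one_mul, one_div]
    have := Complex.re_le_norm s
    gcongr

end PolyGrowth

/-! ### The root p = s√Q and bounds on the kernel -/

section Root

/-- The square root of `s ^ 2 * Q s` in the right half-plane. -/
noncomputable def rootFun (Q : ℂ → ℂ) (s : ℂ) : ℂ := (s ^ 2 * Q s) ^ (1 / 2 : ℂ)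

variable {Q : ℂ → ℂ}

theorem rootFun_sq (s : ℂ) : rootFun Q s ^ 2 = s ^ 2 * Q s := by
  have h := Complex.cpow_nat_inv_pow (s ^ 2 * Q s) two_ne_zero
  rw [Nat.cast_ofNat, ← one_div] at h
  exact h

/-- Off the negative axis the argument lies strictly between `-π` and `π`, and the principal root
halves it. -/
theorem rootFun_re_pos (hQ : ∀ s : ℂ, 0 < s.re → s ^ 2 * Q s ∈ Complex.slitPlane) {s : ℂ}
    (hs : 0 < s.re) : 0 < (rootFun Q s).re := by
  have h1 := hQ s hs
  have h0 := Complex.slitPlane_ne_zero h1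
  rw [rootFun, Complex.cpow_def_of_ne_zero h0, Complex.exp_re]
  refine mul_pos (Real.exp_pos _) (Real.cos_pos_of_mem_Ioo ?_)
  have h2 : (Complex.log (s ^ 2 * Q s) * (1 / 2)).im = (s ^ 2 * Q s).arg / 2 := by
    rw [← Complex.log_im, mul_one_div, Complex.div_ofNat_im]
  rw [h2]
  have h3 := Complex.neg_pi_lt_arg (s ^ 2 * Q s)
  have h4 := (Complex.arg_le_pi (s ^ 2 * Q s)).lt_of_ne (Complex.mem_slitPlane_iff_arg.1 h1).1
  constructor <;> linarith

theorem differentiableOn_rootFun (hQ : ∀ s : ℂ, 0 < s.re → s ^ 2 * Q s ∈ Complex.slitPlane)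
    (hd : DifferentiableOn ℂ Q {s | 0 < s.re}) : DifferentiableOn ℂ (rootFun Q) {s | 0 < s.re} := by
  refine DifferentiableOn.cpow (DifferentiableOn.mul (by fun_prop) hd) (by fun_prop) fun s hs =>
    hQ s hs

theorem HasPolyGrowth.rootFun (hQ : HasPolyGrowth Q) : HasPolyGrowth (rootFun Q) := by
  refine ((hasPolyGrowth_const 1).add (((hasPolyGrowth_id.pow 2).mul hQ).mono (1 : ℝ)
    (G := fun s => ((‖s ^ 2 * Q s‖ : ℝ) : ℂ)) fun s hs => by simp)).mono 1 fun s hs => ?_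
  have h1 : ‖ViscoWave.rootFun Q s‖ ^ 2 = ‖s ^ 2 * Q s‖ := by rw [← rootFun_sq, norm_pow]
  have h2 : ‖(1 + ((‖s ^ 2 * Q s‖ : ℝ) : ℂ))‖ = 1 + ‖s ^ 2 * Q s‖ := by
    rw [← Complex.ofReal_one, ← Complex.ofReal_add, Complex.norm_real,
      Real.norm_of_nonneg (by positivity)]
  rw [h2, ← h1]
  nlinarith [sq_nonneg (‖ViscoWave.rootFun Q s‖ - 1)]

theorem kernelLaplace_eq (x : ℝ) {s : ℂ} (hs : s ≠ 0) :
    kernelLaplace Q x s = rootFun Q s / (2 * s ^ 2) * Complex.exp (-(|x| * rootFun Q s)) := by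
  rw [kernelLaplace, sqrtBranch, ← rootFun, mul_assoc ((|x| : ℝ) : ℂ), mul_div_cancel₀ _ hs]
  congr 1
  field_simp

theorem norm_kernelLaplace_eq (x : ℝ) {s : ℂ} (hs : s ≠ 0) : ‖kernelLaplace Q x s‖ =
    ‖rootFun Q s / (2 * s ^ 2)‖ * Real.exp (-((rootFun Q s).re * |x|)) := by
  rw [kernelLaplace_eq x hs, norm_mul, Complex.norm_exp]
  congr 2
  simp [mul_comm]

/-- The exponential absorbs `|x|^k` at the price `k! / (Re p)^k`. The half-plane Schwarz bound shows
that `1 / Re p` itself has polynomial growth. -/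
theorem exists_norm_kernelLaplace_le
    (hQ : ∀ s : ℂ, 0 < s.re → s ^ 2 * Q s ∈ Complex.slitPlane)
    (hd : DifferentiableOn ℂ Q {s | 0 < s.re}) (hg : HasPolyGrowth Q) (k : ℕ) :
    ∃ C N M, 0 ≤ C ∧ ∀ (x : ℝ) (s : ℂ), 0 < s.re →
      (1 + ‖x‖) ^ k * ‖kernelLaplace Q x s‖ ≤ C * ‖1 + s‖ ^ N * (1 + 1 / s.re) ^ M := by
  have hre := fun s => rootFun_re_pos hQ (s := s)
  have h1 : HasPolyGrowth fun s => ((1 / (rootFun Q s).re : ℝ) : ℂ) := by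
    refine (hasPolyGrowth_one_div_re.mul (hasPolyGrowth_one_add.pow 2)).mono
      (1 / (rootFun Q 1).re) fun s hs => ?_
    have h2 := re_mul_le_of_mapsTo (differentiableOn_rootFun hQ hd) (fun s => hre s) hs
    have h3 := hre s hs
    have h4 := hre 1 (by simp)
    rw [norm_mul, Complex.norm_real, Complex.norm_real, Real.norm_of_nonneg (by positivity),
      Real.norm_of_nonneg (by positivity), norm_pow, ← mul_assoc, one_div_mul_one_div,
      one_div_mul_eq_div, div_le_div_iff₀ h3 (by positivity), one_mul]
    linarith
  obtain ⟨N, M, C, hC, hb⟩ := (hg.rootFun.mul (hasPolyGrowth_inv.pow 2)).mul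
    ((hasPolyGrowth_const 1).add (h1.pow k))
  refine ⟨C * (2 ^ k * k.factorial), N, M, by positivity, fun x s hs => ?_⟩
  have hs0 : s ≠ 0 := fun h => by simp [h] at hs
  have h3 := hre s hs
  set r := (rootFun Q s).re with hr
  rw [norm_kernelLaplace_eq x hs0, ← hr]
  have h5 : ‖rootFun Q s / (2 * s ^ 2)‖ ≤ ‖rootFun Q s * s⁻¹ ^ 2‖ := by
    rw [norm_div, norm_mul, norm_mul, div_eq_mul_inv, mul_inv, norm_pow, norm_pow, norm_inv, inv_pow]
    gcongr
    norm_num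
    have : 0 ≤ (‖s‖ ^ 2)⁻¹ := by positivity
    linarith
  have h6 : (1 + ‖x‖) ^ k * Real.exp (-(r * |x|)) ≤
      2 ^ k * k.factorial * ‖(1 : ℂ) + ((1 / r : ℝ) : ℂ) ^ k‖ := by
    have e1 : ‖(1 : ℂ) + ((1 / r : ℝ) : ℂ) ^ k‖ = 1 + (1 / r) ^ k := by
      rw [← Complex.ofReal_one, ← Complex.ofReal_pow, ← Complex.ofReal_add, Complex.norm_real,
        Real.norm_of_nonneg (by positivity)]
    rw [e1]
    have e2 : (1 + ‖x‖) ^ k ≤ 2 ^ k * (1 + |x| ^ k) := by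
      rw [Real.norm_eq_abs]
      rcases le_total |x| 1 with hx | hx
      · calc (1 + |x|) ^ k ≤ 2 ^ k := by gcongr; linarith
          _ ≤ _ := le_mul_of_one_le_right (by positivity)
            (by have : 0 ≤ |x| ^ k := by positivity
                linarith)
      · calc (1 + |x|) ^ k ≤ (2 * |x|) ^ k := by gcongr; linarith
          _ = 2 ^ k * |x| ^ k := by rw [mul_pow]
          _ ≤ _ := by gcongr; linarith
    have e3 := pow_mul_exp_neg_le k h3 (abs_nonneg x)
    have e4 : Real.exp (-(r * |x|)) ≤ 1 := Real.exp_le_one_iff.2 (by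
      have := mul_nonneg h3.le (abs_nonneg x)
      linarith)
    have e5 : (1 : ℝ) ≤ k.factorial := by exact_mod_cast k.factorial_pos
    calc _ ≤ 2 ^ k * (1 + |x| ^ k) * Real.exp (-(r * |x|)) := by gcongr
      _ = 2 ^ k * (Real.exp (-(r * |x|)) + |x| ^ k * Real.exp (-(r * |x|))) := by ring
      _ ≤ 2 ^ k * (k.factorial + k.factorial / r ^ k) := by gcongr; linarith
      _ = _ := by rw [one_div, inv_pow]; ring
  calc _ = ‖rootFun Q s / (2 * s ^ 2)‖ * ((1 + ‖x‖) ^ k * Real.exp (-(r * |x|))) := by ring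
    _ ≤ ‖rootFun Q s * s⁻¹ ^ 2‖ * (2 ^ k * k.factorial * ‖(1 : ℂ) + ((1 / r : ℝ) : ℂ) ^ k‖) := by
      gcongr
    _ = 2 ^ k * k.factorial * ‖rootFun Q s * s⁻¹ ^ 2 * (1 + ((1 / r : ℝ) : ℂ) ^ k)‖ := by
      rw [norm_mul (_ * _)]; ring
    _ ≤ 2 ^ k * k.factorial * (C * ‖1 + s‖ ^ N * (1 + 1 / s.re) ^ M) := by
      gcongr
      exact hb s hs
    _ = _ := by ring

theorem differentiableOn_kernelLaplace
    (hQ : ∀ s : ℂ, 0 < s.re → s ^ 2 * Q s ∈ Complex.slitPlane)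
    (hd : DifferentiableOn ℂ Q {s | 0 < s.re}) (x : ℝ) :
    DifferentiableOn ℂ (kernelLaplace Q x) {s | 0 < s.re} := by
  have h1 := differentiableOn_rootFun hQ hd
  have h0 : ∀ s ∈ {s : ℂ | 0 < s.re}, s ≠ 0 := fun s hs h => by simp [h] at hs
  refine DifferentiableOn.congr (f := fun s => rootFun Q s / (2 * s ^ 2) *
    Complex.exp (-(|x| * rootFun Q s))) ?_ fun s hs => kernelLaplace_eq x (h0 s hs)
  refine (h1.div (by fun_prop) fun s hs => ?_).mul ((h1.const_mul _).neg.cexp)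
  have := h0 s hs
  simpa using this

end Root

/-! ### Correlation of a distribution with a test function -/

section Correlation

variable {E : Type*} [NormedAddCommGroup E] [NormedSpace ℝ E]

theorem lineDerivOp_compSubConstCLM (v y : E) (φ : 𝓢(E, ℂ)) :
    ∂_{v} (SchwartzMap.compSubConstCLM ℂ y φ) = SchwartzMap.compSubConstCLM ℂ y (∂_{v} φ) := by
  ext x
  rw [SchwartzMap.lineDerivOp_apply_eq_fderiv, SchwartzMap.compSubConstCLM_apply,
    SchwartzMap.lineDerivOp_apply_eq_fderiv]
  change fderiv ℝ (fun x => φ (x - y)) x v = _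
  rw [fderiv_comp_sub]

/-- The function `y ↦ ⟨K(z), φ(z + y)⟩`. -/
noncomputable def correlation (K : 𝓢(E, ℂ) →L[ℂ] ℂ) (φ : 𝓢(E, ℂ)) (y : E) : ℂ :=
  K (SchwartzMap.compSubConstCLM ℂ (-y) φ)

theorem correlation_add (K : 𝓢(E, ℂ) →L[ℂ] ℂ) (φ ψ : 𝓢(E, ℂ)) (y : E) :
    correlation K (φ + ψ) y = correlation K φ y + correlation K ψ y := by
  simp [correlation]

theorem correlation_smul (K : 𝓢(E, ℂ) →L[ℂ] ℂ) (c : ℂ) (φ : 𝓢(E, ℂ)) (y : E) :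
    correlation K (c • φ) y = c * correlation K φ y := by
  simp [correlation]

theorem continuous_correlation (K : 𝓢(E, ℂ) →L[ℂ] ℂ) (φ : 𝓢(E, ℂ)) :
    Continuous (correlation K φ) :=
  K.continuous.comp ((continuous_compSubConstCLM φ).comp continuous_neg)

/-- The fundamental theorem of calculus along the segment from `y` to `y + v`, carried through `K`
by `map_eq_integral`. -/
theorem correlation_sub_eq_integral (K : 𝓢(E, ℂ) →L[ℂ] ℂ) (φ : 𝓢(E, ℂ)) (y v : E) :
    correlation K φ (y + v) - correlation K φ y =
      ∫ r in Set.Icc (0 : ℝ) 1, correlation K (∂_{v} φ) (y + r • v) := by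
  rw [correlation, correlation, ← map_sub]
  have hc : Continuous fun r : ℝ => SchwartzMap.compSubConstCLM ℂ (-(y + r • v)) (∂_{v} φ) :=
    (continuous_compSubConstCLM (∂_{v} φ)).comp (by fun_prop)
  refine map_eq_integral (μ := volume.restrict (Set.Icc (0 : ℝ) 1)) K hc (fun k n => ?_) fun x => ?_
  · exact (((schwartz_withSeminorms ℂ E ℂ).continuous_seminorm (k, n)).comp hc).continuousOn.integrableOn_compact
      isCompact_Icc
  · have hder : ∀ r : ℝ, HasDerivAt (fun r : ℝ => φ (x + y + r • v)) (∂_{v} φ (x + y + r • v)) r := by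
      intro r
      have h1 : HasFDerivAt φ (fderiv ℝ φ (x + y + r • v)) (x + y + r • v) :=
        φ.differentiableAt.hasFDerivAt
      have h2 : HasDerivAt (fun r : ℝ => x + y + r • v) v r := by
        simpa using ((hasDerivAt_id r).smul_const v).const_add (x + y)
      exact h1.comp_hasDerivAt r h2
    have h3 := intervalIntegral.integral_eq_sub_of_hasDerivAt (a := 0) (b := 1)
      (fun r _ => hder r) (Continuous.intervalIntegrable (by
        have := (∂_{v} φ).continuous
        fun_prop) _ _)
    rw [integral_Icc_eq_integral_Ioc, ← intervalIntegral.integral_of_le zero_le_one]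
    simp only [SchwartzMap.compSubConstCLM_apply, sub_apply, sub_neg_eq_add]
    rw [show x + (y + v) = x + y + (1 : ℝ) • v by rw [one_smul, add_assoc]]
    rw [zero_smul, add_zero] at h3
    rw [← h3]
    simp only [add_assoc]

end Correlation

/-! ### Smoothness and decay of correlations in the plane -/

section Plane

theorem lineDerivOp_eq_add (v : ℝ × ℝ) (φ : 𝓢(ℝ × ℝ, ℂ)) :
    ∂_{v} φ = (v.1 : ℂ) • ∂_{((1, 0) : ℝ × ℝ)} φ + (v.2 : ℂ) • ∂_{((0, 1) : ℝ × ℝ)} φ := by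
  ext x
  simp only [add_apply, smul_apply,
    SchwartzMap.lineDerivOp_apply_eq_fderiv]
  have : v = v.1 • ((1, 0) : ℝ × ℝ) + v.2 • ((0, 1) : ℝ × ℝ) := by ext <;> simp
  conv_lhs => rw [this, map_add, map_smul, map_smul]
  simp

/-- The increment is an average of correlations with `∂_v φ`, which is linear in `v`. Continuity of
the correlations with the two partial derivatives gives the little-o remainder. -/
theorem hasFDerivAt_correlation (K : 𝓢(ℝ × ℝ, ℂ) →L[ℂ] ℂ) (φ : 𝓢(ℝ × ℝ, ℂ)) (y : ℝ × ℝ) :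
    HasFDerivAt (correlation K φ)
      ((ContinuousLinearMap.fst ℝ ℝ ℝ).smulRight (correlation K (∂_{((1, 0) : ℝ × ℝ)} φ) y) +
       (ContinuousLinearMap.snd ℝ ℝ ℝ).smulRight (correlation K (∂_{((0, 1) : ℝ × ℝ)} φ) y)) y := by
  rw [hasFDerivAt_iff_isLittleO_nhds_zero, Asymptotics.isLittleO_iff]
  intro c hc
  have hnhds : ∀ ψ : 𝓢(ℝ × ℝ, ℂ), ∃ δ > 0, ∀ w : ℝ × ℝ, ‖w‖ < δ →
      ‖correlation K ψ (y + w) - correlation K ψ y‖ ≤ c / 2 := by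
    intro ψ
    obtain ⟨δ, hδ, h⟩ := Metric.continuousAt_iff.1
      ((continuous_correlation K ψ).continuousAt (x := y)) (c / 2) (by positivity)
    refine ⟨δ, hδ, fun w hw => ?_⟩
    have := @h (y + w) (by simpa [dist_eq_norm] using hw)
    rw [dist_eq_norm] at this
    exact this.le
  obtain ⟨δ₁, hδ₁, h₁⟩ := hnhds (∂_{((1, 0) : ℝ × ℝ)} φ)
  obtain ⟨δ₂, hδ₂, h₂⟩ := hnhds (∂_{((0, 1) : ℝ × ℝ)} φ)
  filter_upwards [Metric.ball_mem_nhds (0 : ℝ × ℝ) (lt_min hδ₁ hδ₂)] with v hv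
  have hv' : ‖v‖ < min δ₁ δ₂ := by simpa using hv
  have hfin : volume.real (Set.Icc (0 : ℝ) 1) = 1 := by simp
  have hconst : ((ContinuousLinearMap.fst ℝ ℝ ℝ).smulRight
        (correlation K (∂_{((1, 0) : ℝ × ℝ)} φ) y) +
       (ContinuousLinearMap.snd ℝ ℝ ℝ).smulRight (correlation K (∂_{((0, 1) : ℝ × ℝ)} φ) y)) v =
      ∫ r in Set.Icc (0 : ℝ) 1, correlation K (∂_{v} φ) y := by
    rw [setIntegral_const, hfin, one_smul, lineDerivOp_eq_add v, correlation_add, correlation_smul,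
      correlation_smul]
    simp
  have hci : ∀ f : ℝ → ℂ, Continuous f → IntegrableOn f (Set.Icc (0 : ℝ) 1) volume := fun f hf =>
    hf.continuousOn.integrableOn_compact isCompact_Icc
  rw [correlation_sub_eq_integral, hconst, ← integral_sub]
  · have hle : ∀ r ∈ Set.Icc (0 : ℝ) 1, ‖correlation K (∂_{v} φ) (y + r • v) -
        correlation K (∂_{v} φ) y‖ ≤ c * ‖v‖ := by
      intro r hr
      have hrv : ‖r • v‖ < min δ₁ δ₂ := by
        refine lt_of_le_of_lt ?_ hv'
        rw [norm_smul, Real.norm_of_nonneg hr.1]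
        exact mul_le_of_le_one_left (norm_nonneg _) hr.2
      have e1 := h₁ (r • v) (hrv.trans_le (min_le_left _ _))
      have e2 := h₂ (r • v) (hrv.trans_le (min_le_right _ _))
      rw [lineDerivOp_eq_add v]
      simp only [correlation_add, correlation_smul]
      have e3 : ‖v.1‖ ≤ ‖v‖ := norm_fst_le v
      have e4 : ‖v.2‖ ≤ ‖v‖ := norm_snd_le v
      rw [show ∀ a b p q p' q' : ℂ, a * p + b * q - (a * p' + b * q') =
        a * (p - p') + b * (q - q') by intros; ring]
      refine (norm_add_le _ _).trans ?_
      rw [norm_mul, norm_mul, Complex.norm_real, Complex.norm_real]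
      calc _ ≤ ‖v‖ * (c / 2) + ‖v‖ * (c / 2) := by gcongr
        _ = _ := by ring
    have := norm_setIntegral_le_of_norm_le_const (μ := volume) (s := Set.Icc (0 : ℝ) 1)
      (by simp) hle
    rwa [hfin, mul_one] at this
  · exact hci _ ((continuous_correlation K _).comp (by fun_prop))
  · exact hci _ continuous_const

theorem fderiv_correlation (K : 𝓢(ℝ × ℝ, ℂ) →L[ℂ] ℂ) (φ : 𝓢(ℝ × ℝ, ℂ)) :
    fderiv ℝ (correlation K φ) = fun y =>
      (ContinuousLinearMap.smulRightL ℝ (ℝ × ℝ) ℂ (ContinuousLinearMap.fst ℝ ℝ ℝ))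
        (correlation K (∂_{((1, 0) : ℝ × ℝ)} φ) y) +
      (ContinuousLinearMap.smulRightL ℝ (ℝ × ℝ) ℂ (ContinuousLinearMap.snd ℝ ℝ ℝ))
        (correlation K (∂_{((0, 1) : ℝ × ℝ)} φ) y) :=
  funext fun y => (hasFDerivAt_correlation K φ y).fderiv

theorem contDiff_correlation (K : 𝓢(ℝ × ℝ, ℂ) →L[ℂ] ℂ) (φ : 𝓢(ℝ × ℝ, ℂ)) :
    ContDiff ℝ ∞ (correlation K φ) := by
  rw [contDiff_infty]
  intro n
  induction n generalizing φ with
  | zero => exact contDiff_zero.2 (continuous_correlation K φ)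
  | succ n ih =>
    rw [Nat.cast_add, Nat.cast_one, contDiff_succ_iff_fderiv]
    refine ⟨fun y => (hasFDerivAt_correlation K φ y).differentiableAt, by simp, ?_⟩
    rw [fderiv_correlation]
    exact ((ContinuousLinearMap.contDiff _).comp (ih _)).add
      ((ContinuousLinearMap.contDiff _).comp (ih _))

/-- The correlation of `K` with test functions decreases rapidly on the half-plane `-2 ≤ t`. -/
def HasDecay (K : 𝓢(ℝ × ℝ, ℂ) →L[ℂ] ℂ) : Prop :=
  ∀ k : ℕ, ∃ q : Seminorm ℂ 𝓢(ℝ × ℝ, ℂ), Continuous q ∧ ∀ (φ : 𝓢(ℝ × ℝ, ℂ)) (y : ℝ × ℝ),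
    -2 ≤ y.2 → (1 + ‖y‖) ^ k * ‖correlation K φ y‖ ≤ q φ

theorem norm_iteratedFDeriv_smulRightL_comp_le (L : ℝ × ℝ →L[ℝ] ℝ) (hL : ‖L‖ ≤ 1) {f : ℝ × ℝ → ℂ}
    (hf : ContDiff ℝ ∞ f) (n : ℕ) (y : ℝ × ℝ) :
    ‖iteratedFDeriv ℝ n (fun y => ContinuousLinearMap.smulRightL ℝ (ℝ × ℝ) ℂ L (f y)) y‖ ≤
      ‖iteratedFDeriv ℝ n f y‖ := by
  have h := (ContinuousLinearMap.smulRightL ℝ (ℝ × ℝ) ℂ L).norm_iteratedFDeriv_comp_left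
    (n := n) (N := ∞) (hf.contDiffAt (x := y)) (mod_cast le_top)
  refine h.trans (mul_le_of_le_one_left (norm_nonneg _) ?_)
  refine ContinuousLinearMap.opNorm_le_bound _ zero_le_one fun x => ?_
  change ‖L.smulRight x‖ ≤ _
  rw [ContinuousLinearMap.norm_smulRight_apply]
  gcongr

/-- Derivatives of a correlation are correlations with derivatives of `φ`, so decay passes to every
order. -/
theorem HasDecay.exists_seminorm {K : 𝓢(ℝ × ℝ, ℂ) →L[ℂ] ℂ} (hK : HasDecay K) (k n : ℕ) :
    ∃ q : Seminorm ℂ 𝓢(ℝ × ℝ, ℂ), Continuous q ∧ ∀ (φ : 𝓢(ℝ × ℝ, ℂ)) (y : ℝ × ℝ),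
      -2 ≤ y.2 → (1 + ‖y‖) ^ k * ‖iteratedFDeriv ℝ n (correlation K φ) y‖ ≤ q φ := by
  induction n with
  | zero =>
    obtain ⟨q, hq, h⟩ := hK k
    exact ⟨q, hq, fun φ y hy => by simpa only [norm_iteratedFDeriv_zero] using h φ y hy⟩
  | succ n ih =>
    obtain ⟨q, hq, h⟩ := ih
    let d (v : ℝ × ℝ) : 𝓢(ℝ × ℝ, ℂ) →L[ℂ] 𝓢(ℝ × ℝ, ℂ) :=
      LineDeriv.lineDerivOpCLM ℂ 𝓢(ℝ × ℝ, ℂ) v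
    refine ⟨q.comp (d (1, 0)).toLinearMap + q.comp (d (0, 1)).toLinearMap,
      (hq.comp (d (1, 0)).continuous).add (hq.comp (d (0, 1)).continuous), fun φ y hy => ?_⟩
    have h1 := h (∂_{((1, 0) : ℝ × ℝ)} φ) y hy
    have h2 := h (∂_{((0, 1) : ℝ × ℝ)} φ) y hy
    have hs := fun ψ => contDiff_correlation K ψ
    have hc : ∀ (L : ℝ × ℝ →L[ℝ] ℝ) (ψ : 𝓢(ℝ × ℝ, ℂ)), ContDiffAt ℝ n (fun y =>
        ContinuousLinearMap.smulRightL ℝ (ℝ × ℝ) ℂ L (correlation K ψ y)) y := fun L ψ =>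
      ((ContinuousLinearMap.contDiff _).comp ((hs ψ).of_le (mod_cast le_top))).contDiffAt
    rw [← norm_iteratedFDeriv_fderiv, fderiv_correlation,
      fun_iteratedFDeriv_add_apply (hc _ _) (hc _ _)]
    refine le_trans ?_ (add_le_add h1 h2)
    rw [← mul_add]
    gcongr
    exact (norm_add_le _ _).trans (add_le_add
      (norm_iteratedFDeriv_smulRightL_comp_le _ (ContinuousLinearMap.norm_fst_le ..) (hs _) n y)
      (norm_iteratedFDeriv_smulRightL_comp_le _ (ContinuousLinearMap.norm_snd_le ..) (hs _) n y))

/-- A smooth function of `t`, equal to `1` for `t ≥ -1` and to `0` for `t ≤ -2`. -/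
noncomputable def timeCutoff (y : ℝ × ℝ) : ℂ := ((Real.smoothTransition (y.2 + 2) : ℝ) : ℂ)

theorem contDiff_timeCutoff : ContDiff ℝ ∞ timeCutoff :=
  Complex.ofRealCLM.contDiff.comp (Real.smoothTransition.contDiff.comp
    (contDiff_snd.add contDiff_const))

theorem norm_iteratedFDeriv_timeCutoff_le (i : ℕ) :
    ∃ B : ℝ, 0 ≤ B ∧ ∀ y : ℝ × ℝ, ‖iteratedFDeriv ℝ i timeCutoff y‖ ≤ B := by
  obtain ⟨B, hB, h⟩ := norm_iteratedFDeriv_smoothTransition_le i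
  refine ⟨B, hB, fun y => ?_⟩
  have hs : ContDiff ℝ ∞ (fun t : ℝ => ((Real.smoothTransition (t + 2) : ℝ) : ℂ)) :=
    Complex.ofRealCLM.contDiff.comp
      (Real.smoothTransition.contDiff.comp (contDiff_id.add contDiff_const))
  have h1 := (ContinuousLinearMap.snd ℝ ℝ ℝ).iteratedFDeriv_comp_right hs y (i := i)
    (mod_cast le_top)
  change ‖iteratedFDeriv ℝ i ((fun t : ℝ => ((Real.smoothTransition (t + 2) : ℝ) : ℂ)) ∘
    ContinuousLinearMap.snd ℝ ℝ ℝ) y‖ ≤ B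
  rw [h1]
  refine (ContinuousMultilinearMap.norm_compContinuousLinearMap_le _ _).trans ?_
  refine (mul_le_of_le_one_right (norm_nonneg _) ?_).trans (h _)
  exact Finset.prod_le_one (fun _ _ => norm_nonneg _)
    (fun _ _ => ContinuousLinearMap.norm_snd_le ..)

/-- Packages a Leibniz sum with real weights as a single continuous seminorm. -/
theorem exists_seminorm_eq_sum {W : Type*} [AddCommGroup W] [Module ℂ W] [TopologicalSpace W]
    {c : ℕ → ℝ} (hc : ∀ i, 0 ≤ c i) {q : ℕ → Seminorm ℂ W} (hq : ∀ i, Continuous (q i)) (n : ℕ) :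
    ∃ Q : Seminorm ℂ W, Continuous Q ∧ ∀ w, Q w = ∑ i ∈ Finset.range n, c i * q i w := by
  induction n with
  | zero => exact ⟨0, continuous_const, fun w => by simp⟩
  | succ n ih =>
    obtain ⟨Q, hQ, h⟩ := ih
    have h1 : ∀ w, (Q + (c n).toNNReal • q n) w =
        ∑ i ∈ Finset.range (n + 1), c i * q i w := fun w => by
      rw [Finset.sum_range_succ, ← h, add_apply, smul_apply, NNReal.smul_def,
        Real.coe_toNNReal _ (hc n), smul_eq_mul]
    refine ⟨Q + (c n).toNNReal • q n, ?_, h1⟩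
    have h2 : ((Q + (c n).toNNReal • q n : Seminorm ℂ W) : W → ℝ) =
        fun w => Q w + c n * q n w := funext fun w => by rw [h1, h, Finset.sum_range_succ]
    rw [h2]
    exact hQ.add (continuous_const.mul (hq n))

/-- Convolution with a kernel whose correlations decay acts on test functions. -/
theorem HasDecay.exists_clm {K : 𝓢(ℝ × ℝ, ℂ) →L[ℂ] ℂ} (hK : HasDecay K) :
    ∃ T : 𝓢(ℝ × ℝ, ℂ) →L[ℂ] 𝓢(ℝ × ℝ, ℂ), ∀ φ y, T φ y = timeCutoff y * correlation K φ y := by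
  refine ⟨SchwartzMap.mkCLM (fun φ y => timeCutoff y * correlation K φ y)
    (fun φ ψ y => by rw [correlation_add, mul_add])
    (fun c φ y => by rw [correlation_smul, RingHom.id_apply, smul_eq_mul]; ring)
    (fun φ => contDiff_timeCutoff.mul (contDiff_correlation K φ)) ?_, fun φ y => rfl⟩
  rintro ⟨k, n⟩
  choose q hq h using fun n => hK.exists_seminorm k n
  choose B hB0 hB using norm_iteratedFDeriv_timeCutoff_le
  obtain ⟨Q, hQc, hQ⟩ := exists_seminorm_eq_sum (c := fun i => (n.choose i : ℝ) * B i)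
    (fun i => mul_nonneg (Nat.cast_nonneg _) (hB0 i)) (q := fun i => q (n - i)) (fun i => hq _)
    (n + 1)
  obtain ⟨s, C, -, hs⟩ := Seminorm.bound_of_continuous (schwartz_withSeminorms ℂ (ℝ × ℝ) ℂ) Q hQc
  refine ⟨s, C, C.2, fun φ y => le_trans ?_ (hs φ)⟩
  rcases lt_or_ge y.2 (-2) with hy | hy
  · have he : (fun y => timeCutoff y * correlation K φ y) =ᶠ[𝓝 y] fun _ => 0 := by
      filter_upwards [(isOpen_lt continuous_snd continuous_const).mem_nhds hy] with w hw
      have hw' : w.2 < -2 := hw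
      simp [timeCutoff, Real.smoothTransition.zero_of_nonpos (by linarith : w.2 + 2 ≤ 0)]
    rw [(he.iteratedFDeriv ℝ n).eq_of_nhds]
    simp only [iteratedFDeriv_fun_zero, Pi.zero_apply, norm_zero, mul_zero]
    exact apply_nonneg _ _
  · have hmul := norm_iteratedFDeriv_mul_le (𝕜 := ℝ) (n := n) (N := ∞) contDiff_timeCutoff
      (contDiff_correlation K φ) y (mod_cast le_top)
    rw [hQ]
    refine (mul_le_mul_of_nonneg_left hmul (by positivity)).trans ?_
    rw [Finset.mul_sum]
    refine Finset.sum_le_sum fun i _ => ?_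
    have h1 := h (n - i) φ y hy
    have h2 := hB i y
    have h3 := hB0 i
    have h4 : ‖y‖ ^ k ≤ (1 + ‖y‖) ^ k := by gcongr; linarith
    calc _ ≤ (1 + ‖y‖) ^ k * ((n.choose i : ℝ) * B i *
          ‖iteratedFDeriv ℝ (n - i) (correlation K φ) y‖) := by gcongr
      _ = (n.choose i : ℝ) * B i *
          ((1 + ‖y‖) ^ k * ‖iteratedFDeriv ℝ (n - i) (correlation K φ) y‖) := by ring
      _ ≤ _ := by gcongr

end Plane

/-! ### The operator 1 - ∂_t on exponentials -/

section ExpDeriv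

/-- The operator `1 - ∂/∂t` on test functions. -/
noncomputable def expDeriv : 𝓢(ℝ × ℝ, ℂ) →L[ℂ] 𝓢(ℝ × ℝ, ℂ) :=
  ContinuousLinearMap.id ℂ _ - LineDeriv.lineDerivOpCLM ℂ 𝓢(ℝ × ℝ, ℂ) ((0, 1) : ℝ × ℝ)

theorem expDeriv_apply (φ : 𝓢(ℝ × ℝ, ℂ)) : expDeriv φ = φ - ∂_{((0, 1) : ℝ × ℝ)} φ := rfl

theorem tsupport_expDeriv_pow_subset (m : ℕ) (φ : 𝓢(ℝ × ℝ, ℂ)) :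
    tsupport ((expDeriv ^ m) φ) ⊆ tsupport φ := by
  induction m with
  | zero => rfl
  | succ m ih =>
    refine Set.Subset.trans ?_ ih
    rw [pow_succ', mul_apply_eq_comp, expDeriv_apply]
    exact (tsupport_sub _ _).trans (Set.union_subset subset_rfl
      (SchwartzMap.tsupport_lineDerivOp_subset _ _))

theorem expDeriv_pow_compSubConstCLM (m : ℕ) (y : ℝ × ℝ) (φ : 𝓢(ℝ × ℝ, ℂ)) :
    (expDeriv ^ m) (SchwartzMap.compSubConstCLM ℂ y φ) =
      SchwartzMap.compSubConstCLM ℂ y ((expDeriv ^ m) φ) := by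
  induction m with
  | zero => rfl
  | succ m ih =>
    rw [pow_succ', mul_apply_eq_comp, mul_apply_eq_comp, ih, expDeriv_apply,
      expDeriv_apply, map_sub, lineDerivOp_compSubConstCLM]

theorem lineDerivOp_snd_apply_of_eqOn {φ : 𝓢(ℝ × ℝ, ℂ)} {c s : ℂ} {f : ℝ → ℂ}
    (h : ∀ z : ℝ × ℝ, -1 < z.2 → φ z = c * (f z.1 * Complex.exp (-(s * z.2)))) {z : ℝ × ℝ}
    (hz : -1 < z.2) :
    ∂_{((0, 1) : ℝ × ℝ)} φ z = -s * c * (f z.1 * Complex.exp (-(s * z.2))) := by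
  rw [SchwartzMap.lineDerivOp_apply, lineDeriv]
  have he : (fun t : ℝ => φ (z + t • ((0, 1) : ℝ × ℝ))) =ᶠ[𝓝 0]
      fun t : ℝ => c * (f z.1 * Complex.exp (-(s * (z.2 + t : ℝ)))) := by
    have hc : Continuous fun t : ℝ => z.2 + t := by fun_prop
    filter_upwards [hc.continuousAt.eventually (lt_mem_nhds (by simpa using hz))] with t ht
    rw [h _ (by simpa using ht)]
    simp
  rw [he.deriv_eq]
  have h1 : HasDerivAt (fun t : ℝ => ((z.2 + t : ℝ) : ℂ)) 1 0 :=
    ((hasDerivAt_id (0 : ℝ)).const_add z.2).ofReal_comp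
  have h2 := (((h1.const_mul s).neg.cexp).const_mul (f z.1)).const_mul c
  refine h2.deriv.trans ?_
  simp only [Pi.neg_apply, add_zero, mul_one]
  ring

/-- Each application multiplies `exp(-st)` by `1 + s`, which later cancels the denominators
introduced for the Bromwich integral. -/
theorem expDeriv_pow_apply_of_eqOn {s : ℂ} {f : ℝ → ℂ} (m : ℕ) {φ : 𝓢(ℝ × ℝ, ℂ)}
    (h : ∀ z : ℝ × ℝ, -1 < z.2 → φ z = f z.1 * Complex.exp (-(s * z.2))) {z : ℝ × ℝ}
    (hz : -1 < z.2) :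
    (expDeriv ^ m) φ z = (1 + s) ^ m * (f z.1 * Complex.exp (-(s * z.2))) := by
  induction m generalizing z with
  | zero => simpa using h z hz
  | succ m ih =>
    rw [pow_succ', mul_apply_eq_comp, expDeriv_apply, sub_apply, ih hz,
      lineDerivOp_snd_apply_of_eqOn (fun w hw => ih hw) hz]
    ring

theorem tensorTest_expTest_apply (f : 𝓢(ℝ, ℂ)) {s : ℂ} (hs : 0 < s.re) {z : ℝ × ℝ}
    (hz : -1 < z.2) : tensorTest f (expTest s hs) z = f z.1 * Complex.exp (-(s * z.2)) := by
  rw [tensorTest_apply, expTest_apply, expFun_of_ge _ hz.le]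

end ExpDeriv

/-! ### Distributions with a prescribed Laplace transform -/

section Kernel

theorem one_add_norm_pow_mul_norm_le (θ : 𝓢(ℝ × ℝ, ℂ)) (k : ℕ) (x : ℝ × ℝ) :
    (1 + ‖x‖) ^ k * ‖θ x‖ ≤
      2 ^ k * (SchwartzMap.seminorm ℂ 0 0 θ + SchwartzMap.seminorm ℂ k 0 θ) := by
  have h0 := SchwartzMap.le_seminorm ℂ 0 0 θ x
  have hk := SchwartzMap.le_seminorm ℂ k 0 θ x
  rw [norm_iteratedFDeriv_zero] at h0 hk
  rw [pow_zero, one_mul] at h0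
  have h1 : (1 + ‖x‖) ^ k ≤ 2 ^ k * (1 + ‖x‖ ^ k) := by
    have hx := norm_nonneg x
    rcases le_total ‖x‖ 1 with h | h
    · calc (1 + ‖x‖) ^ k ≤ 2 ^ k := by gcongr; linarith
        _ ≤ _ := le_mul_of_one_le_right (by positivity) (by
          have : 0 ≤ ‖x‖ ^ k := by positivity
          linarith)
    · calc (1 + ‖x‖) ^ k ≤ (2 * ‖x‖) ^ k := by gcongr; linarith
        _ = 2 ^ k * ‖x‖ ^ k := mul_pow _ _ _
        _ ≤ _ := by gcongr; linarith
  calc _ ≤ 2 ^ k * (1 + ‖x‖ ^ k) * ‖θ x‖ := by gcongr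
    _ = 2 ^ k * (‖θ x‖ + ‖x‖ ^ k * ‖θ x‖) := by ring
    _ ≤ _ := by gcongr

theorem integrable_inv_one_add_norm_sq : Integrable fun t : ℝ => ((1 + ‖t‖) ^ 2)⁻¹ := by
  refine integrable_inv_one_add_sq.mono' (Continuous.aestronglyMeasurable (by
    refine Continuous.inv₀ (by fun_prop) fun t => by positivity)) (.of_forall fun t => ?_)
  rw [Real.norm_of_nonneg (by positivity)]
  have : 1 + t ^ 2 ≤ (1 + ‖t‖) ^ 2 := by
    rw [Real.norm_eq_abs, ← sq_abs t]
    nlinarith [abs_nonneg t]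
  gcongr

/-- Weights are exchanged between the arguments of a correlation on a half-plane. -/
theorem one_add_norm_pow_mul_le {k M : ℕ} {y z : ℝ × ℝ} (hy : -2 ≤ y.2) (hz : 0 ≤ z.2) :
    (1 + ‖y‖) ^ k * (((1 + ‖z.1‖) ^ (k + 2))⁻¹ * (1 + ‖z.2‖) ^ M) ≤
      3 ^ (k + M + 2) * (1 + ‖z + y‖) ^ (2 * k + M + 2) *
        (((1 + ‖z.1‖) ^ 2)⁻¹ * ((1 + ‖z.2‖) ^ 2)⁻¹) := by
  have hn1 : ‖z.1 + y.1‖ ≤ ‖z + y‖ := norm_fst_le (z + y)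
  have hn2 : ‖z.2 + y.2‖ ≤ ‖z + y‖ := norm_snd_le (z + y)
  set w := ‖z + y‖
  have e1 : 1 + ‖y.1‖ ≤ (1 + ‖z.1‖) * (1 + w) := by
    have h1 := one_add_norm_add_le (-z.1) (z.1 + y.1)
    rw [neg_add_cancel_left, norm_neg] at h1
    exact h1.trans (by gcongr)
  -- In time there is no cancellation: `z.2 ≥ 0` and `y.2 ≥ -2`, so the sum controls both terms. In
  -- space the weight on `z.1` has to pay for it.
  have e2 : 1 + ‖y.2‖ ≤ 3 * (1 + w) := by
    have h1 : 1 + ‖y.2‖ ≤ 3 * (1 + ‖z.2 + y.2‖) := by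
      simp only [Real.norm_eq_abs]
      rcases abs_cases y.2 with h | h <;> rcases abs_cases (z.2 + y.2) with h' | h' <;> linarith
    linarith
  have e3 : 1 + ‖z.2‖ ≤ 3 * (1 + w) := by
    have h1 : 1 + ‖z.2‖ ≤ 3 * (1 + ‖z.2 + y.2‖) := by
      simp only [Real.norm_eq_abs]
      rcases abs_cases z.2 with h | h <;> rcases abs_cases (z.2 + y.2) with h' | h' <;> linarith
    linarith
  have e4 : 1 + ‖y‖ ≤ (1 + ‖y.1‖) * (1 + ‖y.2‖) := by
    have : ‖y‖ ≤ ‖y.1‖ + ‖y.2‖ := by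
      rw [Prod.norm_def]
      exact max_le_add_of_nonneg (norm_nonneg _) (norm_nonneg _)
    nlinarith [mul_nonneg (norm_nonneg y.1) (norm_nonneg y.2)]
  have hw : 0 ≤ w := norm_nonneg _
  set a := ‖z.1‖ with ha
  set b := ‖z.2‖ with hb
  have ha0 : 0 ≤ a := norm_nonneg _
  have hb0 : 0 ≤ b := norm_nonneg _
  have e5 : 1 + ‖y‖ ≤ (1 + a) * (1 + w) * (3 * (1 + w)) := e4.trans (by gcongr)
  calc (1 + ‖y‖) ^ k * (((1 + a) ^ (k + 2))⁻¹ * (1 + b) ^ M)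
      ≤ ((1 + a) * (1 + w) * (3 * (1 + w))) ^ k * (((1 + a) ^ (k + 2))⁻¹ * (1 + b) ^ M) := by gcongr
    _ = 3 ^ k * (1 + w) ^ (2 * k) * (((1 + a) ^ 2)⁻¹ * ((1 + b) ^ 2)⁻¹) * (1 + b) ^ (M + 2) := by
      have : 1 + a ≠ 0 := by positivity
      have : 1 + b ≠ 0 := by positivity
      rw [mul_pow, mul_pow, mul_pow]
      field_simp
      ring
    _ ≤ 3 ^ k * (1 + w) ^ (2 * k) * (((1 + a) ^ 2)⁻¹ * ((1 + b) ^ 2)⁻¹) *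
        (3 * (1 + w)) ^ (M + 2) := by gcongr
    _ = _ := by rw [mul_pow]; ring

variable {μ : Measure ℝ} [SFinite μ] {R : ℝ → ℂ → ℂ}

/-- Dividing `R` by `(1 + s)^(N + 2)` leaves decay `|1 + s|⁻²`. Its Bromwich integral is a function
`g(x, t)`, and `K` is `(1 + ∂_t)^(N + 2)` applied to `g` times `μ ⊗ dt`. Of the `k + 2` powers of
`x`, `k` serve the decay of correlations and `2` serve integrability. The measure `μ` is left
general to cover both Lebesgue measure and a point mass. -/
theorem exists_kernel_of_bound (hμ : Integrable (fun x : ℝ => ((1 + ‖x‖) ^ 2)⁻¹) μ)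
    (hcont : ContinuousOn (Function.uncurry R) (Set.univ ×ˢ {s | 0 < s.re}))
    (hd : ∀ x, DifferentiableOn ℂ (R x) {s | 0 < s.re}) {k N M : ℕ} {C : ℝ} (hC : 0 ≤ C)
    (hb : ∀ (x : ℝ) (s : ℂ), 0 < s.re →
      (1 + ‖x‖) ^ (k + 2) * ‖R x s‖ ≤ C * ‖1 + s‖ ^ N * (1 + 1 / s.re) ^ M) :
    ∃ K : 𝓢'(ℝ × ℝ, ℂ), Distribution.IsVanishingOn K {p : ℝ × ℝ | p.2 < 0} ∧
      (∀ (s : ℂ) (hs : 0 < s.re) (f : 𝓢(ℝ, ℂ)), Integrable (fun x : ℝ => f x * R x s) μ ∧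
        K (tensorTest f (expTest s hs)) = ∫ x : ℝ, f x * R x s ∂μ) ∧
      ∃ q : Seminorm ℂ 𝓢(ℝ × ℝ, ℂ), Continuous q ∧ ∀ (φ : 𝓢(ℝ × ℝ, ℂ)) (y : ℝ × ℝ),
        -2 ≤ y.2 → (1 + ‖y‖) ^ k * ‖correlation K φ y‖ ≤ q φ := by
  set m := N + 2
  have hne : ∀ s : ℂ, 0 < s.re → 1 + s ≠ 0 := fun s hs h => by
    have := one_le_norm_one_add hs
    rw [h, norm_zero] at this
    linarith
  let h : ℝ → ℂ → ℂ := fun x s => R x s / (1 + s) ^ m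
  let g : ℝ × ℝ → ℂ := fun z => bromwich (h z.1) 1 z.2
  have hhd : ∀ x, DifferentiableOn ℂ (h x) {s | 0 < s.re} := fun x =>
    (hd x).div (by fun_prop) fun s hs => pow_ne_zero _ (hne s hs)
  have hhb : ∀ (x : ℝ) (s : ℂ), 0 < s.re → ‖h x s‖ ≤
      (C * ((1 + ‖x‖) ^ (k + 2))⁻¹) * (1 + 1 / s.re) ^ M / ‖1 + s‖ ^ 2 := by
    intro x s hs
    have h1 : 0 < ‖1 + s‖ := norm_pos_iff.2 (hne s hs)
    have h2 := hb x s hs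
    have h3 : 0 < (1 + ‖x‖) ^ (k + 2) := by positivity
    rw [norm_div, norm_pow, div_le_div_iff₀ (by positivity) (by positivity)]
    calc ‖R x s‖ * ‖1 + s‖ ^ 2
        = ((1 + ‖x‖) ^ (k + 2))⁻¹ * ((1 + ‖x‖) ^ (k + 2) * ‖R x s‖) * ‖1 + s‖ ^ 2 := by
          field_simp
      _ ≤ ((1 + ‖x‖) ^ (k + 2))⁻¹ * (C * ‖1 + s‖ ^ N * (1 + 1 / s.re) ^ M) * ‖1 + s‖ ^ 2 := by
          gcongr
      _ = _ := by ring
  have hC' : ∀ x : ℝ, 0 ≤ C * ((1 + ‖x‖) ^ (k + 2))⁻¹ := fun x => by positivity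
  have hg0 : ∀ z : ℝ × ℝ, z.2 < 0 → g z = 0 := fun z hz =>
    bromwich_of_neg (hhd _) (hhb _) (hC' _) one_pos hz
  set B := C * (Real.exp (2 * Real.pi) * 2 ^ M * Real.pi) with hB
  have hB0 : 0 ≤ B := by positivity
  have hgb : ∀ z : ℝ × ℝ, ‖g z‖ ≤ B * (((1 + ‖z.1‖) ^ (k + 2))⁻¹ * (1 + ‖z.2‖) ^ M) := by
    intro z
    refine (norm_bromwich_one_le (hhd _) (hhb _) (hC' _) z.2).trans (le_of_eq ?_)
    rw [hB]
    ring
  have hgm : StronglyMeasurable g := by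
    refine StronglyMeasurable.integral_prod_right (f := fun (z : ℝ × ℝ) (ν : ℝ) =>
      Complex.exp (2 * Real.pi * ((1 : ℝ) + ν * Complex.I) * z.2) *
        h z.1 (2 * Real.pi * ((1 : ℝ) + ν * Complex.I))) (Continuous.stronglyMeasurable ?_)
    have hre : ∀ ν : ℝ, 0 < (2 * Real.pi * ((1 : ℝ) + ν * Complex.I) : ℂ).re := fun ν => by
      simp [Real.pi_pos]
    have h1 : Continuous fun p : (ℝ × ℝ) × ℝ =>
        Function.uncurry R (p.1.1, 2 * Real.pi * ((1 : ℝ) + p.2 * Complex.I)) :=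
      hcont.comp_continuous (by fun_prop) fun p => ⟨trivial, hre _⟩
    have h2 : Continuous fun p : (ℝ × ℝ) × ℝ =>
        (1 + 2 * Real.pi * ((1 : ℝ) + p.2 * Complex.I) : ℂ) ^ m := by fun_prop
    refine Continuous.mul (by fun_prop) (h1.div h2 fun p => pow_ne_zero _ (hne _ (hre _)))
  set L := 2 * k + M + 2
  set ρ := μ.prod (volume : Measure ℝ)
  let W : ℝ × ℝ → ℝ := fun z => ((1 + ‖z.1‖) ^ 2)⁻¹ * ((1 + ‖z.2‖) ^ 2)⁻¹
  have hW : Integrable W ρ := hμ.mul_prod integrable_inv_one_add_norm_sq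
  let P : Seminorm ℂ 𝓢(ℝ × ℝ, ℂ) := SchwartzMap.seminorm ℂ 0 0 + SchwartzMap.seminorm ℂ L 0
  have hPc : Continuous P := ((schwartz_withSeminorms ℂ (ℝ × ℝ) ℂ).continuous_seminorm (0, 0)).add
    ((schwartz_withSeminorms ℂ (ℝ × ℝ) ℂ).continuous_seminorm (L, 0))
  set B' := B * 3 ^ (k + M + 2) * 2 ^ L
  have hB'0 : 0 ≤ B' := by positivity
  -- At `y = 0` this gives integrability and continuity of the functional; for general `y` it gives
  -- the decay of correlations.
  have hcore : ∀ (θ : 𝓢(ℝ × ℝ, ℂ)) (y : ℝ × ℝ), -2 ≤ y.2 → ∀ z : ℝ × ℝ,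
      (1 + ‖y‖) ^ k * ‖g z * θ (z + y)‖ ≤ B' * P θ * W z := by
    intro θ y hy z
    have hW0 : 0 ≤ W z := by positivity
    rcases lt_or_ge z.2 0 with hz | hz
    · rw [hg0 z hz, zero_mul, norm_zero, mul_zero]
      have := apply_nonneg P θ
      positivity
    · have h1 := one_add_norm_pow_mul_norm_le θ L (z + y)
      have h2 := one_add_norm_pow_mul_le (k := k) (M := M) hy hz
      rw [norm_mul]
      calc _ ≤ (1 + ‖y‖) ^ k * (B * (((1 + ‖z.1‖) ^ (k + 2))⁻¹ * (1 + ‖z.2‖) ^ M) *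
            ‖θ (z + y)‖) := by gcongr; exact hgb z
        _ = B * ((1 + ‖y‖) ^ k * (((1 + ‖z.1‖) ^ (k + 2))⁻¹ * (1 + ‖z.2‖) ^ M)) *
            ‖θ (z + y)‖ := by ring
        _ ≤ B * (3 ^ (k + M + 2) * (1 + ‖z + y‖) ^ L * W z) * ‖θ (z + y)‖ := by gcongr
        _ = B * 3 ^ (k + M + 2) * W z * ((1 + ‖z + y‖) ^ L * ‖θ (z + y)‖) := by ring
        _ ≤ B * 3 ^ (k + M + 2) * W z * (2 ^ L * (SchwartzMap.seminorm ℂ 0 0 θ +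
            SchwartzMap.seminorm ℂ L 0 θ)) := by gcongr
        _ = B' * P θ * W z := by
          change _ = B' * (SchwartzMap.seminorm ℂ 0 0 θ + SchwartzMap.seminorm ℂ L 0 θ) * W z
          ring
  have hint : ∀ θ : 𝓢(ℝ × ℝ, ℂ), Integrable (fun z => g z * θ z) ρ := by
    intro θ
    refine (hW.const_mul (B' * P θ)).mono' (hgm.aestronglyMeasurable.mul
      θ.continuous.aestronglyMeasurable) (.of_forall fun z => ?_)
    simpa using hcore θ 0 (by simp) z
  let A : 𝓢(ℝ × ℝ, ℂ) →L[ℂ] ℂ := SchwartzMap.mkCLMtoNormedSpace (fun θ => ∫ z, g z * θ z ∂ρ)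
    (fun θ η => by
      simp only [add_apply, mul_add]
      exact integral_add (hint θ) (hint η))
    (fun c θ => by
      simp only [smul_apply, smul_eq_mul, RingHom.id_apply, mul_left_comm _ c]
      exact integral_const_mul c _)
    (by
      obtain ⟨s, c, -, hs⟩ := Seminorm.bound_of_continuous (schwartz_withSeminorms ℂ (ℝ × ℝ) ℂ) P hPc
      refine ⟨s, B' * (∫ z, W z ∂ρ) * c, ?_, fun θ => ?_⟩
      · have : 0 ≤ ∫ z, W z ∂ρ := integral_nonneg fun z => by positivity
        positivity
      · have h1 : ‖∫ z, g z * θ z ∂ρ‖ ≤ B' * P θ * ∫ z, W z ∂ρ := by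
          rw [← integral_const_mul]
          exact norm_integral_le_of_norm_le (hW.const_mul _) (.of_forall fun z => by
            simpa using hcore θ 0 (by simp) z)
        have h2 : P θ ≤ c * s.sup (schwartzSeminormFamily ℂ (ℝ × ℝ) ℂ) θ := hs θ
        have h3 : 0 ≤ ∫ z, W z ∂ρ := integral_nonneg fun z => by positivity
        calc _ ≤ B' * P θ * ∫ z, W z ∂ρ := h1
          _ ≤ B' * (c * s.sup (schwartzSeminormFamily ℂ (ℝ × ℝ) ℂ) θ) * ∫ z, W z ∂ρ := by gcongr
          _ = _ := by ring)
  let K : 𝓢(ℝ × ℝ, ℂ) →L[ℂ] ℂ := A ∘L (expDeriv ^ m)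
  have hK : ∀ φ, K φ = ∫ z, g z * (expDeriv ^ m) φ z ∂ρ := fun φ => rfl
  refine ⟨K, fun φ hφ => ?_, fun s hs f => ?_, ?_⟩
  · change K φ = 0
    rw [hK]
    refine integral_eq_zero_of_ae (.of_forall fun z => ?_)
    rcases lt_or_ge z.2 0 with hz | hz
    · simp [hg0 z hz]
    · have : z ∉ tsupport ((expDeriv ^ m) φ) := fun hmem =>
        absurd (hφ (tsupport_expDeriv_pow_subset m φ hmem)) (not_lt.2 hz)
      simp only [image_eq_zero_of_notMem_tsupport this, mul_zero, Pi.zero_apply]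
  · have hpt : ∀ z : ℝ × ℝ, g z * (expDeriv ^ m) (tensorTest f (expTest s hs)) z =
        (1 + s) ^ m * f z.1 * (Complex.exp (-(s * z.2)) * bromwich (h z.1) 1 z.2) := by
      intro z
      rcases lt_or_ge z.2 0 with hz | hz
      · have : bromwich (h z.1) 1 z.2 = 0 := hg0 z hz
        rw [hg0 z hz, this]
        ring
      · rw [expDeriv_pow_apply_of_eqOn m (fun w hw => tensorTest_expTest_apply f hs hw)
          (by linarith)]
        change bromwich (h z.1) 1 z.2 * _ = _
        ring
    have h1 := hint ((expDeriv ^ m) (tensorTest f (expTest s hs)))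
    simp only [hpt] at h1
    have h2 : ∀ x, ∫ t : ℝ, (1 + s) ^ m * f x * (Complex.exp (-(s * t)) * bromwich (h x) 1 t) =
        f x * R x s := by
      intro x
      rw [integral_const_mul, integral_exp_mul_bromwich (hhd x) (hhb x) (hC' x) hs]
      have := pow_ne_zero m (hne s hs)
      simp only [h]
      field_simp
    refine ⟨?_, ?_⟩
    · have h3 := h1.integral_prod_left
      simpa only [h2] using h3
    · change K _ = _
      rw [hK]
      simp only [hpt]
      rw [integral_prod _ h1]
      simp only [h2]
  · let E : 𝓢(ℝ × ℝ, ℂ) →L[ℂ] 𝓢(ℝ × ℝ, ℂ) := expDeriv ^ m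
    have hI : 0 ≤ B' * ∫ z, W z ∂ρ := mul_nonneg hB'0 (integral_nonneg fun z => by positivity)
    -- A sum with a single term, used to scale a seminorm by a real constant.
    obtain ⟨q, hq, hqe⟩ := exists_seminorm_eq_sum (c := fun _ => B' * ∫ z, W z ∂ρ) (fun _ => hI)
      (q := fun _ => P.comp E.toLinearMap) (fun _ => hPc.comp E.continuous) 1
    refine ⟨q, hq, fun φ y hy => ?_⟩
    rw [hqe, Finset.sum_range_one]
    change _ * ‖K _‖ ≤ _ * P (E φ)
    rw [hK, expDeriv_pow_compSubConstCLM]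
    simp only [SchwartzMap.compSubConstCLM_apply, sub_neg_eq_add]
    have hn : (1 + ‖y‖) ^ k * ‖∫ z, g z * (expDeriv ^ m) φ (z + y) ∂ρ‖ =
        ‖∫ z, (((1 + ‖y‖) ^ k : ℝ) : ℂ) * (g z * (expDeriv ^ m) φ (z + y)) ∂ρ‖ := by
      rw [integral_const_mul, norm_mul, Complex.norm_real, Real.norm_of_nonneg (by positivity)]
    rw [hn, mul_right_comm, ← integral_const_mul]
    refine norm_integral_le_of_norm_le (hW.const_mul _) (.of_forall fun z => ?_)
    rw [norm_mul, Complex.norm_real, Real.norm_of_nonneg (by positivity)]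
    exact hcore _ y hy z

/-- A distribution with a prescribed, rapidly decreasing partial Laplace transform. -/
theorem exists_kernel (hμ : Integrable (fun x : ℝ => ((1 + ‖x‖) ^ 2)⁻¹) μ)
    (hcont : ContinuousOn (Function.uncurry R) (Set.univ ×ˢ {s | 0 < s.re}))
    (hd : ∀ x, DifferentiableOn ℂ (R x) {s | 0 < s.re})
    (hb : ∀ k : ℕ, ∃ C N M, 0 ≤ C ∧ ∀ (x : ℝ) (s : ℂ), 0 < s.re →
      (1 + ‖x‖) ^ k * ‖R x s‖ ≤ C * ‖1 + s‖ ^ N * (1 + 1 / s.re) ^ M) :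
    ∃ K : 𝓢'(ℝ × ℝ, ℂ), Distribution.IsVanishingOn K {p : ℝ × ℝ | p.2 < 0} ∧
      (∀ (s : ℂ) (hs : 0 < s.re) (f : 𝓢(ℝ, ℂ)), Integrable (fun x : ℝ => f x * R x s) μ ∧
        K (tensorTest f (expTest s hs)) = ∫ x : ℝ, f x * R x s ∂μ) ∧ HasDecay K := by
  choose C N M hC hb using hb
  choose K hK0 hKl q hq hKq using fun k =>
    exists_kernel_of_bound hμ hcont hd (hC (k + 2)) (hb (k + 2))
  refine ⟨K 0, hK0 0, hKl 0, fun k => ⟨q k, hq k, ?_⟩⟩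
  -- The kernels built for different `k` share one Laplace transform, hence coincide, and the single
  -- kernel has decay of every order.
  have : K 0 = K k := eq_of_laplace_eq (hK0 0) (hK0 k) fun s hs f => by
    rw [(hKl 0 s hs f).2, (hKl k s hs f).2]
  rw [this]
  exact hKq k

end Kernel

/-! ### Derivatives of product test functions -/

section TensorTest

theorem lineDerivOp_eqOn {φ ψ : 𝓢(ℝ × ℝ, ℂ)} {b : ℝ} (h : ∀ z : ℝ × ℝ, b < z.2 → φ z = ψ z)
    (v : ℝ × ℝ) {z : ℝ × ℝ} (hz : b < z.2) : ∂_{v} φ z = ∂_{v} ψ z := by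
  rw [SchwartzMap.lineDerivOp_apply_eq_fderiv, SchwartzMap.lineDerivOp_apply_eq_fderiv]
  have : φ =ᶠ[𝓝 z] ψ := by
    filter_upwards [(isOpen_lt continuous_const continuous_snd).mem_nhds hz] with w hw using h w hw
  rw [this.fderiv_eq]

theorem lineDerivOp_fst_tensorTest (f g : 𝓢(ℝ, ℂ)) :
    ∂_{((1, 0) : ℝ × ℝ)} (tensorTest f g) = tensorTest (∂_{(1 : ℝ)} f) g := by
  ext z
  rw [SchwartzMap.lineDerivOp_apply, lineDeriv, tensorTest_apply, SchwartzMap.lineDerivOp_apply,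
    lineDeriv]
  have h1 : DifferentiableAt ℝ (fun t : ℝ => f (z.1 + t • (1 : ℝ))) 0 :=
    f.differentiableAt.comp _ (by fun_prop)
  rw [← deriv_mul_const h1]
  simp [tensorTest_apply]

theorem tensorTest_add (f₁ f₂ g : 𝓢(ℝ, ℂ)) :
    tensorTest (f₁ + f₂) g = tensorTest f₁ g + tensorTest f₂ g := by
  ext z
  simp [tensorTest_apply, add_mul]

theorem tensorTest_smul (c : ℂ) (f g : 𝓢(ℝ, ℂ)) :
    tensorTest (c • f) g = c • tensorTest f g := by
  ext z
  simp [tensorTest_apply, mul_assoc]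

theorem dt_dt_tensorTest_apply (f : 𝓢(ℝ, ℂ)) {s : ℂ} (hs : 0 < s.re) {z : ℝ × ℝ}
    (hz : -1 < z.2) :
    ∂_{((0, 1) : ℝ × ℝ)} (∂_{((0, 1) : ℝ × ℝ)} (tensorTest f (expTest s hs))) z =
      (s ^ 2 • tensorTest f (expTest s hs)) z := by
  have h1 : ∀ w : ℝ × ℝ, -1 < w.2 → ∂_{((0, 1) : ℝ × ℝ)} (tensorTest f (expTest s hs)) w =
      -s * (f w.1 * Complex.exp (-(s * w.2))) := fun w hw => by
    have := lineDerivOp_snd_apply_of_eqOn (φ := tensorTest f (expTest s hs)) (c := 1) (s := s)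
      (f := f) (fun w hw => by rw [one_mul, tensorTest_expTest_apply f hs hw]) hw
    rw [this, mul_one]
  rw [lineDerivOp_snd_apply_of_eqOn h1 hz, smul_apply, tensorTest_expTest_apply f hs hz,
    smul_eq_mul]
  ring

theorem isVanishingOn_dx {u : 𝓢'(ℝ × ℝ, ℂ)} {s : Set (ℝ × ℝ)}
    (hu : Distribution.IsVanishingOn u s) : Distribution.IsVanishingOn (dx u) s :=
  Distribution.TemperedDistribution.IsVanishingOn.lineDerivOp hu _

theorem dt_dt_apply (u : 𝓢'(ℝ × ℝ, ℂ)) (φ : 𝓢(ℝ × ℝ, ℂ)) :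
    dt (dt u) φ = u (∂_{((0, 1) : ℝ × ℝ)} (∂_{((0, 1) : ℝ × ℝ)} φ)) := by
  rw [dt, dt, TemperedDistribution.lineDerivOp_apply_apply,
    TemperedDistribution.lineDerivOp_apply_apply, LineDeriv.lineDerivOp_neg, neg_neg]

theorem dx_dx_apply (u : 𝓢'(ℝ × ℝ, ℂ)) (φ : 𝓢(ℝ × ℝ, ℂ)) :
    dx (dx u) φ = u (∂_{((1, 0) : ℝ × ℝ)} (∂_{((1, 0) : ℝ × ℝ)} φ)) := by
  rw [dx, dx, TemperedDistribution.lineDerivOp_apply_apply,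
    TemperedDistribution.lineDerivOp_apply_apply, LineDeriv.lineDerivOp_neg, neg_neg]

theorem timeCutoff_of_ge {y : ℝ × ℝ} (hy : -1 ≤ y.2) : timeCutoff y = 1 := by
  simp [timeCutoff, Real.smoothTransition.one_of_one_le (show 1 ≤ y.2 + 2 by linarith)]

end TensorTest

/-! ### Time convolution and the weak form of the equation -/

section TimeConvolution

variable {a : 𝓢'(ℝ, ℂ)} {A : ℂ → ℂ}

/-- The distribution `δ(x) a(t)`. -/
noncomputable def deltaTensor (a : 𝓢'(ℝ, ℂ)) : 𝓢'(ℝ × ℝ, ℂ) :=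
  PointwiseConvergenceCLM.precomp ℂ (sliceT 0 0) a

theorem deltaTensor_apply (a : 𝓢'(ℝ, ℂ)) (φ : 𝓢(ℝ × ℝ, ℂ)) :
    deltaTensor a φ = a (sliceT 0 0 φ) := rfl

theorem correlation_deltaTensor (a : 𝓢'(ℝ, ℂ)) (φ : 𝓢(ℝ × ℝ, ℂ)) (y : ℝ × ℝ) :
    correlation (deltaTensor a : 𝓢(ℝ × ℝ, ℂ) →L[ℂ] ℂ) φ y = a (sliceT y.1 y.2 φ) := by
  change a (sliceT 0 0 (SchwartzMap.compSubConstCLM ℂ (-y) φ)) = _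
  congr 1
  ext τ
  rw [sliceT_apply, sliceT_apply, SchwartzMap.compSubConstCLM_apply]
  congr 1
  ext
  · simp
  · simp [add_comm]

theorem IsInverseLaplace.isVanishingOn_deltaTensor (ha : IsInverseLaplace a A) :
    Distribution.IsVanishingOn (deltaTensor a) {p : ℝ × ℝ | p.2 < 0} := by
  intro φ hφ
  rw [deltaTensor_apply]
  refine ha.1 _ fun t ht => ?_
  have hc : Continuous fun t : ℝ => ((0, 0 + t) : ℝ × ℝ) := by fun_prop
  have h1 := tsupport_comp_subset_preimage φ hc ht
  simpa using hφ h1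

theorem IsInverseLaplace.deltaTensor_tensorTest (ha : IsInverseLaplace a A) {s : ℂ} (hs : 0 < s.re)
    (f : 𝓢(ℝ, ℂ)) : deltaTensor a (tensorTest f (expTest s hs)) = f 0 * A s := by
  rw [deltaTensor_apply, ← ha.2 s hs, ← smul_eq_mul, ← map_smul]
  congr 1
  ext t
  simp [sliceT_apply, tensorTest_apply]

theorem IsInverseLaplace.hasDecay_deltaTensor (ha : IsInverseLaplace a A) :
    HasDecay (deltaTensor a : 𝓢(ℝ × ℝ, ℂ) →L[ℂ] ℂ) := by
  obtain ⟨N, M, C, hC, hb⟩ := ha.polyGrowth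
  -- The bump supplies the decay in `x` demanded by `exists_kernel`. It equals `1` at `x = 0`, the
  -- only point seen by the Dirac measure.
  have hc : ContinuousOn (Function.uncurry fun (x : ℝ) (s : ℂ) => unitBump x * A s)
      (Set.univ ×ˢ {s | 0 < s.re}) := by
    refine ContinuousOn.mul (unitBump.continuous.comp continuous_fst).continuousOn ?_
    exact ha.differentiableOn.continuousOn.comp continuousOn_snd fun p hp => hp.2
  have hbd : ∀ k : ℕ, ∃ C N M, 0 ≤ C ∧ ∀ (x : ℝ) (s : ℂ), 0 < s.re →
      (1 + ‖x‖) ^ k * ‖unitBump x * A s‖ ≤ C * ‖1 + s‖ ^ N * (1 + 1 / s.re) ^ M := by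
    intro k
    obtain ⟨D, hD, h⟩ := one_add_norm_pow_mul_iteratedFDeriv_le unitBump k 0
    refine ⟨D * C, N, M, by positivity, fun x s hs => ?_⟩
    have h1 := h x
    rw [norm_iteratedFDeriv_zero] at h1
    have h2 := hb s hs
    rw [norm_mul, ← mul_assoc, mul_assoc D, mul_assoc D]
    gcongr
  obtain ⟨K, hK0, hKl, hK⟩ := exists_kernel (μ := Measure.dirac (0 : ℝ))
    (integrable_dirac (by simp)) hc (fun x => ha.differentiableOn.const_mul _) hbd
  have : deltaTensor a = K :=
    eq_of_laplace_eq ha.isVanishingOn_deltaTensor hK0 fun s hs f => by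
      rw [(hKl s hs f).2, integral_dirac, unitBump_zero, one_mul, ha.deltaTensor_tensorTest hs]
  rw [this]
  exact hK

theorem IsInverseLaplace.exists_clm (ha : IsInverseLaplace a A) :
    ∃ T : 𝓢(ℝ × ℝ, ℂ) →L[ℂ] 𝓢(ℝ × ℝ, ℂ),
      ∀ φ y, -1 < y.2 → T φ y = a (sliceT y.1 y.2 φ) := by
  obtain ⟨T, hT⟩ := ha.hasDecay_deltaTensor.exists_clm
  exact ⟨T, fun φ y hy => by
    rw [hT, timeCutoff_of_ge hy.le, one_mul, correlation_deltaTensor]⟩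

/-- The exponential `exp(-st)` is an eigenfunction of the transposed time convolution, with
eigenvalue `A s`. -/
theorem IsInverseLaplace.sliceT_tensorTest (ha : IsInverseLaplace a A) {s : ℂ} (hs : 0 < s.re)
    (f : 𝓢(ℝ, ℂ)) {y : ℝ × ℝ} (hy : -1 < y.2) :
    a (sliceT y.1 y.2 (tensorTest f (expTest s hs))) =
      A s * tensorTest f (expTest s hs) y := by
  rw [← ha.2 s hs, mul_comm, ← smul_eq_mul, ← map_smul]
  -- Both cutoffs must equal `1`, that is `τ > -1` and `y.2 + τ > -1`. The hypothesis on `y.2` makes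
  -- the maximum negative.
  refine map_eq_of_eqOn_Ioi ha.1 (b := max (-1) (-1 - y.2)) (max_lt (by norm_num) (by linarith))
    fun t ht => ?_
  have h1 := (le_max_left _ _).trans_lt ht
  have h2 := (le_max_right _ _).trans_lt ht
  rw [sliceT_apply, tensorTest_expTest_apply f hs (by simp only; linarith), smul_apply, smul_eq_mul,
    tensorTest_expTest_apply f hs hy, expTest_apply, expFun_of_ge _ h1.le, mul_assoc,
    ← Complex.exp_add]
  congr 2
  push_cast
  ring

variable {T : 𝓢(ℝ × ℝ, ℂ) →L[ℂ] 𝓢(ℝ × ℝ, ℂ)}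

/-- Derivatives and convolution are moved onto the test function. The auxiliary `ψ` in `IsConvT`
matters only for `t > -1`, where it agrees with `T φ`. -/
theorem isSolution_iff (hT : ∀ φ y, -1 < y.2 → T φ y = a (sliceT y.1 y.2 φ))
    (f u : 𝓢'(ℝ × ℝ, ℂ)) : IsSolution a f u ↔
      Distribution.IsVanishingOn u {p : ℝ × ℝ | p.2 < 0} ∧ ∀ φ,
        u (∂_{((0, 1) : ℝ × ℝ)} (∂_{((0, 1) : ℝ × ℝ)} φ)) =
          u (∂_{((1, 0) : ℝ × ℝ)} (∂_{((1, 0) : ℝ × ℝ)} (T φ))) + f φ := by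
  refine and_congr_right fun hu => ⟨?_, fun h => ?_⟩
  · rintro ⟨w, hw, he⟩ φ
    rw [← dt_dt_apply, he, ← dx_dx_apply]
    obtain ⟨ψ, hψ, hwφ⟩ := hw φ
    change w φ + f φ = _
    rw [hwφ, map_eq_of_eqOn (isVanishingOn_dx (isVanishingOn_dx hu))
      (b := -1) (by norm_num) (φ := ψ) (ψ := T φ) fun p hp => by
        rw [hT φ p hp, ← hψ p.1 p.2 hp]]
  · refine ⟨PointwiseConvergenceCLM.precomp ℂ T (dx (dx u)), fun φ => ⟨T φ, fun x t ht =>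
      hT φ (x, t) ht, rfl⟩, ?_⟩
    ext φ
    change dt (dt u) φ = dx (dx u) (T φ) + f φ
    rw [dt_dt_apply, dx_dx_apply, h]

theorem dx_dx_clm_tensorTest (ha : IsInverseLaplace a A)
    (hT : ∀ φ y, -1 < y.2 → T φ y = a (sliceT y.1 y.2 φ))
    {u : 𝓢'(ℝ × ℝ, ℂ)} (hu : Distribution.IsVanishingOn u {p : ℝ × ℝ | p.2 < 0}) {s : ℂ}
    (hs : 0 < s.re) (f : 𝓢(ℝ, ℂ)) :
    u (∂_{((1, 0) : ℝ × ℝ)} (∂_{((1, 0) : ℝ × ℝ)} (T (tensorTest f (expTest s hs))))) =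
      A s * u (tensorTest (∂_{(1 : ℝ)} (∂_{(1 : ℝ)} f)) (expTest s hs)) := by
  rw [← lineDerivOp_fst_tensorTest, ← lineDerivOp_fst_tensorTest, ← smul_eq_mul, ← map_smul]
  refine map_eq_of_eqOn hu (b := -1) (by norm_num) fun p hp => ?_
  rw [← LineDeriv.lineDerivOp_smul, ← LineDeriv.lineDerivOp_smul]
  refine lineDerivOp_eqOn (fun q hq => lineDerivOp_eqOn (fun r hr => ?_) _ hq) _ hp
  rw [hT _ _ hr, ha.sliceT_tensorTest hs f hr, smul_apply, smul_eq_mul]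

theorem dt_dt_map_tensorTest {u : 𝓢'(ℝ × ℝ, ℂ)}
    (hu : Distribution.IsVanishingOn u {p : ℝ × ℝ | p.2 < 0}) {s : ℂ} (hs : 0 < s.re)
    (f : 𝓢(ℝ, ℂ)) :
    u (∂_{((0, 1) : ℝ × ℝ)} (∂_{((0, 1) : ℝ × ℝ)} (tensorTest f (expTest s hs)))) =
      s ^ 2 * u (tensorTest f (expTest s hs)) := by
  rw [← smul_eq_mul, ← map_smul]
  exact map_eq_of_eqOn hu (b := -1) (by norm_num) fun p hp => dt_dt_tensorTest_apply f hs hp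

end TimeConvolution

/-! ### The Green's function of ∂² - p² on the line -/

section OneDimensional

theorem tendsto_mul_exp_neg_atTop (f : 𝓢(ℝ, ℂ)) {p : ℂ} (hp : 0 < p.re) :
    Tendsto (fun x : ℝ => f x * Complex.exp (-(p * x))) atTop (𝓝 0) := by
  refine squeeze_zero_norm' (a := fun x => ‖f x‖) ?_ ?_
  · filter_upwards [eventually_ge_atTop 0] with x hx
    rw [norm_mul, Complex.norm_exp]
    refine mul_le_of_le_one_right (norm_nonneg _) (Real.exp_le_one_iff.2 ?_)
    simp only [Complex.neg_re, Complex.re_mul_ofReal]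
    nlinarith
  · have h := (SchwartzMap.toZeroAtInfty f).zero_at_infty'
    have h1 : Tendsto f (cocompact ℝ) (𝓝 0) := h
    simpa using (h1.mono_left atTop_le_cocompact).norm

theorem integrableOn_mul_exp_neg (f : 𝓢(ℝ, ℂ)) {p : ℂ} (hp : 0 < p.re) :
    IntegrableOn (fun x : ℝ => f x * Complex.exp (-(p * x))) (Set.Ioi 0) := by
  refine (f.integrable.norm.integrableOn).mono' (Continuous.aestronglyMeasurable
    (by have := f.continuous; fun_prop)) ?_
  filter_upwards [ae_restrict_mem measurableSet_Ioi] with x hx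
  have hx : 0 < x := hx
  rw [norm_mul, Complex.norm_exp]
  refine mul_le_of_le_one_right (norm_nonneg _) (Real.exp_le_one_iff.2 ?_)
  simp only [Complex.neg_re, Complex.re_mul_ofReal]
  nlinarith

theorem hasDerivAt_schwartz (f : 𝓢(ℝ, ℂ)) (x : ℝ) : HasDerivAt f (∂_{(1 : ℝ)} f x) x := by
  rw [SchwartzMap.lineDerivOp_apply_eq_fderiv]
  exact f.differentiableAt.hasDerivAt

/-- The integrand is the derivative of `(f' + p f) exp(-px)`, which vanishes at infinity, so only
the boundary term at `0` remains. -/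
theorem integral_Ioi_mul_exp_neg (f : 𝓢(ℝ, ℂ)) {p : ℂ} (hp : 0 < p.re) :
    ∫ x in Set.Ioi (0 : ℝ), (∂_{(1 : ℝ)} (∂_{(1 : ℝ)} f) - p ^ 2 • f) x * Complex.exp (-(p * x)) =
      -(∂_{(1 : ℝ)} f 0 + p * f 0) := by
  have hd : ∀ x ∈ Set.Ici (0 : ℝ), HasDerivAt
      (fun x : ℝ => (∂_{(1 : ℝ)} f + p • f) x * Complex.exp (-(p * x)))
      ((∂_{(1 : ℝ)} (∂_{(1 : ℝ)} f) - p ^ 2 • f) x * Complex.exp (-(p * x))) x := by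
    intro x _
    have h1 : HasDerivAt (fun x : ℝ => Complex.exp (-(p * x)))
        (Complex.exp (-(p * x)) * (-(p * 1))) x :=
      (((Complex.ofRealCLM.hasDerivAt (x := x)).const_mul p).neg).cexp
    refine ((hasDerivAt_schwartz (∂_{(1 : ℝ)} f + p • f) x).mul h1).congr_deriv ?_
    simp only [LineDeriv.lineDerivOp_add, LineDeriv.lineDerivOp_smul, add_apply, sub_apply,
      smul_apply, smul_eq_mul]
    ring
  rw [integral_Ioi_of_hasDerivAt_of_tendsto' hd (integrableOn_mul_exp_neg _ hp)
    (tendsto_mul_exp_neg_atTop _ hp)]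
  simp

/-- Reflection of a test function. -/
noncomputable def reflect : 𝓢(ℝ, ℂ) →L[ℂ] 𝓢(ℝ, ℂ) :=
  SchwartzMap.compCLMOfContinuousLinearEquiv ℂ (ContinuousLinearEquiv.neg ℝ (M := ℝ))

theorem reflect_apply (f : 𝓢(ℝ, ℂ)) (x : ℝ) : reflect f x = f (-x) := rfl

theorem lineDerivOp_reflect (f : 𝓢(ℝ, ℂ)) :
    ∂_{(1 : ℝ)} (reflect f) = -reflect (∂_{(1 : ℝ)} f) := by
  ext x
  have h1 := (hasDerivAt_schwartz (reflect f) x).unique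
    (((hasDerivAt_schwartz f (-x)).scomp x (hasDerivAt_neg x)))
  rw [h1, neg_apply, reflect_apply]
  simp

theorem integral_mul_exp_neg_abs (f : 𝓢(ℝ, ℂ)) {p : ℂ} (hp : 0 < p.re) :
    Integrable (fun x : ℝ => f x * Complex.exp (-(|x| * p))) ∧
    ∫ x : ℝ, f x * Complex.exp (-(|x| * p)) =
      (∫ x in Set.Ioi (0 : ℝ), f x * Complex.exp (-(p * x))) +
        ∫ x in Set.Ioi (0 : ℝ), reflect f x * Complex.exp (-(p * x)) := by
  have hcont : Continuous fun x : ℝ => f x * Complex.exp (-(|x| * p)) := by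
    have := f.continuous
    fun_prop
  have hint : Integrable (fun x : ℝ => f x * Complex.exp (-(|x| * p))) := by
    refine f.integrable.norm.mono' hcont.aestronglyMeasurable (.of_forall fun x => ?_)
    rw [norm_mul, Complex.norm_exp]
    refine mul_le_of_le_one_right (norm_nonneg _) (Real.exp_le_one_iff.2 ?_)
    simp only [Complex.neg_re, Complex.re_ofReal_mul]
    nlinarith [abs_nonneg x]
  refine ⟨hint, ?_⟩
  rw [← intervalIntegral.integral_Iic_add_Ioi hint.integrableOn hint.integrableOn (b := 0),
    add_comm]
  congr 1
  · refine setIntegral_congr_fun measurableSet_Ioi fun x hx => ?_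
    have hx : 0 < x := hx
    simp only [abs_of_pos hx, mul_comm p]
  · rw [← neg_zero, ← integral_comp_neg_Ioi, neg_zero]
    refine setIntegral_congr_fun measurableSet_Ioi fun x hx => ?_
    have hx : 0 < x := hx
    simp only [abs_neg, abs_of_pos hx, mul_comm p, reflect_apply]

/-- Weak form of `(∂² - p²) exp(-p|x|) = -2pδ`. The half-line formula is applied to `f` and to its
reflection, and the terms `f' 0` cancel. -/
theorem integral_lineDerivOp_mul_exp_neg_abs (f : 𝓢(ℝ, ℂ)) {p : ℂ} (hp : 0 < p.re) :
    ∫ x : ℝ, ∂_{(1 : ℝ)} (∂_{(1 : ℝ)} f) x * Complex.exp (-(|x| * p)) =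
      p ^ 2 * (∫ x : ℝ, f x * Complex.exp (-(|x| * p))) - 2 * p * f 0 := by
  set g := ∂_{(1 : ℝ)} (∂_{(1 : ℝ)} f) with hg
  have h1 := (integral_mul_exp_neg_abs (g - p ^ 2 • f) hp).2
  have hr : reflect (g - p ^ 2 • f) =
      ∂_{(1 : ℝ)} (∂_{(1 : ℝ)} (reflect f)) - p ^ 2 • reflect f := by
    rw [map_sub, map_smul, lineDerivOp_reflect, LineDeriv.lineDerivOp_neg, lineDerivOp_reflect,
      neg_neg]
  rw [hr, integral_Ioi_mul_exp_neg f hp, integral_Ioi_mul_exp_neg _ hp, lineDerivOp_reflect,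
    neg_apply, reflect_apply, reflect_apply, neg_zero] at h1
  simp only [sub_apply, smul_apply, sub_mul, smul_eq_mul, mul_assoc] at h1
  rw [integral_sub (integral_mul_exp_neg_abs g hp).1
    ((integral_mul_exp_neg_abs f hp).1.const_mul _), integral_const_mul] at h1
  linear_combination h1

end OneDimensional

/-! ### Distributions supported in t ≥ 0 -/

section HalfSpace

/-- Translating both functions by `ε` in time gains the margin required by `map_eq_of_eqOn`;
continuity of translation then lets `ε → 0`. -/
theorem map_eq_of_eqOn_pos {z : 𝓢'(ℝ × ℝ, ℂ)}
    (hz : Distribution.IsVanishingOn z {p : ℝ × ℝ | p.2 < 0}) {φ ψ : 𝓢(ℝ × ℝ, ℂ)}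
    (h : ∀ p : ℝ × ℝ, 0 < p.2 → φ p = ψ p) : z φ = z ψ := by
  let u : 𝓢(ℝ × ℝ, ℂ) →L[ℂ] ℂ := z
  have hc : ∀ θ : 𝓢(ℝ × ℝ, ℂ), Tendsto
      (fun ε : ℝ => u (SchwartzMap.compSubConstCLM ℂ ((0, -ε) : ℝ × ℝ) θ)) (𝓝[>] 0) (𝓝 (u θ)) := by
    intro θ
    have h1 : Continuous fun ε : ℝ => u (SchwartzMap.compSubConstCLM ℂ ((0, -ε) : ℝ × ℝ) θ) :=
      u.continuous.comp ((continuous_compSubConstCLM θ).comp (by fun_prop))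
    have h2 := h1.tendsto 0
    have h3 : SchwartzMap.compSubConstCLM ℂ ((0, -0) : ℝ × ℝ) θ = θ := by
      ext p
      rw [SchwartzMap.compSubConstCLM_apply, neg_zero, show ((0, 0) : ℝ × ℝ) = 0 from rfl,
        sub_zero]
    rw [h3] at h2
    exact h2.mono_left nhdsWithin_le_nhds
  refine tendsto_nhds_unique ((hc φ).congr' ?_) (hc ψ)
  filter_upwards [self_mem_nhdsWithin] with ε hε
  have hε : 0 < ε := hε
  refine map_eq_of_eqOn hz (b := -ε) (by linarith) fun p hp => ?_
  rw [SchwartzMap.compSubConstCLM_apply, SchwartzMap.compSubConstCLM_apply]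
  refine h _ ?_
  simp only [Prod.snd_sub]
  linarith

theorem eq_zero_of_tsupport_subset {φ : 𝓢(ℝ × ℝ, ℂ)} (h : tsupport φ ⊆ {p : ℝ × ℝ | p.2 < 0})
    {p : ℝ × ℝ} (hp : 0 ≤ p.2) : φ p = 0 :=
  image_eq_zero_of_notMem_tsupport fun hm => absurd (h hm) (not_lt.2 hp)

theorem isVanishingOn_mulDelta (w : 𝓢'(ℝ, ℂ)) :
    Distribution.IsVanishingOn (mulDelta w) {p : ℝ × ℝ | p.2 < 0} := by
  intro φ hφ
  have : sliceX 0 φ = 0 := by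
    ext x
    rw [sliceX_apply, eq_zero_of_tsupport_subset hφ le_rfl]
    rfl
  rw [mulDelta_apply, this, map_zero]

theorem isVanishingOn_cauchyData (u₀ v₀ : 𝓢'(ℝ, ℂ)) :
    Distribution.IsVanishingOn (cauchyData u₀ v₀) {p : ℝ × ℝ | p.2 < 0} := by
  intro φ hφ
  have h1 : dt (mulDelta u₀) φ = 0 :=
    Distribution.TemperedDistribution.IsVanishingOn.lineDerivOp (isVanishingOn_mulDelta u₀) _ φ hφ
  change dt (mulDelta u₀) φ + mulDelta v₀ φ = 0
  rw [h1, isVanishingOn_mulDelta v₀ φ hφ, add_zero]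

theorem compSubConstCLM_tensorTest (x : ℝ) (f g : 𝓢(ℝ, ℂ)) :
    SchwartzMap.compSubConstCLM ℂ (-((x, 0) : ℝ × ℝ)) (tensorTest f g) =
      tensorTest (SchwartzMap.compSubConstCLM ℂ (-x) f) g := by
  ext p
  simp [SchwartzMap.compSubConstCLM_apply, tensorTest_apply]

end HalfSpace

/-! ### The fundamental solution -/

section FundamentalSolution

variable {a : 𝓢'(ℝ, ℂ)} {A Q : ℂ → ℂ} {T : 𝓢(ℝ × ℝ, ℂ) →L[ℂ] 𝓢(ℝ × ℝ, ℂ)} {S : 𝓢'(ℝ × ℝ, ℂ)}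

theorem exists_kernelLaplace_inverse (hQ : ∀ s : ℂ, 0 < s.re → s ^ 2 * Q s ∈ Complex.slitPlane)
    (hd : DifferentiableOn ℂ Q {s | 0 < s.re}) (hg : HasPolyGrowth Q) :
    ∃ S : 𝓢'(ℝ × ℝ, ℂ), IsInverseLaplaceT S (kernelLaplace Q) ∧
      HasDecay (S : 𝓢(ℝ × ℝ, ℂ) →L[ℂ] ℂ) := by
  have hc : ContinuousOn (Function.uncurry (kernelLaplace Q)) (Set.univ ×ˢ {s | 0 < s.re}) := by
    have h0 : ∀ s : ℂ, 0 < s.re → s ≠ 0 := fun s hs h => by simp [h] at hs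
    have h1 : ContinuousOn (fun p : ℝ × ℂ => rootFun Q p.2) (Set.univ ×ˢ {s | 0 < s.re}) :=
      (differentiableOn_rootFun hQ hd).continuousOn.comp continuousOn_snd fun p hp => hp.2
    refine ContinuousOn.congr (f := fun p : ℝ × ℂ => rootFun Q p.2 / (2 * p.2 ^ 2) *
      Complex.exp (-(|p.1| * rootFun Q p.2))) ?_ fun p hp => kernelLaplace_eq p.1 (h0 p.2 hp.2)
    refine (h1.div (by fun_prop) fun p hp => ?_).mul
      (ContinuousOn.cexp (ContinuousOn.neg (ContinuousOn.mul (by fun_prop) h1)))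
    have := h0 p.2 hp.2
    simpa using this
  obtain ⟨S, h0, hl, hS⟩ := exists_kernel (μ := volume) integrable_inv_one_add_norm_sq hc
    (differentiableOn_kernelLaplace hQ hd) (exists_norm_kernelLaplace_le hQ hd hg)
  exact ⟨S, ⟨h0, hl⟩, hS⟩

/-- The ODE `s²Ŝ - A Ŝ'' = δ` in weak form. It follows from the Green's function formula because `A
p² = s² A Q = s²`. -/
theorem map_tensorTest_identity (hQ : ∀ s : ℂ, 0 < s.re → s ^ 2 * Q s ∈ Complex.slitPlane)
    (hAQ : ∀ s : ℂ, 0 < s.re → A s * Q s = 1) (hS : IsInverseLaplaceT S (kernelLaplace Q)) {s : ℂ}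
    (hs : 0 < s.re) (f : 𝓢(ℝ, ℂ)) :
    s ^ 2 * S (tensorTest f (expTest s hs)) =
      A s * S (tensorTest (∂_{(1 : ℝ)} (∂_{(1 : ℝ)} f)) (expTest s hs)) + f 0 := by
  have hs0 : s ≠ 0 := fun h => by simp [h] at hs
  have h1 : ∀ f : 𝓢(ℝ, ℂ), S (tensorTest f (expTest s hs)) =
      rootFun Q s / (2 * s ^ 2) * ∫ x : ℝ, f x * Complex.exp (-(|x| * rootFun Q s)) := by
    intro f
    rw [(hS.2 s hs f).2, ← integral_const_mul]
    refine integral_congr_ae (.of_forall fun x => ?_)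
    simp only [kernelLaplace_eq x hs0]
    ring
  rw [h1, h1, integral_lineDerivOp_mul_exp_neg_abs f (rootFun_re_pos hQ hs)]
  have h2 := rootFun_sq (Q := Q) s
  have h3 := hAQ s hs
  set p := rootFun Q s
  set I := ∫ x : ℝ, f x * Complex.exp (-(|x| * p))
  field_simp
  have h4 : A s * p ^ 2 = s ^ 2 := by rw [h2, mul_left_comm, h3, mul_one]
  linear_combination (-(p * I) + 2 * f 0) * h4

/-- Both sides define distributions in `φ` that vanish for `t < 0`, and `map_tensorTest_identity`
says that their Laplace transforms agree. -/
theorem map_dt_dt_eq (hQ : ∀ s : ℂ, 0 < s.re → s ^ 2 * Q s ∈ Complex.slitPlane)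
    (hAQ : ∀ s : ℂ, 0 < s.re → A s * Q s = 1) (ha : IsInverseLaplace a A)
    (hT : ∀ φ y, -1 < y.2 → T φ y = a (sliceT y.1 y.2 φ))
    (hS : IsInverseLaplaceT S (kernelLaplace Q)) (φ : 𝓢(ℝ × ℝ, ℂ)) :
    S (∂_{((0, 1) : ℝ × ℝ)} (∂_{((0, 1) : ℝ × ℝ)} φ)) =
      S (∂_{((1, 0) : ℝ × ℝ)} (∂_{((1, 0) : ℝ × ℝ)} (T φ))) + φ (0, 0) := by
  let w : 𝓢'(ℝ × ℝ, ℂ) := PointwiseConvergenceCLM.precomp ℂ T (dx (dx S)) +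
    TemperedDistribution.delta ((0, 0) : ℝ × ℝ)
  have hw : ∀ φ, w φ = S (∂_{((1, 0) : ℝ × ℝ)} (∂_{((1, 0) : ℝ × ℝ)} (T φ))) + φ (0, 0) :=
    fun φ => by
      rw [← dx_dx_apply]
      rfl
  have hw0 : Distribution.IsVanishingOn w {p : ℝ × ℝ | p.2 < 0} := by
    intro φ hφ
    -- At a time `t > 0`, `T φ` involves `φ` only at later times, because `a` is supported in `[0,
    -- ∞)`. So `T φ` vanishes there when `φ` lives in `t < 0`.
    have h1 : dx (dx S) (T φ) = dx (dx S) 0 :=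
      map_eq_of_eqOn_pos (isVanishingOn_dx (isVanishingOn_dx hS.1)) fun p hp => by
        rw [hT _ _ (by linarith)]
        have h2 : a (sliceT p.1 p.2 φ) = a 0 :=
          map_eq_of_eqOn_Ioi ha.1 (b := -p.2) (by linarith) fun t ht =>
            eq_zero_of_tsupport_subset hφ (by simp only; linarith)
        rw [h2, map_zero]
        rfl
    rw [hw, ← dx_dx_apply, h1, map_zero, zero_add, eq_zero_of_tsupport_subset hφ le_rfl]
  have key : dt (dt S) = w := by
    refine eq_of_laplace_eq ?_ hw0 fun s hs f => ?_
    · exact Distribution.TemperedDistribution.IsVanishingOn.lineDerivOp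
        (Distribution.TemperedDistribution.IsVanishingOn.lineDerivOp hS.1 _) _
    · rw [dt_dt_apply, hw, dt_dt_map_tensorTest hS.1 hs, dx_dx_clm_tensorTest ha hT hS.1 hs,
        map_tensorTest_identity hQ hAQ hS hs, tensorTest_apply, expTest_apply,
        expFun_of_ge _ (by norm_num)]
      simp
  rw [← dt_dt_apply, key, hw]

/-- The convolution with the fundamental solution inverts the transposed wave operator. -/
theorem correlation_dt_dt_sub (hQ : ∀ s : ℂ, 0 < s.re → s ^ 2 * Q s ∈ Complex.slitPlane)
    (hAQ : ∀ s : ℂ, 0 < s.re → A s * Q s = 1) (ha : IsInverseLaplace a A)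
    (hT : ∀ φ y, -1 < y.2 → T φ y = a (sliceT y.1 y.2 φ))
    (hS : IsInverseLaplaceT S (kernelLaplace Q)) (φ : 𝓢(ℝ × ℝ, ℂ)) {y : ℝ × ℝ} (hy : 0 < y.2) :
    correlation (S : 𝓢(ℝ × ℝ, ℂ) →L[ℂ] ℂ) (∂_{((0, 1) : ℝ × ℝ)} (∂_{((0, 1) : ℝ × ℝ)} φ)) y =
      correlation (S : 𝓢(ℝ × ℝ, ℂ) →L[ℂ] ℂ)
        (∂_{((1, 0) : ℝ × ℝ)} (∂_{((1, 0) : ℝ × ℝ)} (T φ))) y + φ y := by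
  have h := map_dt_dt_eq hQ hAQ ha hT hS (SchwartzMap.compSubConstCLM ℂ (-y) φ)
  rw [lineDerivOp_compSubConstCLM, lineDerivOp_compSubConstCLM] at h
  change S _ = S _ + _
  rw [h, SchwartzMap.compSubConstCLM_apply, sub_neg_eq_add, show ((0, 0) : ℝ × ℝ) = 0 from rfl,
    zero_add, ← lineDerivOp_compSubConstCLM, ← lineDerivOp_compSubConstCLM]
  congr 1
  -- `T` commutes with translations only away from its cutoff. For `p.2 > 0` and `y.2 > 0` both
  -- evaluation times are in the good range.
  refine map_eq_of_eqOn_pos hS.1 fun p hp => ?_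
  refine lineDerivOp_eqOn (fun q hq => lineDerivOp_eqOn (fun r hr => ?_) _ hq) _ hp
  rw [SchwartzMap.compSubConstCLM_apply, sub_neg_eq_add, hT _ _ (by linarith),
    hT _ _ (by simp only [Prod.snd_add]; linarith)]
  congr 1
  ext τ
  rw [sliceT_apply, sliceT_apply, SchwartzMap.compSubConstCLM_apply, sub_neg_eq_add]
  congr 1
  ext
  · rfl
  · change r.2 + τ + y.2 = r.2 + y.2 + τ
    ring

/-- `F x` pairs the Green's function at `s` with the translate `f(· + x)`. It is a Schwartz function
because it is the restriction to `t = 0` of `U` applied to `f(x) exp(-st)`. -/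
theorem exists_ode_solution (hQ : ∀ s : ℂ, 0 < s.re → s ^ 2 * Q s ∈ Complex.slitPlane)
    (hAQ : ∀ s : ℂ, 0 < s.re → A s * Q s = 1) (hS : IsInverseLaplaceT S (kernelLaplace Q))
    {U : 𝓢(ℝ × ℝ, ℂ) →L[ℂ] 𝓢(ℝ × ℝ, ℂ)}
    (hU : ∀ φ y, U φ y = timeCutoff y * correlation (S : 𝓢(ℝ × ℝ, ℂ) →L[ℂ] ℂ) φ y) {s : ℂ}
    (hs : 0 < s.re) (f : 𝓢(ℝ, ℂ)) :
    ∃ F : 𝓢(ℝ, ℂ), s ^ 2 • F - A s • ∂_{(1 : ℝ)} (∂_{(1 : ℝ)} F) = f := by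
  let F (f : 𝓢(ℝ, ℂ)) : 𝓢(ℝ, ℂ) := sliceX 0 (U (tensorTest f (expTest s hs)))
  have hF : ∀ f x, F f x = correlation (S : 𝓢(ℝ × ℝ, ℂ) →L[ℂ] ℂ) (tensorTest f (expTest s hs))
      (x, 0) := fun f x => by
    rw [sliceX_apply, hU, timeCutoff_of_ge (by norm_num), one_mul]
  have hFS : ∀ f x, F f x = S (tensorTest (SchwartzMap.compSubConstCLM ℂ (-x) f) (expTest s hs)) :=
    fun f x => (hF f x).trans (by rw [← compSubConstCLM_tensorTest]; rfl)
  have hder : ∀ f, ∂_{(1 : ℝ)} (F f) = F (∂_{(1 : ℝ)} f) := by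
    intro f
    ext x
    have h1 := hasFDerivAt_correlation (S : 𝓢(ℝ × ℝ, ℂ) →L[ℂ] ℂ) (tensorTest f (expTest s hs)) (x, 0)
    have h2 : HasDerivAt (fun x : ℝ => ((x, 0) : ℝ × ℝ)) (1, 0) x :=
      (hasDerivAt_id x).prodMk (hasDerivAt_const x 0)
    have h3 := h1.comp_hasDerivAt x h2
    have h4 : ⇑(F f) = (correlation (S : 𝓢(ℝ × ℝ, ℂ) →L[ℂ] ℂ) (tensorTest f (expTest s hs))) ∘
        fun x : ℝ => ((x, 0) : ℝ × ℝ) := funext fun x => hF f x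
    rw [(hasDerivAt_schwartz (F f) x).unique (h4 ▸ h3), hF, lineDerivOp_fst_tensorTest]
    simp
  refine ⟨F f, ?_⟩
  ext x
  rw [hder, hder, sub_apply, smul_apply, smul_apply, smul_eq_mul, smul_eq_mul, hFS, hFS,
    map_tensorTest_identity hQ hAQ hS hs, lineDerivOp_compSubConstCLM, lineDerivOp_compSubConstCLM,
    SchwartzMap.compSubConstCLM_apply]
  simp

end FundamentalSolution

/-! ### Existence and uniqueness for the Cauchy problem -/

section CauchyProblem

variable {a : 𝓢'(ℝ, ℂ)} {A Q : ℂ → ℂ}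

theorem exists_fundamentalSolution_cauchyProblem
    (hQ : ∀ s : ℂ, 0 < s.re → s ^ 2 * Q s ∈ Complex.slitPlane)
    (hd : DifferentiableOn ℂ Q {s | 0 < s.re}) (hg : HasPolyGrowth Q)
    (hAQ : ∀ s : ℂ, 0 < s.re → A s * Q s = 1) (ha : IsInverseLaplace a A)
    {G : 𝓢'(ℝ × ℝ, ℂ)} (hG : Distribution.IsVanishingOn G {p : ℝ × ℝ | p.2 < 0}) :
    ∃ S u : 𝓢'(ℝ × ℝ, ℂ), IsInverseLaplaceT S (kernelLaplace Q) ∧ IsFundamentalSolution a S ∧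
      IsConv S G u ∧ IsSolution a G u ∧ ∀ w : 𝓢'(ℝ × ℝ, ℂ), IsSolution a G w → w = u := by
  obtain ⟨T, hT⟩ := ha.exists_clm
  obtain ⟨S, hS, hSd⟩ := exists_kernelLaplace_inverse hQ hd hg
  obtain ⟨U, hU⟩ := hSd.exists_clm
  -- Since `U φ` is the cut-off function `y ↦ ⟨S(z), φ(z + y)⟩`, this is the convolution of `S` with
  -- `G`.
  let u : 𝓢'(ℝ × ℝ, ℂ) := PointwiseConvergenceCLM.precomp ℂ U G
  have hu : ∀ φ, u φ = G (U φ) := fun φ => rfl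
  have hU1 : ∀ φ y, -1 < y.2 → U φ y = S (SchwartzMap.compSubConstCLM ℂ (-y) φ) := fun φ y hy => by
    rw [hU, timeCutoff_of_ge hy.le, one_mul]
    rfl
  have hu0 : Distribution.IsVanishingOn u {p : ℝ × ℝ | p.2 < 0} := by
    intro φ hφ
    rw [hu, ← map_zero G]
    refine map_eq_of_eqOn_pos hG fun p hp => ?_
    rw [hU1 _ _ (by linarith)]
    have h2 : S (SchwartzMap.compSubConstCLM ℂ (-p) φ) = S 0 :=
      map_eq_of_eqOn hS.1 (b := -p.2) (by linarith) fun q hq => by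
        rw [SchwartzMap.compSubConstCLM_apply, eq_zero_of_tsupport_subset hφ]
        · rfl
        · simp only [sub_neg_eq_add, Prod.snd_add]
          linarith
    rw [h2, map_zero]
    rfl
  have husol : ∀ φ, u (∂_{((0, 1) : ℝ × ℝ)} (∂_{((0, 1) : ℝ × ℝ)} φ)) =
      u (∂_{((1, 0) : ℝ × ℝ)} (∂_{((1, 0) : ℝ × ℝ)} (T φ))) + G φ := by
    intro φ
    rw [hu, hu, ← map_add]
    refine map_eq_of_eqOn_pos hG fun p hp => ?_
    rw [add_apply, hU1 _ _ (by linarith), hU1 _ _ (by linarith)]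
    exact correlation_dt_dt_sub hQ hAQ ha hT hS φ hp
  refine ⟨S, u, hS, (isSolution_iff hT _ _).2 ⟨hS.1, fun φ => ?_⟩, fun φ => ⟨U φ, hU1 φ, rfl⟩,
    (isSolution_iff hT _ _).2 ⟨hu0, husol⟩, fun w hw => ?_⟩
  · exact map_dt_dt_eq hQ hAQ ha hT hS φ
  · obtain ⟨hw0, hw⟩ := (isSolution_iff hT _ _).1 hw
    refine eq_of_laplace_eq hw0 hu0 fun s hs f => ?_
    -- Writing the test function as `s²F - A F''` makes the value of any solution at it equal to
    -- that of `G` at `F exp(-st)`, which does not depend on the solution.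
    obtain ⟨F, rfl⟩ := exists_ode_solution hQ hAQ hS hU hs f
    have h1 : ∀ v : 𝓢'(ℝ × ℝ, ℂ), Distribution.IsVanishingOn v {p : ℝ × ℝ | p.2 < 0} →
        (∀ φ, v (∂_{((0, 1) : ℝ × ℝ)} (∂_{((0, 1) : ℝ × ℝ)} φ)) =
          v (∂_{((1, 0) : ℝ × ℝ)} (∂_{((1, 0) : ℝ × ℝ)} (T φ))) + G φ) →
        v (tensorTest (s ^ 2 • F - A s • ∂_{(1 : ℝ)} (∂_{(1 : ℝ)} F)) (expTest s hs)) =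
          G (tensorTest F (expTest s hs)) := by
      intro v hv0 hv
      have h2 := hv (tensorTest F (expTest s hs))
      rw [dt_dt_map_tensorTest hv0 hs, dx_dx_clm_tensorTest ha hT hv0 hs] at h2
      rw [sub_eq_add_neg, ← neg_smul, tensorTest_add, tensorTest_smul, tensorTest_smul, map_add,
        map_smul, map_smul, smul_eq_mul, smul_eq_mul, h2]
      ring
    rw [h1 w hw0 hw, h1 u hu0 husol]

end CauchyProblem

end ViscoWave

theorem mainTheorem1
    (φσ φε : 𝓢'(ℝ, ℂ))
    (hσ : Distribution.dsupport φσ ⊆ Set.Icc (0 : ℝ) 1)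
    (hε : Distribution.dsupport φε ⊆ Set.Icc (0 : ℝ) 1)
    (u₀ v₀ : 𝓢'(ℝ, ℂ))
    (a : 𝓢'(ℝ, ℂ))
    (hA1 : ViscoWave.IsInverseLaplace a (fun s => ViscoWave.Phi φε s / ViscoWave.Phi φσ s))
    (hA2 : ∀ s : ℂ, 0 < s.re →
      s ^ 2 * (ViscoWave.Phi φσ s / ViscoWave.Phi φε s) ∈ Complex.slitPlane)
    (hA3 : ∃ b : 𝓢'(ℝ, ℂ),
      ViscoWave.IsInverseLaplace b (fun s => ViscoWave.Phi φσ s / ViscoWave.Phi φε s)) :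
    ∃ S u : 𝓢'(ℝ × ℝ, ℂ),
      ViscoWave.IsInverseLaplaceT S
        (ViscoWave.kernelLaplace (fun s => ViscoWave.Phi φσ s / ViscoWave.Phi φε s)) ∧
      ViscoWave.IsFundamentalSolution a S ∧
      ViscoWave.IsConv S (ViscoWave.cauchyData u₀ v₀) u ∧
      ViscoWave.IsSolution a (ViscoWave.cauchyData u₀ v₀) u ∧
      ∀ w : 𝓢'(ℝ × ℝ, ℂ),
        ViscoWave.IsSolution a (ViscoWave.cauchyData u₀ v₀) w → w = u := by
  -- (A3) enters through the holomorphy and polynomial growth of Φ_σ/Φ_ε.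
  obtain ⟨b, hb⟩ := hA3
  refine ViscoWave.exists_fundamentalSolution_cauchyProblem hA2 hb.differentiableOn hb.polyGrowth
    (fun s hs => ?_) hA1 (ViscoWave.isVanishingOn_cauchyData u₀ v₀)
  -- The slit plane omits `0`, so (A2) makes Φ_σ/Φ_ε nonzero and the two quotients mutually inverse.
  have h := right_ne_zero_of_mul (Complex.slitPlane_ne_zero (hA2 s hs))
  rw [← inv_div]
  exact inv_mul_cancel₀ h
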